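/- **Setting.** Let $u_m>0$ and $w(\sigma):=u_m\,\mathrm{mod}(\sigma+\tfrac12,1)-\tfrac{u_m}{2}$. The PWM encoder of range $[-u_m,u_m]$ is $\mathcal M(u,\sigma):=-u_m$ if $u-u_m<4w(\sigma)\le u_m-u$, and $\mathcal M(u,\sigma):=u_m$ otherwise. For $|u|\le u_m$ it is 1-periodic with mean $u$ in $\sigma$. The induced probing signal is $s_0(u,\sigma):=\mathcal M(u,\sigma)-u$, which is discontinuous in both arguments, and its zero-mean primitive in $\sigma$ (for $|u|\le u_m$) is $$s_1(u,\sigma):=\bigl(1-\tfrac{u}{u_m}\bigr)w(\sigma)-\bigl|\tfrac{u-u_m}{4}-w(\sigma)\bigr|+\bigl|\tfrac{u-u_m}{4}+w(\sigma)\bigr|.$$ Let $f,g:\mathbb R^n\to\mathbb R^n$ be $C^2$ and $h:\mathbb R^n\to\mathbb R$ be $C^3$. For $\varepsilon>0$ put $H_0(x):=h(x)$, $H_1(x):=\varepsilon h'(x)g(x)$ and $H:=(H_0,H_1)$. Let $\alpha(\eta,Y,t)\in\mathbb R$ and $a(\eta,Y,t)\in\mathbb R^q$ be $C^2$ functions of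 $(\eta,Y,t)\in\mathbb R^q\times\mathbb R^2\times\mathbb R$, whose derivatives of order at most $2$ are bounded on $C\times[0,\infty)$ for every compact $C\subset\mathbb R^q\times\mathbb R^2$. The ideal closed loop is $$\dot{\bar x}=f(\bar x)+g(\bar x)\,\alpha(\bar\eta,H(\bar x),t),\qquad \dot{\bar\eta}=a(\bar\eta,H(\bar x),t).\tag{I}$$ Let $\bar H=\bar H_\varepsilon(x,\eta,\sigma,t)\in\mathbb R^2$ be any function with $$\bar H_\varepsilon(x,\eta,\sigma,t)=H\Bigl(x-\varepsilon g(x)\,s_1\bigl(\alpha(\eta,H(x),t),\sigma\bigr)\Bigr)+O(\varepsilon^2),$$ uniformly in $\sigma\in\mathbb R$ and $t\ge0$ and locally uniformly in $(x,\eta)$. The PWM-fed closed loop is $$\dot x=f(x)+g(x)\,\mathcal M\bigl(\alpha(\eta,\bar H_\varepsilon(x,\eta,\tfrac t\varepsilon,t),t),\tfrac t\varepsilon\bigr),\qquad \dot\eta=a\bigl(\eta,\bar H_\varepsilon(x,\eta,\tfrac t\varepsilon,t),t\bigr),\tag{P}$$ whose solutions are understood in the sense of Carathéodory (absolutely continuous,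 equal to the integral of the right-hand side). **Theorem 1.** Fix $(x_0,\eta_0)$. Assume that for all small $\varepsilon$ the ideal loop (I) has exponentially stable behavior: (I) has a solution $X^*_\varepsilon$ on $[0,\infty)$, bounded uniformly in $\varepsilon$, and there are $r,k,\lambda>0$ independent of $\varepsilon$ such that, for all $s\ge0$, every solution $X$ of (I) with $|X(s)-X^*_\varepsilon(s)|\le r$ exists for all $t\ge s$ and satisfies $|X(t)-X^*_\varepsilon(t)|\le k e^{-\lambda(t-s)}|X(s)-X^*_\varepsilon(s)|$; and $|(x_0,\eta_0)-X^*_\varepsilon(0)|\le r$. Let $(\bar x,\bar\eta)$ be the solution of (I) starting from $\bigl(x_0-\varepsilon g(x_0)s_1(\alpha(\eta_0,H(x_0),0),0),\,\eta_0\bigr)$, and put $\bar u(t):=\alpha(\bar\eta(t),H(\bar x(t)),t)$. Assume that $|\alpha(\eta,H(x),t)|\le u_m$ for all $t\ge0$ and all $(x,\eta)$ at distance at most $\rho$ of $(\bar x(t),\bar\eta(t))$, for some $\rho>0$ independent of $\varepsilon$. Then there are $\varepsilon_0>0$ and $K>0$ such that, for all $\varepsilon\in(0,\varepsilon_0)$,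 every solution $(x,\eta)$ of (P) starting from $(x_0,\eta_0)$ satisfies, with $y(t):=h(x(t))$, $$x(t)=\bar x(t)+\varepsilon g(\bar x(t))\,s_1\bigl(\bar u(t),\tfrac t\varepsilon\bigr)+O(\varepsilon^2),\qquad \eta(t)=\bar\eta(t)+O(\varepsilon^2),$$ $$y(t)=H_0(\bar x(t))+H_1(\bar x(t))\,s_1\bigl(\bar u(t),\tfrac t\varepsilon\bigr)+O(\varepsilon^2)$$ for all $t\ge0$ for which it is defined, where each $O(\varepsilon^2)$ is bounded by $K\varepsilon^2$, with $K$ independent of $t$ and $\varepsilon$. If moreover the $O(\varepsilon^2)$ remainder in $\bar H_\varepsilon$ is, locally uniformly in $(x,\eta)$, Lipschitz in $(x,\eta,\sigma,t)$ with an $O(\varepsilon^2)$ Lipschitz constant (for instance if it is zero), then for all $\varepsilon\in(0,\varepsilon_0)$ the solution of (P) starting from $(x_0,\eta_0)$ exists for all $t\ge0$ and is unique, so that the estimates hold for all $t\ge0$. -/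

import Mathlib

open Set MeasureTheory

noncomputable section

/-- The sawtooth wrapping the normalized time `σ` to an interval of length `um` around `0`. -/
def wrap (um σ : ℝ) : ℝ := um * Int.fract (σ + 1 / 2) - um / 2

/-- The PWM encoder of range `[-um, um]`: its output is `-um` exactly when
`u - um < 4 * wrap σ ≤ um - u`, and `um` otherwise. -/
def pwm (um u σ : ℝ) : ℝ :=
  if u - um < 4 * wrap um σ ∧ 4 * wrap um σ ≤ um - u then -um else um

/-- The probing signal induced by the PWM process. -/
def s0 (um u σ : ℝ) : ℝ := pwm um u σ - u

/-- The zero-mean primitive of `s0` in the second argument (for `u` in the range `[-um, um]`). -/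
def s1 (um u σ : ℝ) : ℝ :=
  (1 - u / um) * wrap um σ - |(u - um) / 4 - wrap um σ| + |(u - um) / 4 + wrap um σ|

/-- `X` solves `dX/dt = F(t, X)` on `[s, T]` in the sense of Carathéodory (the right-hand side
may be discontinuous): the right-hand side is integrable along `X`, and `X` is its integral. -/
def IsSolution {V : Type*} [NormedAddCommGroup V] [NormedSpace ℝ V]
    (F : ℝ → V → V) (s T : ℝ) (X : ℝ → V) : Prop :=
  IntervalIntegrable (fun τ => F τ (X τ)) volume s T ∧
    ∀ t ∈ Icc s T, X t = X s + ∫ τ in s..t, F τ (X τ)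

/-- The solution `Z` of `dX/dt = F(t, X)` on `[0, ∞)` is uniformly exponentially stable, with
radius `r`, gain `k` and rate `lam`: for all `s ≥ 0`, a solution starting at time `s` at distance
at most `r` of `Z s` is defined for all `t ≥ s` and converges exponentially to `Z`. -/
def ExpStable {V : Type*} [NormedAddCommGroup V] [NormedSpace ℝ V]
    (F : ℝ → V → V) (r k lam : ℝ) (Z : ℝ → V) : Prop :=
  (∀ T, 0 ≤ T → IsSolution F 0 T Z) ∧
    ∀ s, 0 ≤ s → ∀ p : V, ‖p - Z s‖ ≤ r →
      ∃ Y : ℝ → V, Y s = p ∧ (∀ T, s ≤ T → IsSolution F s T Y) ∧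
        ∀ t, s ≤ t → ‖Y t - Z t‖ ≤ k * Real.exp (-lam * (t - s)) * ‖p - Z s‖

/-- A time-dependent feedback function `φ(η, Y, t)` that is of class `C²`, with derivatives of
order at most `2` bounded uniformly in time, locally uniformly in `(η, Y)`. -/
def UniformC2 {Q G : Type*} [NormedAddCommGroup Q] [NormedSpace ℝ Q]
    [NormedAddCommGroup G] [NormedSpace ℝ G] (φ : Q → ℝ × ℝ → ℝ → G) : Prop :=
  ContDiff ℝ 2 (fun z : Q × (ℝ × ℝ) × ℝ => φ z.1 z.2.1 z.2.2) ∧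
    ∀ C : Set (Q × (ℝ × ℝ)), IsCompact C → ∃ B : ℝ, ∀ p ∈ C, ∀ t : ℝ, 0 ≤ t → ∀ m : ℕ, m ≤ 2 →
      ‖iteratedFDeriv ℝ m (fun z : Q × (ℝ × ℝ) × ℝ => φ z.1 z.2.1 z.2.2) (p.1, p.2, t)‖ ≤ B

section ClosedLoop

variable {E Q : Type*} [NormedAddCommGroup E] [NormedSpace ℝ E]
  [NormedAddCommGroup Q] [NormedSpace ℝ Q]

/-- The virtual output `H₁(x) = ε h'(x) g(x)`. -/
def virtualOutput (g : E → E) (h : E → ℝ) (ε : ℝ) (x : E) : ℝ := ε * fderiv ℝ h x (g x)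

/-- The extended output `H(x) = (h(x), ε h'(x) g(x))`. -/
def extOutput (g : E → E) (h : E → ℝ) (ε : ℝ) (x : E) : ℝ × ℝ := (h x, virtualOutput g h ε x)

/-- The ideal closed loop, without PWM and with the controller fed by `H(x)`. -/
def idealField (f g : E → E) (h : E → ℝ) (α : Q → ℝ × ℝ → ℝ → ℝ) (a : Q → ℝ × ℝ → ℝ → Q)
    (ε t : ℝ) (X : E × Q) : E × Q :=
  (f X.1 + α X.2 (extOutput g h ε X.1) t • g X.1, a X.2 (extOutput g h ε X.1) t)

/-- The PWM-fed closed loop, with the controller fed by `Hb(x, η, t/ε, t)`. -/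
def pwmField (um : ℝ) (f g : E → E) (α : Q → ℝ × ℝ → ℝ → ℝ) (a : Q → ℝ × ℝ → ℝ → Q)
    (Hb : ℝ → E → Q → ℝ → ℝ → ℝ × ℝ) (ε t : ℝ) (X : E × Q) : E × Q :=
  (f X.1 + pwm um (α X.2 (Hb ε X.1 X.2 (t / ε) t) t) (t / ε) • g X.1,
    a X.2 (Hb ε X.1 X.2 (t / ε) t) t)

/-- The corrected output without remainder, `H(x - ε g(x) s₁(α(η, H(x), t), σ))`. -/
def correctedOutput (um : ℝ) (g : E → E) (h : E → ℝ) (α : Q → ℝ × ℝ → ℝ → ℝ)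
    (ε : ℝ) (X : E × Q) (σ t : ℝ) : ℝ × ℝ :=
  extOutput g h ε (X.1 - (ε * s1 um (α X.2 (extOutput g h ε X.1) t) σ) • g X.1)

/-- `Hb` equals the corrected output up to `O(ε²)`, uniformly in `σ` and in `t ≥ 0`, and locally
uniformly in `(x, η)`. -/
def IsCorrectedOutput (um : ℝ) (g : E → E) (h : E → ℝ) (α : Q → ℝ × ℝ → ℝ → ℝ)
    (Hb : ℝ → E → Q → ℝ → ℝ → ℝ × ℝ) : Prop :=
  ∀ C : Set (E × Q), IsCompact C → ∃ B ε₁ : ℝ, 0 < ε₁ ∧ ∀ ε ∈ Ioo 0 ε₁, ∀ X ∈ C,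
    ∀ σ t : ℝ, 0 ≤ t → ‖Hb ε X.1 X.2 σ t - correctedOutput um g h α ε X σ t‖ ≤ B * ε ^ 2

/-- The `O(ε²)` remainder in `Hb` is Lipschitz, with a Lipschitz constant that is `O(ε²)`
as well (in particular, this holds when there is no remainder). -/
def LipschitzRemainder (um : ℝ) (g : E → E) (h : E → ℝ) (α : Q → ℝ × ℝ → ℝ → ℝ)
    (Hb : ℝ → E → Q → ℝ → ℝ → ℝ × ℝ) : Prop :=
  ∀ C : Set (E × Q), IsCompact C → ∃ B ε₁ : ℝ, 0 < ε₁ ∧ ∀ ε ∈ Ioo 0 ε₁, ∀ X ∈ C, ∀ X' ∈ C,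
    ∀ σ σ' t t' : ℝ, 0 ≤ t → 0 ≤ t' →
      ‖(Hb ε X.1 X.2 σ t - correctedOutput um g h α ε X σ t) -
        (Hb ε X'.1 X'.2 σ' t' - correctedOutput um g h α ε X' σ' t')‖
        ≤ B * ε ^ 2 * (‖X - X'‖ + |σ - σ'| + |t - t'|)

end ClosedLoop

end

/-! The PWM period is `ε`, so the heart of the matter is a one-step estimate: over a full period, a
PWM-fed solution departs from the ideal flow by only `O(ε³)`. Summed over the `O(1/ε)` periods of a
bounded time interval this gives `O(ε²)`, and exponential stability prevents further accumulation on
`[0, ∞)`. At period boundaries the ripple `s₁` vanishes, so there the PWM-fed and ideal states are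
compared directly. In particular, both loops start from the same state.

The one-step estimate is a bootstrap in normalized time `θ`. The state moves by `O(ε)`, so the
measured duty cycle is `O(ε)`-close to its initial value `u`. Although the encoder is discontinuous,
an error `D` on a slowly varying duty cycle alters its output only on a set of measure `O(D)`
(`exists_pwm_disagreement`), because the carrier crosses the thresholds transversally. Since `u θ +
s₁(u, θ)` is the primitive of the PWM signal (`integral_pwm`), the state is the Euler curve of the
ideal loop plus `ε s₁ g`, up to `O(ε²)` (`norm_fst_sub_le`). The corrected output removes exactly
this ripple, so the measured feedbacks are the ideal ones along the Euler curve up to `O(ε²)`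
(`norm_measured_sub_euler_le`), and the duty cycle is affine in `θ` at that order. Substituting this
back, every first-order oscillating term has zero mean over a period: `s₁`, `θ s₀` and `s₁ M` by
symmetry about `θ = 1/2`. An affine duty cycle `u + θ δ` produces the mean `u + δ/2` up to `O(δ²)`
(`abs_integral_pwm_affine_sub_le`). What remains is the ideal field integrated along the Euler curve
(`norm_end_sub_le`).

For infinite time, exponential stability of a single reference makes nearby ideal solutions contract
towards one another over a fixed time (`exists_contraction_of_expStable`). `grid_error_le` uses this
to halve old errors while the errors of the last window supply the other half of the bound `K ε²`.
Between grid times the first-order expansion suffices (`estimates_ideal`).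

When the remainder is Lipschitz, the same small-measure property makes the integral operator of the
discontinuous loop a contraction on slowly moving curves over one period. Existence and uniqueness
then extend period by period, because tracking keeps every grid state in the region where the
argument applies. -/

/-! ### The encoder and its ripple over one period. -/

theorem wrap_add_natCast (um σ : ℝ) (j : ℕ) : wrap um (j + σ) = wrap um σ := by
  unfold wrap
  rw [add_assoc, Int.fract_natCast_add]

theorem pwm_add_natCast (um u σ : ℝ) (j : ℕ) : pwm um u (j + σ) = pwm um u σ := by
  unfold pwm
  rw [wrap_add_natCast]

theorem s1_add_natCast (um u σ : ℝ) (j : ℕ) : s1 um u (j + σ) = s1 um u σ := by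
  unfold s1
  rw [wrap_add_natCast]

theorem wrap_of_lt_half {um θ : ℝ} (h0 : 0 ≤ θ) (h1 : θ < 1 / 2) : wrap um θ = um * θ := by
  have : Int.fract (θ + 1 / 2) = θ + 1 / 2 :=
    Int.fract_eq_iff.2 ⟨by linarith, by linarith, 0, by simp⟩
  rw [wrap, this]; ring

theorem wrap_of_half_le {um θ : ℝ} (h0 : 1 / 2 ≤ θ) (h1 : θ ≤ 1) :
    wrap um θ = um * (θ - 1) := by
  have : Int.fract (θ + 1 / 2) = θ - 1 / 2 :=
    Int.fract_eq_iff.2 ⟨by linarith, by linarith, 1, by push_cast; ring⟩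
  rw [wrap, this]; ring

theorem wrap_eq_or {um θ : ℝ} (h : θ ∈ Icc (0 : ℝ) 1) :
    wrap um θ = um * θ ∨ wrap um θ = um * (θ - 1) := by
  rcases lt_or_ge θ (1 / 2) with h' | h'
  · exact Or.inl (wrap_of_lt_half h.1 h')
  · exact Or.inr (wrap_of_half_le h' h.2)

theorem measurable_wrap (um : ℝ) : Measurable (wrap um) := by
  unfold wrap
  fun_prop

theorem abs_wrap_le {um : ℝ} (hum : 0 < um) (σ : ℝ) : |wrap um σ| ≤ um / 2 := by
  have h0 := Int.fract_nonneg (σ + 1 / 2)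
  have h1 := (Int.fract_lt_one (σ + 1 / 2)).le
  rw [wrap, abs_le]
  constructor <;> nlinarith

theorem abs_pwm {um : ℝ} (hum : 0 < um) (u σ : ℝ) : |pwm um u σ| = um := by
  unfold pwm
  split_ifs <;> simp [abs_of_pos hum]

theorem measurable_pwm_comp {um : ℝ} {u σ : ℝ → ℝ} (hu : Measurable u) (hσ : Measurable σ) :
    Measurable fun t => pwm um (u t) (σ t) := by
  unfold pwm
  have hw := (measurable_wrap um).comp hσ
  refine Measurable.ite ?_ measurable_const measurable_const
  exact (measurableSet_lt (hu.sub_const um) (hw.const_mul 4)).inter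
    (measurableSet_le (hw.const_mul 4) (hu.const_sub um))

theorem s1_zero (um u : ℝ) : s1 um u 0 = 0 := by
  rw [s1, wrap_of_lt_half le_rfl (by norm_num)]
  simp

/-- The linear term has slope at most `1/2` in `u` because `|w| ≤ um / 2`, and each absolute value
has slope `1/4`. The ripple is thus Lipschitz in the duty cycle even though the PWM signal jumps. -/
theorem abs_s1_sub_le {um : ℝ} (hum : 0 < um) (u u' σ : ℝ) :
    |s1 um u σ - s1 um u' σ| ≤ |u - u'| := by
  have hw := abs_wrap_le hum σ
  set w := wrap um σ with hwd
  have e : s1 um u σ - s1 um u' σ = -((u - u') * (w / um)) -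
      (|(u - um) / 4 - w| - |(u' - um) / 4 - w|) + (|(u - um) / 4 + w| - |(u' - um) / 4 + w|) := by
    simp only [s1, ← hwd]; ring
  have h1 : |(u - u') * (w / um)| ≤ |u - u'| * (1 / 2) := by
    rw [abs_mul, abs_div, abs_of_pos hum]
    refine mul_le_mul_of_nonneg_left ?_ (abs_nonneg _)
    rw [div_le_iff₀ hum]; linarith
  have h2 := abs_abs_sub_abs_le ((u - um) / 4 - w) ((u' - um) / 4 - w)
  have h3 := abs_abs_sub_abs_le ((u - um) / 4 + w) ((u' - um) / 4 + w)
  have h4 : |(u - um) / 4 - w - ((u' - um) / 4 - w)| = |u - u'| / 4 := by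
    rw [show (u - um) / 4 - w - ((u' - um) / 4 - w) = (u - u') / 4 by ring, abs_div]; norm_num
  have h5 : |(u - um) / 4 + w - ((u' - um) / 4 + w)| = |u - u'| / 4 := by
    rw [show (u - um) / 4 + w - ((u' - um) / 4 + w) = (u - u') / 4 by ring, abs_div]; norm_num
  rw [e]
  rw [h4] at h2
  rw [h5] at h3
  rw [abs_le] at h1 h2 h3 ⊢
  constructor <;> linarith [h1.1, h1.2, h2.1, h2.2, h3.1, h3.2]

theorem s1_self (um σ : ℝ) (hum : 0 < um) : s1 um um σ = 0 := by
  simp [s1, hum.ne']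

/-- Comparison with `u = um`, where the ripple vanishes. No range condition is imposed on `u`, so
the bound also covers states whose duty cycle saturates. -/
theorem abs_s1_le {um : ℝ} (hum : 0 < um) (u σ : ℝ) : |s1 um u σ| ≤ |u - um| := by
  simpa [s1_self um σ hum] using abs_s1_sub_le hum u um σ

theorem abs_s1_le_of_abs_le {um : ℝ} (hum : 0 < um) {u : ℝ} (hu : |u| ≤ um) (σ : ℝ) :
    |s1 um u σ| ≤ 2 * um := by
  refine (abs_s1_le hum u σ).trans ?_
  rw [abs_le] at hu ⊢
  constructor <;> linarith [hu.1, hu.2]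

/-- Along an affine duty cycle, the PWM output over a period is a two-threshold step function. -/
theorem pwm_affine_eq_step {um : ℝ} (hum : 0 < um) {u δ : ℝ} (hu : |u| ≤ um)
    (hu' : |u + δ| ≤ um) {θ : ℝ} (h0 : 0 < θ) (h1 : θ ≤ 1) (h2 : θ ≠ 1 / 2) :
    pwm um (u + θ * δ) θ = -um + 2 * um *
      (Ioc ((um - u) / (4 * um + δ)) ((3 * um + u) / (4 * um - δ))).indicator 1 θ := by
  rw [abs_le] at hu hu'
  have hp : 0 < 4 * um + δ := by linarith
  have hm : 0 < 4 * um - δ := by linarith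
  -- The endpoints are where the carrier meets the moving thresholds: `4 um θ = um - (u + θ δ)`
  -- before mid-period and `4 um (θ - 1) = (u + θ δ) - um` after it. At `θ = 1/2` the formula fails
  -- in the degenerate case `u = -um`, `δ = 0`, whence the exclusion.
  have key : θ ∈ Ioc ((um - u) / (4 * um + δ)) ((3 * um + u) / (4 * um - δ)) ↔
      um - u < θ * (4 * um + δ) ∧ θ * (4 * um - δ) ≤ 3 * um + u := by
    rw [mem_Ioc, div_lt_iff₀ hp, le_div_iff₀ hm]
  have hconv : -um ≤ u + θ * δ ∧ u + θ * δ ≤ um := by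
    constructor <;> nlinarith
  unfold pwm
  rcases lt_or_gt_of_ne h2 with h | h
  · rw [wrap_of_lt_half h0.le h]
    have hpos : 0 < um * θ := by positivity
    split_ifs with hc
    · rw [indicator_of_notMem]
      · simp
      · rw [key]; intro hk; linarith [hc.2, hk.1]
    · rw [indicator_of_mem]
      · simp; ring
      · rw [key]
        have : ¬ 4 * (um * θ) ≤ um - (u + θ * δ) := fun hh => hc ⟨by linarith, hh⟩
        constructor <;> nlinarith
  · rw [wrap_of_half_le h.le h1]
    have hneg : um * (θ - 1) ≤ 0 := by nlinarith
    split_ifs with hc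
    · rw [indicator_of_notMem]
      · simp
      · rw [key]; intro hk; linarith [hc.1, hk.2]
    · rw [indicator_of_mem]
      · simp; ring
      · rw [key]
        have : ¬ u + θ * δ - um < 4 * (um * (θ - 1)) := fun hh => hc ⟨hh, by linarith⟩
        constructor <;> nlinarith

theorem integral_indicator_Ioc {a b θ : ℝ} (ha : 0 ≤ a) (hab : a ≤ b) (hθ : 0 ≤ θ) :
    ∫ σ in (0 : ℝ)..θ, (Ioc a b).indicator (1 : ℝ → ℝ) σ = min θ b - min θ a := by
  rw [intervalIntegral.integral_of_le hθ, setIntegral_indicator measurableSet_Ioc]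
  simp only [Pi.one_apply, integral_const, smul_eq_mul, mul_one, measureReal_restrict_apply_univ]
  rw [Ioc_inter_Ioc, Real.volume_real_Ioc, max_eq_right ha]
  rcases le_total θ b with h | h <;> rcases le_total θ a with h' | h' <;>
    simp [*] <;> linarith

theorem ae_ne_real (c : ℝ) : ∀ᵐ θ : ℝ, θ ≠ c := by
  simp [ae_iff]

theorem integral_pwm_affine {um : ℝ} (hum : 0 < um) {u δ : ℝ} (hu : |u| ≤ um)
    (hu' : |u + δ| ≤ um) {θ : ℝ} (hθ : θ ∈ Icc (0 : ℝ) 1) :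
    ∫ σ in (0 : ℝ)..θ, pwm um (u + σ * δ) σ = -um * θ + 2 * um *
      (min θ ((3 * um + u) / (4 * um - δ)) - min θ ((um - u) / (4 * um + δ))) := by
  have hu1 := abs_le.1 hu
  have hu2 := abs_le.1 hu'
  have hp : 0 < 4 * um + δ := by linarith
  have hm : 0 < 4 * um - δ := by linarith
  have hae : ∀ᵐ σ : ℝ, σ ∈ uIoc 0 θ → pwm um (u + σ * δ) σ = -um + 2 * um *
      (Ioc ((um - u) / (4 * um + δ)) ((3 * um + u) / (4 * um - δ))).indicator (1 : ℝ → ℝ) σ := by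
    filter_upwards [ae_ne_real (1 / 2)] with σ hσ hσ'
    rw [uIoc_of_le hθ.1] at hσ'
    exact pwm_affine_eq_step hum hu hu' hσ'.1 (hσ'.2.trans hθ.2) hσ
  have ha : 0 ≤ (um - u) / (4 * um + δ) := div_nonneg (by linarith) hp.le
  have ha' : (um - u) / (4 * um + δ) ≤ 1 / 2 := by
    rw [div_le_iff₀ hp]; linarith
  have hb : 1 / 2 ≤ (3 * um + u) / (4 * um - δ) := by
    rw [le_div_iff₀ hm]; linarith
  have hint : IntervalIntegrable (fun σ => 2 * um *
      (Ioc ((um - u) / (4 * um + δ)) ((3 * um + u) / (4 * um - δ))).indicator (1 : ℝ → ℝ) σ)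
      volume 0 θ := by
    refine IntervalIntegrable.const_mul ?_ _
    rw [intervalIntegrable_iff]
    exact (integrableOn_const (by simp : volume (uIoc 0 θ) ≠ ⊤)).indicator measurableSet_Ioc
  rw [intervalIntegral.integral_congr_ae hae, intervalIntegral.integral_add (by simp) hint,
    intervalIntegral.integral_const_mul,
    integral_indicator_Ioc ha (ha'.trans hb) hθ.1, intervalIntegral.integral_const]
  simp; ring

/-- This identifies the closed form of `s1` as the primitive of `s0`, for a duty cycle in range. -/
theorem integral_pwm {um : ℝ} (hum : 0 < um) {u : ℝ} (hu : |u| ≤ um) {θ : ℝ}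
    (hθ : θ ∈ Icc (0 : ℝ) 1) :
    ∫ σ in (0 : ℝ)..θ, pwm um u σ = u * θ + s1 um u θ := by
  have h := integral_pwm_affine hum hu (δ := 0) (by simpa using hu) hθ
  simp only [mul_zero, add_zero, sub_zero] at h
  rw [h]
  rw [abs_le] at hu
  have ha : (um - u) / (4 * um) = (um - u) / 4 / um := by field_simp
  have hb : (3 * um + u) / (4 * um) = 1 - (um - u) / 4 / um := by field_simp; ring
  -- For a constant duty cycle the switching instants are `c` and `1 - c`. In terms of `c` both
  -- sides are piecewise affine in `θ`, with breaks only there.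
  obtain ⟨c, hc⟩ : ∃ c, c = (um - u) / 4 / um := ⟨_, rfl⟩
  have hu' : u = um - 4 * um * c := by rw [hc]; field_simp; ring
  have hc0 : 0 ≤ c := by rw [hc]; exact div_nonneg (by linarith) hum.le
  have hc1 : c ≤ 1 / 2 := by rw [hc, div_le_iff₀ hum]; linarith
  rw [ha, hb, ← hc, s1, hu']
  have e0 : (um - 4 * um * c) / um = 1 - 4 * c := by field_simp
  have e1 : (um - 4 * um * c - um) / 4 = -(um * c) := by ring
  rw [e0, e1]
  rcases lt_or_ge θ (1 / 2) with h' | h'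
  · rw [wrap_of_lt_half hθ.1 h', min_eq_left (by linarith : θ ≤ 1 - c),
      show -(um * c) - um * θ = -(um * (c + θ)) by ring, abs_neg,
      abs_of_nonneg (mul_nonneg hum.le (add_nonneg hc0 hθ.1)),
      show -(um * c) + um * θ = um * (θ - c) by ring, abs_mul, abs_of_pos hum]
    rcases le_total θ c with h'' | h''
    · rw [min_eq_left h'', abs_of_nonpos (by linarith)]; ring
    · rw [min_eq_right h'', abs_of_nonneg (by linarith)]; ring
  · rw [wrap_of_half_le h' hθ.2, min_eq_right (by linarith : c ≤ θ),
      show -(um * c) + um * (θ - 1) = -(um * (c + (1 - θ))) by ring, abs_neg,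
      abs_of_nonneg (mul_nonneg hum.le (add_nonneg hc0 (by linarith [hθ.2]))),
      show -(um * c) - um * (θ - 1) = um * (1 - θ - c) by ring, abs_mul, abs_of_pos hum]
    rcases le_total θ (1 - c) with h'' | h''
    · rw [min_eq_left h'', abs_of_nonneg (by linarith)]; ring
    · rw [min_eq_right h'', abs_of_nonpos (by linarith)]; ring

/-- The encoder samples the duty cycle at its switching instants `a` and `b` only, and `a + b - 1 =
δ (b - a) / (4 um)`. The sampled values therefore average to the mean duty cycle up to the exact
error `δ² (b - a) / (8 um)`. -/
theorem abs_integral_pwm_affine_sub_le {um : ℝ} (hum : 0 < um) {u δ : ℝ} (hu : |u| ≤ um)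
    (hu' : |u + δ| ≤ um) :
    |(∫ σ in (0 : ℝ)..1, pwm um (u + σ * δ) σ) - (u + δ / 2)| ≤ δ ^ 2 / (8 * um) := by
  rw [integral_pwm_affine hum hu hu' ⟨zero_le_one, le_rfl⟩]
  rw [abs_le] at hu hu'
  have hp : 0 < 4 * um + δ := by linarith
  have hm : 0 < 4 * um - δ := by linarith
  obtain ⟨a, ha⟩ : ∃ a, a = (um - u) / (4 * um + δ) := ⟨_, rfl⟩
  obtain ⟨b, hb⟩ : ∃ b, b = (3 * um + u) / (4 * um - δ) := ⟨_, rfl⟩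
  rw [← ha, ← hb]
  have ha0 : 0 ≤ a := ha ▸ div_nonneg (by linarith) hp.le
  have ha1 : a ≤ 1 / 2 := by rw [ha, div_le_iff₀ hp]; linarith
  have hb0 : 1 / 2 ≤ b := by rw [hb, le_div_iff₀ hm]; linarith
  have hb1 : b ≤ 1 := by rw [hb, div_le_iff₀ hm]; linarith
  rw [min_eq_right hb1, min_eq_right (by linarith)]
  have hae : 4 * um * a = um - u - δ * a := by
    have : a * (4 * um + δ) = um - u := by rw [ha, div_mul_cancel₀ _ hp.ne']
    linarith
  have hbe : 4 * um * b = 3 * um + u + δ * b := by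
    have : b * (4 * um - δ) = 3 * um + u := by rw [hb, div_mul_cancel₀ _ hm.ne']
    linarith
  have e : -um * 1 + 2 * um * (b - a) - (u + δ / 2) = δ ^ 2 / (8 * um) * (b - a) := by
    have h1 : 2 * um * (b - a) = um + u + δ * (a + b) / 2 := by linarith
    have h2 : a + b - 1 = δ * (b - a) / (4 * um) := by
      field_simp; linarith
    have h3 : a + b = 1 + δ * (b - a) / (4 * um) := by linarith
    rw [h1, h3]
    field_simp; ring
  rw [e, abs_of_nonneg (mul_nonneg (by positivity) (by linarith))]
  exact mul_le_of_le_one_right (by positivity) (by linarith)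

/-- The difference of ripples is the integral of a PWM signal of modulus `um` minus `u (θ - θ')`,
and `|u| ≤ um`. -/
theorem abs_s1_sub_le_time {um : ℝ} (hum : 0 < um) {u : ℝ} (hu : |u| ≤ um) {θ θ' : ℝ}
    (hθ : θ ∈ Icc (0 : ℝ) 1) (hθ' : θ' ∈ Icc (0 : ℝ) 1) :
    |s1 um u θ - s1 um u θ'| ≤ 2 * um * |θ - θ'| := by
  have hi : ∀ a b, IntervalIntegrable (fun σ => pwm um u σ) volume a b := fun a b =>
    (intervalIntegrable_const (c := um)).mono_fun
      (measurable_pwm_comp measurable_const measurable_id).aestronglyMeasurable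
      (Filter.Eventually.of_forall fun σ => by
        simp only [Real.norm_eq_abs]; rw [abs_pwm hum, abs_of_pos hum])
  have h := intervalIntegral.norm_integral_le_of_norm_le_const (a := θ') (b := θ)
    (f := fun σ => pwm um u σ) (C := um)
    (fun σ _ => by rw [Real.norm_eq_abs, abs_pwm hum])
  rw [← intervalIntegral.integral_interval_sub_left (hi 0 θ) (hi 0 θ'), integral_pwm hum hu hθ,
    integral_pwm hum hu hθ', Real.norm_eq_abs] at h
  have e : s1 um u θ - s1 um u θ' = (u * θ + s1 um u θ - (u * θ' + s1 um u θ')) -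
    u * (θ - θ') := by ring
  have h2 : |u * (θ - θ')| ≤ um * |θ - θ'| := by
    rw [abs_mul]; gcongr
  rw [e]
  exact (abs_sub _ _).trans (by linarith)

/-- The reflection `θ ↦ 1 - θ` turns the integral into its opposite. The almost-everywhere form
leaves aside the jump of `wrap` and the switching instants, where the symmetry may break. -/
theorem integral_eq_zero_of_odd {ψ : ℝ → ℝ}
    (h : ∀ᵐ θ : ℝ, θ ∈ Ioc (0 : ℝ) 1 → ψ (1 - θ) = -ψ θ) : ∫ θ in (0 : ℝ)..1, ψ θ = 0 := by
  have h1 : ∫ θ in (0 : ℝ)..1, ψ (1 - θ) = ∫ θ in (0 : ℝ)..1, ψ θ := by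
    simp [intervalIntegral.integral_comp_sub_left (fun x => ψ x) 1]
  have h2 : ∫ θ in (0 : ℝ)..1, ψ (1 - θ) = ∫ θ in (0 : ℝ)..1, -ψ θ := by
    refine intervalIntegral.integral_congr_ae ?_
    filter_upwards [h] with θ hθ hθ'
    exact hθ (by rwa [uIoc_of_le zero_le_one] at hθ')
  rw [intervalIntegral.integral_neg] at h2
  linarith

/-- `wrap` is odd about `1/2` away from its jump, and changing its sign exchanges the two absolute
values. -/
theorem s1_one_sub {um u θ : ℝ} (h0 : 0 < θ) (h1 : θ ≤ 1) (h2 : θ ≠ 1 / 2) :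
    s1 um u (1 - θ) = -s1 um u θ := by
  have : wrap um (1 - θ) = -wrap um θ := by
    rcases lt_or_gt_of_ne h2 with h | h
    · rw [wrap_of_lt_half h0.le h, wrap_of_half_le (by linarith) (by linarith)]; ring
    · rw [wrap_of_half_le h.le h1, wrap_of_lt_half (by linarith) (by linarith)]; ring
  rw [s1, s1, this, sub_neg_eq_add, ← sub_eq_add_neg]; ring

/-- The two switching instants of a constant duty cycle are mirror images about `1/2`; the half-open
interval between them is symmetric up to its endpoints. -/
theorem pwm_one_sub_ae {um : ℝ} (hum : 0 < um) {u : ℝ} (hu : |u| ≤ um) :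
    ∀ᵐ θ : ℝ, θ ∈ Ioc (0 : ℝ) 1 → pwm um u (1 - θ) = pwm um u θ := by
  filter_upwards [ae_ne_real 1, ae_ne_real (1 / 2), ae_ne_real ((um - u) / (4 * um)),
    ae_ne_real ((3 * um + u) / (4 * um))] with θ h1 h2 h3 h4 h
  have hlt : θ < 1 := lt_of_le_of_ne h.2 h1
  have e := pwm_affine_eq_step hum hu (δ := 0) (by simpa using hu) h.1 h.2 h2
  have e' := pwm_affine_eq_step hum hu (δ := 0) (θ := 1 - θ) (by simpa using hu) (by linarith)
    (by linarith [h.1]) (fun hh => h2 (by linarith))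
  simp only [mul_zero, add_zero, sub_zero] at e e'
  rw [e, e']
  have hb : (3 * um + u) / (4 * um) = 1 - (um - u) / (4 * um) := by field_simp; ring
  rw [hb] at h4 ⊢
  congr 2
  have : 1 - θ ∈ Ioc ((um - u) / (4 * um)) (1 - (um - u) / (4 * um)) ↔
      θ ∈ Ioc ((um - u) / (4 * um)) (1 - (um - u) / (4 * um)) := by
    simp only [mem_Ioc]
    constructor
    · rintro ⟨ha, hb⟩
      exact ⟨lt_of_le_of_ne (by linarith) (Ne.symm h3), by linarith⟩
    · rintro ⟨ha, hb⟩
      exact ⟨by have := lt_of_le_of_ne hb h4; linarith, by linarith⟩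
  by_cases hm : θ ∈ Ioc ((um - u) / (4 * um)) (1 - (um - u) / (4 * um))
  · rw [indicator_of_mem hm, indicator_of_mem (this.2 hm)]; rfl
  · rw [indicator_of_notMem hm, indicator_of_notMem (fun hh => hm (this.1 hh))]

theorem integral_s1 (um u : ℝ) : ∫ θ in (0 : ℝ)..1, s1 um u θ = 0 := by
  refine integral_eq_zero_of_odd ?_
  filter_upwards [ae_ne_real (1 / 2)] with θ h2 h
  exact s1_one_sub h.1 h.2 h2

/-- About `1/2` the ripple is odd and the PWM signal even. -/
theorem integral_s1_mul_pwm {um : ℝ} (hum : 0 < um) {u : ℝ} (hu : |u| ≤ um) :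
    ∫ θ in (0 : ℝ)..1, s1 um u θ * pwm um u θ = 0 := by
  refine integral_eq_zero_of_odd ?_
  filter_upwards [ae_ne_real (1 / 2), pwm_one_sub_ae hum hu] with θ h2 h3 h
  rw [s1_one_sub h.1 h.2 h2, h3 h]; ring

theorem intervalIntegrable_pwm_comp {um : ℝ} (hum : 0 < um) {u : ℝ → ℝ} (hu : Measurable u)
    (a b : ℝ) : IntervalIntegrable (fun θ => pwm um (u θ) θ) volume a b :=
  (intervalIntegrable_const (c := um)).mono_fun
    (measurable_pwm_comp hu measurable_id).aestronglyMeasurable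
    (Filter.Eventually.of_forall fun σ => by
      simp only [Real.norm_eq_abs]; rw [abs_pwm hum, abs_of_pos hum])

/-- Write `θ = (θ - 1/2) + 1/2`: the first part gives an odd integrand, and the second a multiple of
the mean of `s0`, which is zero. -/
theorem integral_id_mul_pwm_sub {um : ℝ} (hum : 0 < um) {u : ℝ} (hu : |u| ≤ um) :
    ∫ θ in (0 : ℝ)..1, θ * (pwm um u θ - u) = 0 := by
  have hi : IntervalIntegrable (fun θ => pwm um u θ) volume 0 1 :=
    intervalIntegrable_pwm_comp hum measurable_const 0 1
  have h1 : ∫ θ in (0 : ℝ)..1, (θ - 1 / 2) * (pwm um u θ - u) = 0 := by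
    refine integral_eq_zero_of_odd ?_
    filter_upwards [pwm_one_sub_ae hum hu] with θ h3 h
    rw [h3 h]; ring
  have h2 : ∫ θ in (0 : ℝ)..1, (1 / 2 : ℝ) * (pwm um u θ - u) = 0 := by
    rw [intervalIntegral.integral_const_mul, intervalIntegral.integral_sub hi (by simp),
      integral_pwm hum hu ⟨zero_le_one, le_rfl⟩]
    have h1 : s1 um u 1 = 0 := by
      have := s1_add_natCast um u 0 1
      simp only [Nat.cast_one, add_zero] at this
      rw [this, s1_zero]
    simp [h1]
  have hi' : IntervalIntegrable (fun θ => pwm um u θ - u) volume 0 1 := hi.sub (by simp)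
  have h3 := intervalIntegral.integral_add
    (hi'.continuousOn_mul (g := fun θ => θ - 1 / 2) (by fun_prop))
    (hi'.const_mul (1 / 2 : ℝ))
  rw [h1, h2, add_zero] at h3
  rw [← h3]
  congr 1
  ext θ; ring

/-- Perturbing by at most `D` a slowly varying duty cycle `υ` changes the PWM output only on a
set of small measure. -/
theorem exists_pwm_disagreement {um : ℝ} (hum : 0 < um) {υ : ℝ → ℝ} {c : ℝ}
    (hc1 : c ≤ 1)
    (hυ : ∀ θ ∈ Icc (0 : ℝ) c, ∀ θ' ∈ Icc (0 : ℝ) c, |υ θ - υ θ'| ≤ 2 * um * |θ - θ'|)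
    {D : ℝ} (hD : 0 ≤ D) :
    ∃ S : Set ℝ, MeasurableSet S ∧ volume.real S ≤ 4 * (D / um) ∧ volume S ≠ ⊤ ∧
      ∀ θ ∈ Icc (0 : ℝ) c, ∀ v, |v - υ θ| ≤ D → θ ∉ S → pwm um v θ = pwm um (υ θ) θ := by
  have hcont : ContinuousOn υ (Icc 0 c) := by
    have : LipschitzOnWith (Real.toNNReal (2 * um)) υ (Icc 0 c) := by
      refine LipschitzOnWith.of_dist_le_mul fun x hx y hy => ?_
      rw [Real.coe_toNNReal _ (by positivity)]
      exact hυ x hx y hy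
    exact this.continuousOn
  -- A change of output forces `4 wrap` to lie within `D` of one of the two thresholds `± (um - υ)`.
  -- Each threshold on each of the two branches of `wrap` gives one set `A s b`, four in all.
  let A : ℝ → ℝ → Set ℝ := fun s b => Icc 0 c ∩ {θ | |4 * um * θ - b + s * υ θ| ≤ D}
  have hAm : ∀ s b, MeasurableSet (A s b) := fun s b => by
    have : ContinuousOn (fun θ => |4 * um * θ - b + s * υ θ|) (Icc 0 c) := by fun_prop
    exact (this.preimage_isClosed_of_isClosed isClosed_Icc isClosed_Iic).measurableSet
  -- The carrier has slope `4 um` and `υ` has slope at most `2 um`, so they cross at relative slope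
  -- at least `2 um`. A band of width `2 D` is then traversed within a set of diameter at most `D /
  -- um`.
  have hAv : ∀ s b, |s| = 1 → volume (A s b) ≤ ENNReal.ofReal (D / um) := fun s b hs => by
    refine (Real.volume_le_diam _).trans (Metric.ediam_le fun x hx y hy => ?_)
    rw [edist_dist]
    refine ENNReal.ofReal_le_ofReal ?_
    have h1 : |4 * um * x - b + s * υ x| ≤ D := hx.2
    have h2 : |4 * um * y - b + s * υ y| ≤ D := hy.2
    have h3 := hυ x hx.1 y hy.1
    have h4 : |s * (υ x - υ y)| ≤ 2 * um * |x - y| := by rw [abs_mul, hs, one_mul]; exact h3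
    have h5 : |4 * um * (x - y)| ≤ 2 * D + 2 * um * |x - y| := by
      have : 4 * um * (x - y) = (4 * um * x - b + s * υ x) - (4 * um * y - b + s * υ y) -
        s * (υ x - υ y) := by ring
      rw [this]
      have e1 := abs_sub (4 * um * x - b + s * υ x) (4 * um * y - b + s * υ y)
      have e2 := abs_sub ((4 * um * x - b + s * υ x) - (4 * um * y - b + s * υ y))
        (s * (υ x - υ y))
      linarith
    rw [abs_mul, abs_of_pos (by positivity : 0 < 4 * um)] at h5
    rw [Real.dist_eq, le_div_iff₀ hum]
    nlinarith
  refine ⟨A 1 um ∪ A 1 (5 * um) ∪ (A (-1) (-um) ∪ A (-1) (3 * um)), ?_, ?_, ?_, ?_⟩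
  · exact ((hAm _ _).union (hAm _ _)).union ((hAm _ _).union (hAm _ _))
  · have hr : ∀ s b, |s| = 1 → volume.real (A s b) ≤ D / um := fun s b hs =>
      ENNReal.toReal_le_of_le_ofReal (by positivity) (hAv s b hs)
    have h1 := measureReal_union_le (μ := volume) (A 1 um ∪ A 1 (5 * um))
      (A (-1) (-um) ∪ A (-1) (3 * um))
    have h2 := measureReal_union_le (μ := volume) (A 1 um) (A 1 (5 * um))
    have h3 := measureReal_union_le (μ := volume) (A (-1) (-um)) (A (-1) (3 * um))
    have := hr 1 um (by simp)
    have := hr 1 (5 * um) (by simp)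
    have := hr (-1) (-um) (by simp)
    have := hr (-1) (3 * um) (by simp)
    linarith
  · have hr : ∀ s b, |s| = 1 → volume (A s b) ≠ ⊤ := fun s b hs =>
      ((hAv s b hs).trans_lt ENNReal.ofReal_lt_top).ne
    exact measure_union_ne_top (measure_union_ne_top (hr _ _ (by simp)) (hr _ _ (by simp)))
      (measure_union_ne_top (hr _ _ (by simp)) (hr _ _ (by simp)))
  · intro θ hθ v hv hS
    by_contra hne
    apply hS
    have hw := wrap_eq_or (um := um) (θ := θ) ⟨hθ.1, hθ.2.trans hc1⟩
    -- Farther than `D` from both thresholds, the two inequalities defining the output have the same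
    -- truth values for `v` and for `υ θ`.
    have hcross : |4 * wrap um θ - um + υ θ| ≤ D ∨ |4 * wrap um θ + um - υ θ| ≤ D := by
      by_contra hcon
      push Not at hcon
      apply hne
      rw [abs_le] at hv
      simp only [pwm]
      have h1 : (v - um < 4 * wrap um θ) ↔ (υ θ - um < 4 * wrap um θ) := by
        rcases lt_abs.1 hcon.2 with h | h <;> constructor <;> intro <;> linarith
      have h2 : (4 * wrap um θ ≤ um - v) ↔ (4 * wrap um θ ≤ um - υ θ) := by
        rcases lt_abs.1 hcon.1 with h | h <;> constructor <;> intro <;> linarith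
      simp only [h1, h2]
    rcases hcross with h | h <;> rcases hw with hw | hw <;> rw [hw] at h
    · left; left; refine ⟨hθ, ?_⟩
      simp only [mem_ofPred_eq]
      convert h using 2; ring
    · left; right; refine ⟨hθ, ?_⟩
      simp only [mem_ofPred_eq]
      convert h using 2; ring
    · right; left; refine ⟨hθ, ?_⟩
      simp only [mem_ofPred_eq]
      convert h using 2; ring
    · right; right; refine ⟨hθ, ?_⟩
      simp only [mem_ofPred_eq]
      convert h using 2; ring

/-! ### Carathéodory solutions: restriction, gluing, change of time scale, Grönwall. -/

section Solutions

variable {V : Type*} [NormedAddCommGroup V] [NormedSpace ℝ V] {F : ℝ → V → V} {X Y : ℝ → V}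
  {s a b c T : ℝ}

theorem IsSolution.mono (h : IsSolution F s T X) (hsa : s ≤ a) (hab : a ≤ b) (hbT : b ≤ T) :
    IsSolution F a b X := by
  have hi : ∀ u v, u ∈ Icc s T → v ∈ Icc s T →
      IntervalIntegrable (fun τ => F τ (X τ)) volume u v := fun u v hu hv =>
    h.1.mono_set (by rw [uIcc_of_le (hu.1.trans hu.2)]; exact uIcc_subset_Icc hu hv)
  have hs : s ∈ Icc s T := ⟨le_rfl, by linarith⟩
  have ha : a ∈ Icc s T := ⟨hsa, by linarith⟩
  refine ⟨hi a b ha ⟨by linarith, hbT⟩, fun t ht => ?_⟩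
  have ht' : t ∈ Icc s T := ⟨hsa.trans ht.1, ht.2.trans hbT⟩
  rw [h.2 t ht', h.2 a ha, add_assoc,
    intervalIntegral.integral_add_adjacent_intervals (hi s a hs ha) (hi a t ha ht')]

theorem IsSolution.congr (h : IsSolution F a b X) (hab : a ≤ b) (hXY : EqOn X Y (Icc a b)) :
    IsSolution F a b Y := by
  have hF : ∀ t ∈ Icc a b, F t (X t) = F t (Y t) := fun t ht => by rw [hXY ht]
  refine ⟨h.1.congr fun t ht => hF t ?_, fun t ht => ?_⟩
  · rw [uIoc_of_le hab] at ht; exact ⟨ht.1.le, ht.2⟩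
  · rw [← hXY ht, ← hXY ⟨le_rfl, hab⟩, h.2 t ht]
    congr 1
    refine intervalIntegral.integral_congr fun τ hτ => hF τ ?_
    rw [uIcc_of_le ht.1] at hτ
    exact ⟨hτ.1, hτ.2.trans ht.2⟩

theorem IsSolution.continuousOn (h : IsSolution F a b X) (hab : a ≤ b) :
    ContinuousOn X (Icc a b) := by
  have h1 : ContinuousOn (fun t => X a + ∫ τ in a..t, F τ (X τ)) (Icc a b) := by
    refine continuousOn_const.add ?_
    have := intervalIntegral.continuousOn_primitive_interval
      ((intervalIntegrable_iff_integrableOn_Icc_of_le hab).1 h.1 |>.mono_set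
        (by rw [uIcc_of_le hab]))
    rwa [uIcc_of_le hab] at this
  exact h1.congr fun t ht => h.2 t ht

theorem IsSolution.glue (hX : IsSolution F a b X) (hY : IsSolution F b c Y) (hab : a ≤ b)
    (hbc : b ≤ c) (h : X b = Y b) : IsSolution F a c (fun t => if t ≤ b then X t else Y t) := by
  set Z : ℝ → V := fun t => if t ≤ b then X t else Y t with hZ
  have hZX : EqOn X Z (Icc a b) := fun t ht => by simp [hZ, ht.2]
  have hZY : EqOn Y Z (Icc b c) := fun t ht => by
    rcases eq_or_lt_of_le ht.1 with h' | h'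
    · subst h'; simp [hZ, h]
    · simp [hZ, not_le.2 h']
  have h1 := hX.congr hab hZX
  have h2 := hY.congr hbc hZY
  refine ⟨h1.1.trans h2.1, fun t ht => ?_⟩
  rcases le_total t b with htb | htb
  · exact h1.2 t ⟨ht.1, htb⟩
  · have h3 := h2.mono le_rfl htb ht.2
    rw [← intervalIntegral.integral_add_adjacent_intervals h1.1 h3.1, ← add_assoc,
      ← h1.2 b ⟨hab, le_rfl⟩]
    exact h3.2 t ⟨htb, le_rfl⟩

theorem IsSolution.rescale {τ ε : ℝ} (hε : 0 < ε)
    (h : IsSolution F (τ + ε * a) (τ + ε * b) X) :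
    IsSolution (fun θ x => ε • F (τ + ε * θ) x) a b (fun θ => X (τ + ε * θ)) := by
  constructor
  · have := (h.1.comp_add_left τ).comp_mul_left (c := ε)
    simp only [add_sub_cancel_left] at this
    rw [mul_div_cancel_left₀ _ hε.ne', mul_div_cancel_left₀ _ hε.ne'] at this
    exact this.smul ε
  · intro t ht
    change X (τ + ε * t) = X (τ + ε * a) + ∫ θ in a..t, ε • F (τ + ε * θ) (X (τ + ε * θ))
    rw [h.2 (τ + ε * t) ⟨by have := ht.1; gcongr, by have := ht.2; gcongr⟩]
    congr 1
    rw [intervalIntegral.integral_smul]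
    exact (intervalIntegral.smul_integral_comp_add_mul (fun x => F x (X x)) ε τ).symm

theorem IsSolution.unscale {τ ε : ℝ} (hε : 0 < ε)
    (h : IsSolution (fun θ x => ε • F (τ + ε * θ) x) a b X) :
    IsSolution F (τ + ε * a) (τ + ε * b) (fun t => X ((t - τ) / ε)) := by
  have e : ∀ t, -τ / ε + ε⁻¹ * t = (t - τ) / ε := fun t => by field_simp; ring
  have e1 : ∀ t, -τ / ε + ε⁻¹ * (τ + ε * t) = t := fun t => by field_simp; ring
  have := IsSolution.rescale (τ := -τ / ε) (ε := ε⁻¹) (a := τ + ε * a) (b := τ + ε * b)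
    (F := fun θ x => ε • F (τ + ε * θ) x) (X := X) (inv_pos.2 hε)
    (by rw [e1, e1]; exact h)
  have e2 : ∀ t, τ + ε * ((t - τ) / ε) = t := fun t => by field_simp; ring
  simpa only [e, e2, inv_smul_smul₀ hε.ne'] using this

/-- When the field is continuous along the curve, as for the ideal loop, the integral equation
yields a right derivative everywhere, the form needed for the differential Grönwall inequality. -/
theorem IsSolution.hasDerivWithinAt [CompleteSpace V] (h : IsSolution F a b X)
    (hc : ContinuousOn (fun t => F t (X t)) (Icc a b)) {t : ℝ} (ht : t ∈ Ico a b) :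
    HasDerivWithinAt X (F t (X t)) (Ici t) t := by
  have hab : a ≤ b := ht.1.trans ht.2.le
  have h1 := h.mono ht.1 ht.2.le le_rfl
  have hmem : Icc t b ∈ nhdsWithin t (Ici t) := Icc_mem_nhdsGE ht.2
  have hcw : ContinuousWithinAt (fun t => F t (X t)) (Ici t) t :=
    ((hc t ⟨ht.1, ht.2.le⟩).mono (Icc_subset_Icc_left ht.1)).mono_of_mem_nhdsWithin hmem
  have hd : HasDerivWithinAt (fun v => X t + ∫ τ in t..v, F τ (X τ)) (F t (X t)) (Ici t) t := by
    refine HasDerivWithinAt.const_add _ ?_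
    refine intervalIntegral.integral_hasDerivWithinAt_right (by simp) ?_
      (hcw.mono Ioi_subset_Ici_self) (t := Ioi t)
    exact ⟨Icc t b, nhdsWithin_mono _ Ioi_subset_Ici_self hmem,
      (hc.mono (Icc_subset_Icc_left ht.1)).aestronglyMeasurable measurableSet_Icc⟩
  refine hd.congr_of_eventuallyEq ?_ (by simp)
  filter_upwards [hmem] with v hv
  exact h1.2 v hv

/-- Grönwall estimate between two solutions of a field that is Lipschitz on a set. -/
theorem IsSolution.norm_sub_le [CompleteSpace V] {K : ℝ} {S : Set V} (hab : a ≤ b)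
    (hX : IsSolution F a b X) (hY : IsSolution F a b Y)
    (hcX : ContinuousOn (fun t => F t (X t)) (Icc a b))
    (hcY : ContinuousOn (fun t => F t (Y t)) (Icc a b))
    (hXS : ∀ t ∈ Icc a b, X t ∈ S) (hYS : ∀ t ∈ Icc a b, Y t ∈ S)
    (hF : ∀ t ∈ Icc a b, ∀ x ∈ S, ∀ y ∈ S, ‖F t x - F t y‖ ≤ K * ‖x - y‖) :
    ∀ t ∈ Icc a b, ‖X t - Y t‖ ≤ ‖X a - Y a‖ * Real.exp (K * (t - a)) := by
  intro t ht
  have := norm_le_gronwallBound_of_norm_deriv_right_le (f := fun t => X t - Y t)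
    (f' := fun t => F t (X t) - F t (Y t)) (δ := ‖X a - Y a‖) (K := K) (ε := 0) (a := a) (b := b)
    ((hX.continuousOn hab).sub (hY.continuousOn hab))
    (fun t ht => (hX.hasDerivWithinAt hcX ht).sub (hY.hasDerivWithinAt hcY ht)) le_rfl
    (fun t ht => by
      have ht' := Ico_subset_Icc_self ht
      simpa using hF t ht' _ (hXS t ht') _ (hYS t ht')) t ht
  rwa [gronwallBound_ε0] at this

end Solutions

/-- Discrete Grönwall inequality. -/
theorem discrete_gronwall_affine {e : ℕ → ℝ} {A B : ℝ} (hA : 0 ≤ A) (hB : 0 ≤ B) {N : ℕ}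
    (h : ∀ i < N, e (i + 1) ≤ (1 + A) * e i + B) (h0 : 0 ≤ e 0) :
    ∀ i ≤ N, e i ≤ (e 0 + i * B) * Real.exp (A * i) := by
  intro i
  induction i with
  | zero => intro _; simp
  | succ i ih =>
    intro hi
    have h1 := h i (by omega)
    have h2 := ih (by omega)
    have h3 : (1 + A) ≤ Real.exp A := by linarith [Real.add_one_le_exp A]
    have h4 : (1 : ℝ) ≤ Real.exp (A * (i + 1)) := Real.one_le_exp (by positivity)
    have h5 : (1 + A) * e i ≤ Real.exp A * ((e 0 + i * B) * Real.exp (A * i)) :=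
      by
        calc (1 + A) * e i ≤ (1 + A) * ((e 0 + i * B) * Real.exp (A * i)) := by gcongr
          _ ≤ _ := by gcongr
    have h6 : Real.exp (A * (i + 1)) = Real.exp A * Real.exp (A * i) := by
      rw [← Real.exp_add]; ring_nf
    push_cast
    calc e (i + 1) ≤ Real.exp A * ((e 0 + i * B) * Real.exp (A * i)) + B := by linarith
      _ = (e 0 + i * B) * Real.exp (A * (i + 1)) + B * 1 := by rw [h6]; ring
      _ ≤ (e 0 + i * B) * Real.exp (A * (i + 1)) + B * Real.exp (A * (i + 1)) := by gcongr
      _ = _ := by ring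

/-! ### Calculus of functions with bounded derivatives up to order two. -/

section C2Bounds

variable {Z Z' G G' : Type*} [NormedAddCommGroup Z] [NormedSpace ℝ Z]
  [NormedAddCommGroup Z'] [NormedSpace ℝ Z'] [NormedAddCommGroup G] [NormedSpace ℝ G]
  [NormedAddCommGroup G'] [NormedSpace ℝ G'] {D : Set Z} {D' : Set Z'}

/-- A `C²` function bounded on `D` together with its derivatives of order at most `2`. -/
def C2BoundedOn (φ : Z → G) (D : Set Z) : Prop :=
  ContDiff ℝ 2 φ ∧ ∃ B : ℝ, ∀ z ∈ D, ∀ m : ℕ, m ≤ 2 → ‖iteratedFDeriv ℝ m φ z‖ ≤ B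

/-- A `C²` function whose derivatives of orders `1` and `2` are bounded on `D`. -/
def DerivsBoundedOn (φ : Z → G) (D : Set Z) : Prop :=
  ContDiff ℝ 2 φ ∧ ∃ B : ℝ, ∀ z ∈ D, ∀ m : ℕ, 1 ≤ m → m ≤ 2 → ‖iteratedFDeriv ℝ m φ z‖ ≤ B

theorem C2BoundedOn.derivsBoundedOn {φ : Z → G} (h : C2BoundedOn φ D) : DerivsBoundedOn φ D :=
  ⟨h.1, h.2.imp fun _ hB z hz m _ hm => hB z hz m hm⟩

theorem C2BoundedOn.of_isCompact {φ : Z → G} (h : ContDiff ℝ 2 φ) (hD : IsCompact D) :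
    C2BoundedOn φ D := by
  have hb : ∀ m : ℕ, m ≤ 2 → ∃ B, ∀ z ∈ D, ‖iteratedFDeriv ℝ m φ z‖ ≤ B := fun m hm =>
    hD.exists_bound_of_continuousOn
      (h.continuous_iteratedFDeriv (m := m) (by exact_mod_cast hm)).continuousOn
  obtain ⟨B0, h0⟩ := hb 0 (by norm_num)
  obtain ⟨B1, h1⟩ := hb 1 (by norm_num)
  obtain ⟨B2, h2⟩ := hb 2 (by norm_num)
  refine ⟨h, max B0 (max B1 B2), fun z hz m hm => ?_⟩
  interval_cases m
  · exact (h0 z hz).trans (le_max_left _ _)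
  · exact (h1 z hz).trans ((le_max_left _ _).trans (le_max_right _ _))
  · exact (h2 z hz).trans ((le_max_right _ _).trans (le_max_right _ _))

/-- The inner map may be unbounded as long as its derivatives are not, which lets the time
coordinate through. The constant is the Faà di Bruno bound `m! C D ^ m` for `m ≤ 2`; taking `max B
1` makes the bound on each derivative also a bound by the corresponding power. -/
theorem C2BoundedOn.comp {g : Z' → G} {φ : Z → Z'} (hg : C2BoundedOn g D')
    (hφ : DerivsBoundedOn φ D) (hm : MapsTo φ D D') : C2BoundedOn (fun z => g (φ z)) D := by
  obtain ⟨hg1, C, hC⟩ := hg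
  obtain ⟨hφ1, B, hB⟩ := hφ
  refine ⟨hg1.comp hφ1, 2 * |C| * (max B 1) ^ 2, fun z hz m hm2 => ?_⟩
  have h1 : (1 : ℝ) ≤ max B 1 := le_max_right _ _
  have := norm_iteratedFDeriv_comp_le hg1 hφ1 (n := m) (by exact_mod_cast hm2) z (C := |C|)
    (D := max B 1) (fun i hi => (hC _ (hm hz) i (hi.trans hm2)).trans (le_abs_self _))
    (fun i hi1 hi2 => (hB z hz i hi1 (hi2.trans hm2)).trans
      ((le_max_left _ _).trans (le_self_pow₀ h1 (by omega))))
  refine this.trans ?_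
  have hf : (m.factorial : ℝ) ≤ 2 := by exact_mod_cast (Nat.factorial_le hm2)
  gcongr

theorem ContinuousLinearMap.derivsBoundedOn (L : Z →L[ℝ] G) : DerivsBoundedOn L D := by
  refine ⟨L.contDiff, ‖L‖, fun z _ m h1 h2 => ?_⟩
  interval_cases m
  · rw [← norm_iteratedFDeriv_fderiv, norm_iteratedFDeriv_zero, L.fderiv]
  · have : fderiv ℝ L = fun _ => L := funext fun x => L.fderiv
    rw [← norm_iteratedFDeriv_fderiv, ← norm_iteratedFDeriv_fderiv, norm_iteratedFDeriv_zero,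
      this, fderiv_fun_const]
    simp

theorem DerivsBoundedOn.prodMk {φ : Z → G} {ψ : Z → G'} (hφ : DerivsBoundedOn φ D)
    (hψ : DerivsBoundedOn ψ D) : DerivsBoundedOn (fun z => (φ z, ψ z)) D := by
  obtain ⟨hφ1, B, hB⟩ := hφ
  obtain ⟨hψ1, C, hC⟩ := hψ
  refine ⟨hφ1.prodMk hψ1, max B C, fun z hz m h1 h2 => ?_⟩
  have hm : (m : WithTop ℕ∞) ≤ 2 := by exact_mod_cast h2
  rw [iteratedFDeriv_prodMk hφ1.contDiffAt hψ1.contDiffAt hm, ContinuousMultilinearMap.opNorm_prod]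
  exact max_le_max (hB z hz m h1 h2) (hC z hz m h1 h2)

theorem C2BoundedOn.prodMk {φ : Z → G} {ψ : Z → G'} (hφ : C2BoundedOn φ D)
    (hψ : C2BoundedOn ψ D) : C2BoundedOn (fun z => (φ z, ψ z)) D := by
  obtain ⟨hφ1, B, hB⟩ := hφ
  obtain ⟨hψ1, C, hC⟩ := hψ
  refine ⟨hφ1.prodMk hψ1, max B C, fun z hz m h2 => ?_⟩
  have hm : (m : WithTop ℕ∞) ≤ 2 := by exact_mod_cast h2
  rw [iteratedFDeriv_prodMk hφ1.contDiffAt hψ1.contDiffAt hm, ContinuousMultilinearMap.opNorm_prod]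
  exact max_le_max (hB z hz m h2) (hC z hz m h2)

theorem C2BoundedOn.add {φ ψ : Z → G} (hφ : C2BoundedOn φ D)
    (hψ : C2BoundedOn ψ D) : C2BoundedOn (fun z => φ z + ψ z) D := by
  obtain ⟨hφ1, B, hB⟩ := hφ
  obtain ⟨hψ1, C, hC⟩ := hψ
  refine ⟨hφ1.add hψ1, B + C, fun z hz m h2 => ?_⟩
  have hm : (m : WithTop ℕ∞) ≤ 2 := by exact_mod_cast h2
  have : iteratedFDeriv ℝ m (fun z => φ z + ψ z) z = _ :=
    iteratedFDeriv_add_apply (hφ1.of_le hm).contDiffAt (hψ1.of_le hm).contDiffAt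
  rw [this]
  exact (norm_add_le _ _).trans (add_le_add (hB z hz m h2) (hC z hz m h2))

theorem C2BoundedOn.smul {φ : Z → ℝ} {ψ : Z → G} (hφ : C2BoundedOn φ D)
    (hψ : C2BoundedOn ψ D) : C2BoundedOn (fun z => φ z • ψ z) D := by
  obtain ⟨hφ1, B, hB⟩ := hφ
  obtain ⟨hψ1, C, hC⟩ := hψ
  refine ⟨hφ1.smul hψ1, 4 * (|B| * |C|), fun z hz m h2 => ?_⟩
  have hm : (m : WithTop ℕ∞) ≤ 2 := by exact_mod_cast h2
  refine (norm_iteratedFDeriv_smul_le hφ1 hψ1 z hm).trans ?_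
  calc _ ≤ ∑ i ∈ Finset.range (m + 1), (m.choose i : ℝ) * |B| * |C| := by
        refine Finset.sum_le_sum fun i hi => ?_
        have hi' : i ≤ m := by simpa [Nat.lt_succ_iff] using hi
        gcongr
        · exact (hB z hz i (hi'.trans h2)).trans (le_abs_self _)
        · exact (hC z hz (m - i) (by omega)).trans (le_abs_self _)
    _ = 2 ^ m * (|B| * |C|) := by
        simp_rw [mul_assoc]
        rw [← Finset.sum_mul]
        congr 1
        exact_mod_cast Nat.sum_range_choose m
    _ ≤ 4 * (|B| * |C|) := by
        gcongr
        calc (2 : ℝ) ^ m ≤ 2 ^ 2 := pow_le_pow_right₀ (by norm_num) h2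
          _ = 4 := by norm_num

/-- Quantitative consequences, with a single constant, of `C²` bounds on a convex set. -/
structure C2Estimates (φ : Z → G) (D : Set Z) (B : ℝ) : Prop where
  bound : ∀ z ∈ D, ‖φ z‖ ≤ B
  fderiv_bound : ∀ z ∈ D, ‖fderiv ℝ φ z‖ ≤ B
  lip : ∀ z ∈ D, ∀ z' ∈ D, ‖φ z - φ z'‖ ≤ B * ‖z - z'‖
  taylor : ∀ z ∈ D, ∀ z' ∈ D, ‖φ z' - φ z - fderiv ℝ φ z (z' - z)‖ ≤ B * ‖z' - z‖ ^ 2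
  second_diff : ∀ a ∈ D, ∀ b ∈ D, ∀ c ∈ D, ∀ e ∈ D, ‖φ a - φ b - (φ c - φ e)‖ ≤
    B * (‖a - b - (c - e)‖ + (‖a - c‖ + ‖b - e‖) * ‖c - e‖)

theorem C2Estimates.mono {φ : Z → G} {B B' : ℝ} (h : C2Estimates φ D B) (hB : B ≤ B') :
    C2Estimates φ D B' where
  bound z hz := (h.bound z hz).trans hB
  fderiv_bound z hz := (h.fderiv_bound z hz).trans hB
  lip z hz z' hz' := (h.lip z hz z' hz').trans (by gcongr)
  taylor z hz z' hz' := (h.taylor z hz z' hz').trans (by gcongr)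
  second_diff a ha b hb c hc e he := (h.second_diff a ha b hb c hc e he).trans (by gcongr)

theorem C2BoundedOn.exists_estimates {φ : Z → G} (h : C2BoundedOn φ D) (hD : Convex ℝ D) :
    ∃ B, C2Estimates φ D B := by
  obtain ⟨hφ, C, hC⟩ := h
  set B := max C 0
  have hB0 : 0 ≤ B := le_max_right _ _
  have hd : Differentiable ℝ φ := hφ.differentiable (by norm_num)
  have hd' : Differentiable ℝ (fderiv ℝ φ) :=
    (hφ.fderiv_right (m := 1) (by norm_num)).differentiable (by norm_num)
  have b0 : ∀ z ∈ D, ‖φ z‖ ≤ B := fun z hz => by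
    have := (hC z hz 0 (by norm_num)).trans (le_max_left C 0)
    rwa [norm_iteratedFDeriv_zero] at this
  have b1 : ∀ z ∈ D, ‖fderiv ℝ φ z‖ ≤ B := fun z hz => by
    have := (hC z hz 1 (by norm_num)).trans (le_max_left C 0)
    rwa [← norm_iteratedFDeriv_fderiv, norm_iteratedFDeriv_zero] at this
  have b2 : ∀ z ∈ D, ‖fderiv ℝ (fderiv ℝ φ) z‖ ≤ B := fun z hz => by
    have := (hC z hz 2 (by norm_num)).trans (le_max_left C 0)
    rwa [← norm_iteratedFDeriv_fderiv, ← norm_iteratedFDeriv_fderiv,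
      norm_iteratedFDeriv_zero] at this
  have lip0 : ∀ z ∈ D, ∀ z' ∈ D, ‖φ z - φ z'‖ ≤ B * ‖z - z'‖ := fun z hz z' hz' =>
    hD.norm_image_sub_le_of_norm_fderiv_le (fun x _ => hd x) b1 hz' hz
  have lip1 : ∀ z ∈ D, ∀ z' ∈ D, ‖fderiv ℝ φ z - fderiv ℝ φ z'‖ ≤ B * ‖z - z'‖ :=
    fun z hz z' hz' =>
    hD.norm_image_sub_le_of_norm_fderiv_le (fun x _ => hd' x) b2 hz' hz
  refine ⟨B, b0, b1, lip0, fun z hz z' hz' => ?_, fun a ha b hb c hc e he => ?_⟩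
  · have hs : segment ℝ z z' ⊆ D := hD.segment_subset hz hz'
    have := (convex_segment z z').norm_image_sub_le_of_norm_fderiv_le' (f := φ)
      (φ := fderiv ℝ φ z) (C := B * ‖z' - z‖) (fun x _ => hd x) (fun x hx => by
        refine (lip1 x (hs hx) z hz).trans ?_
        gcongr
        obtain ⟨s, hs, rfl⟩ := (segment_eq_image' ℝ z z' ▸ hx : _ ∈ (_ '' _))
        rw [add_sub_cancel_left, norm_smul, Real.norm_eq_abs, abs_of_nonneg hs.1]
        exact mul_le_of_le_one_left (norm_nonneg _) hs.2)
      (left_mem_segment ℝ z z') (right_mem_segment ℝ z z')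
    refine this.trans (le_of_eq (by ring))
  -- Both pairs are interpolated at the same speed. The derivative of `φ (p s) - φ (r s)` splits
  -- into the effect of different increments, controlled by the first derivative, and that of
  -- different base points, controlled by the second.
  · let p : ℝ → Z := fun s => b + s • (a - b)
    let r : ℝ → Z := fun s => e + s • (c - e)
    have hp : ∀ s ∈ Icc (0 : ℝ) 1, p s ∈ D := fun s hs =>
      hD.add_smul_sub_mem hb ha hs
    have hr : ∀ s ∈ Icc (0 : ℝ) 1, r s ∈ D := fun s hs =>
      hD.add_smul_sub_mem he hc hs
    have dp : ∀ s, HasDerivAt (fun s => φ (p s) - φ (r s))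
        (fderiv ℝ φ (p s) (a - b) - fderiv ℝ φ (r s) (c - e)) s := fun s => by
      have h1 : HasDerivAt p (a - b) s := by
        have := ((hasDerivAt_id s).smul_const (a - b)).const_add b
        rwa [one_smul] at this
      have h2 : HasDerivAt r (c - e) s := by
        have := ((hasDerivAt_id s).smul_const (c - e)).const_add e
        rwa [one_smul] at this
      exact ((hd _).hasFDerivAt.comp_hasDerivAt s h1).sub
        ((hd _).hasFDerivAt.comp_hasDerivAt s h2)
    have := (convex_Icc (0 : ℝ) 1).norm_image_sub_le_of_norm_hasDerivWithin_le
      (f := fun s => φ (p s) - φ (r s))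
      (C := B * (‖a - b - (c - e)‖ + (‖a - c‖ + ‖b - e‖) * ‖c - e‖))
      (fun s _ => (dp s).hasDerivWithinAt) (fun s hs => by
        have e1 : fderiv ℝ φ (p s) (a - b) - fderiv ℝ φ (r s) (c - e) =
            fderiv ℝ φ (p s) (a - b - (c - e)) +
              (fderiv ℝ φ (p s) - fderiv ℝ φ (r s)) (c - e) := by
          rw [(fderiv ℝ φ (p s)).map_sub (a - b) (c - e), sub_apply]; abel
        have e2 : ‖p s - r s‖ ≤ ‖a - c‖ + ‖b - e‖ := by
          have : p s - r s = s • (a - c) + (1 - s) • (b - e) := by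
            simp only [p, r, smul_sub, sub_smul, one_smul]; abel
          rw [this]
          refine (norm_add_le _ _).trans (add_le_add ?_ ?_)
          · rw [norm_smul, Real.norm_eq_abs, abs_of_nonneg hs.1]
            exact mul_le_of_le_one_left (norm_nonneg _) hs.2
          · rw [norm_smul, Real.norm_eq_abs, abs_of_nonneg (by linarith [hs.2])]
            exact mul_le_of_le_one_left (norm_nonneg _) (by linarith [hs.1])
        rw [e1]
        calc _ ≤ ‖fderiv ℝ φ (p s)‖ * ‖a - b - (c - e)‖ +
              ‖fderiv ℝ φ (p s) - fderiv ℝ φ (r s)‖ * ‖c - e‖ :=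
              (norm_add_le _ _).trans (add_le_add (ContinuousLinearMap.le_opNorm _ _)
                (ContinuousLinearMap.le_opNorm _ _))
          _ ≤ B * ‖a - b - (c - e)‖ + (B * (‖a - c‖ + ‖b - e‖)) * ‖c - e‖ := by
              gcongr
              · exact b1 _ (hp s hs)
              · exact (lip1 _ (hp s hs) _ (hr s hs)).trans (by gcongr)
          _ = _ := by ring)
      (left_mem_Icc.2 zero_le_one) (right_mem_Icc.2 zero_le_one)
    simp only [p, r, one_smul, zero_smul, add_zero, add_sub_cancel, sub_zero, norm_one,
      mul_one] at this
    calc _ = ‖φ a - φ c - (φ b - φ e)‖ := by congr 1; abel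
      _ ≤ _ := this

end C2Bounds

/-! ### Bounds on the closed loops, uniform in time and in `ε`. -/

section LoopBounds

variable {E Q G : Type*} [NormedAddCommGroup E] [NormedSpace ℝ E] [FiniteDimensional ℝ E]
  [NormedAddCommGroup Q] [NormedSpace ℝ Q]
  [NormedAddCommGroup G] [NormedSpace ℝ G]

/-- States of norm at most `R`, nonnegative times, and parameters in `[0, 1]`. -/
def loopDomain (V : Type*) [NormedAddCommGroup V] (R : ℝ) : Set (V × ℝ × ℝ) :=
  {z | ‖z.1‖ ≤ R ∧ 0 ≤ z.2.1 ∧ z.2.2 ∈ Icc (0 : ℝ) 1}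

theorem convex_loopDomain (V : Type*) [NormedAddCommGroup V] [NormedSpace ℝ V] (R : ℝ) :
    Convex ℝ (loopDomain V R) := by
  have h : loopDomain V R = Metric.closedBall 0 R ×ˢ (Ici (0 : ℝ) ×ˢ Icc (0 : ℝ) 1) := by
    ext z; simp [loopDomain]
  rw [h]
  exact (convex_closedBall _ _).prod ((convex_Ici _).prod (convex_Icc _ _))

theorem c2BoundedOn_state {φ : E → G} (hφ : ContDiff ℝ 2 φ) (R : ℝ) :
    C2BoundedOn (fun z : (E × Q) × ℝ × ℝ => φ z.1.1) (loopDomain (E × Q) R) := by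
  have := FiniteDimensional.proper ℝ E
  refine (C2BoundedOn.of_isCompact hφ (isCompact_closedBall (0 : E) R)).comp
    (ContinuousLinearMap.derivsBoundedOn
      (ContinuousLinearMap.fst ℝ E Q ∘L ContinuousLinearMap.fst ℝ (E × Q) (ℝ × ℝ))) ?_
  intro z hz
  simpa using (norm_fst_le z.1).trans hz.1

/-- Since `ε` is treated as a variable in the compact interval `[0, 1]`, compactness gives bounds
uniform in `ε`. The derivative of `h` in the virtual output is what calls for `h` of class `C³`. -/
theorem c2BoundedOn_extOutput {g : E → E} {h : E → ℝ} (hg : ContDiff ℝ 2 g)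
    (hh : ContDiff ℝ 3 h) (R : ℝ) :
    C2BoundedOn (fun z : (E × Q) × ℝ × ℝ => extOutput g h z.2.2 z.1.1)
      (loopDomain (E × Q) R) := by
  have := FiniteDimensional.proper ℝ E
  have hd : ContDiff ℝ 2 (fun x => fderiv ℝ h x (g x)) :=
    (hh.fderiv_right (m := 2) (by norm_num)).clm_apply hg
  have hc : ContDiff ℝ 2 (fun z : E × ℝ => extOutput g h z.2 z.1) :=
    ((hh.of_le (by norm_num)).comp contDiff_fst).prodMk
      (contDiff_snd.mul (hd.comp contDiff_fst))
  refine (C2BoundedOn.of_isCompact hc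
    ((isCompact_closedBall (0 : E) R).prod (isCompact_Icc (a := (0 : ℝ)) (b := 1)))).comp
    (φ := fun z : (E × Q) × ℝ × ℝ => (z.1.1, z.2.2))
    (ContinuousLinearMap.derivsBoundedOn
      ((ContinuousLinearMap.fst ℝ E Q ∘L ContinuousLinearMap.fst ℝ (E × Q) (ℝ × ℝ)).prod
        (ContinuousLinearMap.snd ℝ ℝ ℝ ∘L ContinuousLinearMap.snd ℝ (E × Q) (ℝ × ℝ)))) ?_
  intro z hz
  exact ⟨by simpa using (norm_fst_le z.1).trans hz.1, hz.2.2⟩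

theorem UniformC2.c2BoundedOn [FiniteDimensional ℝ Q] {φ : Q → ℝ × ℝ → ℝ → G}
    (hφ : UniformC2 φ) (R : ℝ) :
    C2BoundedOn (fun z : Q × (ℝ × ℝ) × ℝ => φ z.1 z.2.1 z.2.2)
      {z | ‖z.1‖ ≤ R ∧ ‖z.2.1‖ ≤ R ∧ 0 ≤ z.2.2} := by
  have := FiniteDimensional.proper ℝ Q
  obtain ⟨B, hB⟩ := hφ.2 (Metric.closedBall 0 R ×ˢ Metric.closedBall 0 R)
    ((isCompact_closedBall _ _).prod (isCompact_closedBall _ _))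
  exact ⟨hφ.1, B, fun z hz m hm => hB (z.1, z.2.1) ⟨by simpa using hz.1, by simpa using hz.2.1⟩
    z.2.2 hz.2.2 m hm⟩

/-- Time ranges over a half-line, so compactness is replaced by the uniformity in time built into
`UniformC2`. The outputs first have to be confined to a ball, of radius at most `max R C`. -/
theorem UniformC2.c2BoundedOn_feedback [FiniteDimensional ℝ Q] {φ : Q → ℝ × ℝ → ℝ → G}
    (hφ : UniformC2 φ) {g : E → E} {h : E → ℝ} (hg : ContDiff ℝ 2 g) (hh : ContDiff ℝ 3 h) (R : ℝ) :
    C2BoundedOn (fun z : (E × Q) × ℝ × ℝ => φ z.1.2 (extOutput g h z.2.2 z.1.1) z.2.1)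
      (loopDomain (E × Q) R) := by
  have hH := c2BoundedOn_extOutput (Q := Q) hg hh R
  obtain ⟨C, hC⟩ := hH.2
  refine (hφ.c2BoundedOn (max R C)).comp
    (φ := fun z : (E × Q) × ℝ × ℝ => (z.1.2, extOutput g h z.2.2 z.1.1, z.2.1))
    (DerivsBoundedOn.prodMk (ContinuousLinearMap.derivsBoundedOn
      (ContinuousLinearMap.snd ℝ E Q ∘L ContinuousLinearMap.fst ℝ (E × Q) (ℝ × ℝ)))
      (hH.derivsBoundedOn.prodMk (ContinuousLinearMap.derivsBoundedOn
        (ContinuousLinearMap.fst ℝ ℝ ℝ ∘L ContinuousLinearMap.snd ℝ (E × Q) (ℝ × ℝ))))) ?_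
  intro z hz
  refine ⟨((norm_snd_le z.1).trans hz.1).trans (le_max_left _ _), ?_, hz.2.1⟩
  have := hC z hz 0 (by norm_num)
  rw [norm_iteratedFDeriv_zero] at this
  exact this.trans (le_max_right _ _)

theorem c2BoundedOn_idealField [FiniteDimensional ℝ Q] {f g : E → E} {h : E → ℝ}
    {α : Q → ℝ × ℝ → ℝ → ℝ}
    {a : Q → ℝ × ℝ → ℝ → Q} (hf : ContDiff ℝ 2 f) (hg : ContDiff ℝ 2 g) (hh : ContDiff ℝ 3 h)
    (hα : UniformC2 α) (ha : UniformC2 a) (R : ℝ) :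
    C2BoundedOn (fun z : (E × Q) × ℝ × ℝ => idealField f g h α a z.2.2 z.2.1 z.1)
      (loopDomain (E × Q) R) :=
  C2BoundedOn.prodMk ((c2BoundedOn_state hf R).add
    ((hα.c2BoundedOn_feedback hg hh R).smul (c2BoundedOn_state hg R)))
    (ha.c2BoundedOn_feedback hg hh R)

end LoopBounds

/-! ### Integral comparison off small sets, and the speed of solutions. -/

/-- Two integrands that are close outside small sets have close integrals. -/
theorem norm_integral_sub_le_of_indicator {W : Type*} [NormedAddCommGroup W] [NormedSpace ℝ W]
    {φ ψ : ℝ → W} {θ b₁ b₂ b₃ : ℝ} {S S' : Set ℝ} (hθ : θ ∈ Icc (0 : ℝ) 1)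
    (hφ : IntervalIntegrable φ volume 0 θ) (hψ : IntervalIntegrable ψ volume 0 θ)
    (hS : MeasurableSet S) (hSf : volume S ≠ ⊤) (hS' : MeasurableSet S') (hSf' : volume S' ≠ ⊤)
    (hb₁ : 0 ≤ b₁) (hb₂ : 0 ≤ b₂) (hb₃ : 0 ≤ b₃)
    (h : ∀ σ ∈ Icc 0 θ, ‖φ σ - ψ σ‖ ≤
      b₁ + b₂ * S.indicator 1 σ + b₃ * S'.indicator 1 σ) :
    ‖(∫ σ in (0 : ℝ)..θ, φ σ) - ∫ σ in (0 : ℝ)..θ, ψ σ‖ ≤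
      b₁ + b₂ * volume.real S + b₃ * volume.real S' := by
  rw [← intervalIntegral.integral_sub hφ hψ]
  have hi : ∀ {A : Set ℝ}, MeasurableSet A → volume A ≠ ⊤ →
      Integrable (A.indicator (1 : ℝ → ℝ)) volume := fun hA hAf =>
    (integrable_indicator_iff hA).2 (integrableOn_const hAf)
  have hI : ∀ {A : Set ℝ}, MeasurableSet A → volume A ≠ ⊤ →
      ∫ σ in (0 : ℝ)..θ, A.indicator (1 : ℝ → ℝ) σ ≤ volume.real A := fun {A} hA hAf => by
    rw [intervalIntegral.integral_of_le hθ.1]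
    refine (setIntegral_le_integral (hi hA hAf) (Filter.Eventually.of_forall fun σ =>
      indicator_nonneg (fun _ _ => zero_le_one) _)).trans ?_
    rw [integral_indicator_one hA]
  have h1 := (hi hS hSf).intervalIntegrable (a := 0) (b := θ) |>.const_mul b₂
  have h2 := (hi hS' hSf').intervalIntegrable (a := 0) (b := θ) |>.const_mul b₃
  have h0 : IntervalIntegrable (fun _ => b₁) volume 0 θ := intervalIntegrable_const
  refine (intervalIntegral.norm_integral_le_of_norm_le hθ.1
    (Filter.Eventually.of_forall fun σ hσ => h σ ⟨hσ.1.le, hσ.2⟩) ((h0.add h1).add h2)).trans ?_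
  rw [intervalIntegral.integral_add (h0.add h1) h2, intervalIntegral.integral_add h0 h1,
    intervalIntegral.integral_const, intervalIntegral.integral_const_mul,
    intervalIntegral.integral_const_mul]
  have := mul_le_mul_of_nonneg_left (hI hS hSf) hb₂
  have := mul_le_mul_of_nonneg_left (hI hS' hSf') hb₃
  have : (θ - 0) • b₁ ≤ b₁ := by
    rw [smul_eq_mul, sub_zero]; exact mul_le_of_le_one_left hb₁ hθ.2
  linarith

/-- A solution whose field is bounded by `S` near its initial value moves at speed at most `S`. -/
theorem IsSolution.norm_sub_le_of_bound {V : Type*} [NormedAddCommGroup V] [NormedSpace ℝ V]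
    {F : ℝ → V → V} {Z : ℝ → V} {c S ρ : ℝ} (h : IsSolution F 0 c Z) (hc : c ≤ 1)
    (hS : 0 ≤ S) (hSρ : S < ρ)
    (hF : ∀ θ ∈ Icc 0 c, ∀ X, ‖X - Z 0‖ ≤ ρ → ‖F θ X‖ ≤ S) :
    ∀ θ ∈ Icc 0 c, ‖Z θ - Z 0‖ ≤ S * θ := by
  intro θ hθ
  have h0c : 0 ≤ c := hθ.1.trans hθ.2
  have hZ := h.continuousOn h0c
  -- A solution that has stayed in the ball up to `θ`, excluded, obeys the speed bound at `θ`
  -- itself, since one instant does not count in the integral.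
  have step : ∀ θ ∈ Icc 0 c, (∀ σ ∈ Ico 0 θ, ‖Z σ - Z 0‖ ≤ ρ) → ‖Z θ - Z 0‖ ≤ S * θ := by
    intro θ hθ hσ
    rw [h.2 θ hθ, add_sub_cancel_left]
    have := intervalIntegral.norm_integral_le_of_norm_le_const_ae (a := 0) (b := θ)
      (f := fun τ => F τ (Z τ)) (C := S) (by
        filter_upwards [ae_ne_real θ] with σ hne hm
        rw [uIoc_of_le hθ.1] at hm
        exact hF σ ⟨hm.1.le, hm.2.trans hθ.2⟩ _ (hσ σ ⟨hm.1.le, lt_of_le_of_ne hm.2 hne⟩))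
    rwa [sub_zero, abs_of_nonneg hθ.1] at this
  -- At a first instant `m ≤ 1` with distance at least `ρ`, the preceding step would give `ρ ≤ S m ≤
  -- S`, against `S < ρ`.
  have hall : ∀ θ ∈ Icc 0 c, ‖Z θ - Z 0‖ < ρ := by
    by_contra hcon
    push Not at hcon
    obtain ⟨θ₁, hθ₁, hθ₁'⟩ := hcon
    have hcl : IsCompact (Icc 0 c ∩ (fun θ => ‖Z θ - Z 0‖) ⁻¹' Ici ρ) :=
      isCompact_Icc.of_isClosed_subset
        ((hZ.sub continuousOn_const).norm.preimage_isClosed_of_isClosed isClosed_Icc isClosed_Ici)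
        inter_subset_left
    obtain ⟨m, hm, hmin⟩ := hcl.exists_isLeast ⟨θ₁, hθ₁, hθ₁'⟩
    have h1 := step m hm.1 (fun σ hσ => by
      by_contra hlt
      have := hmin ⟨⟨hσ.1, hσ.2.le.trans hm.1.2⟩, (not_le.1 hlt).le⟩
      exact absurd hσ.2 (not_lt.2 this))
    have h2 : S * m ≤ S := mul_le_of_le_one_right hS (hm.1.2.trans hc)
    have h3 : ρ ≤ ‖Z m - Z 0‖ := hm.2
    linarith
  exact step θ hθ fun σ hσ => (hall σ ⟨hσ.1, hσ.2.le.trans hθ.2⟩).le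

/-! ### One PWM period: definitions and crude `O(ε)` bounds. -/

section Period

variable {E Q G : Type*} [NormedAddCommGroup E] [NormedSpace ℝ E]
  [NormedAddCommGroup Q] [NormedSpace ℝ Q] [NormedAddCommGroup G] [NormedSpace ℝ G]

/-- The feedback function `φ` fed by the extended output. -/
noncomputable def idealFeedback (g : E → E) (h : E → ℝ) (φ : Q → ℝ × ℝ → ℝ → G) (ε t : ℝ)
    (X : E × Q) : G :=
  φ X.2 (extOutput g h ε X.1) t

/-- The feedback function `φ` fed by the measured output. -/
noncomputable def measuredFeedback (Hb : ℝ → E → Q → ℝ → ℝ → ℝ × ℝ) (φ : Q → ℝ × ℝ → ℝ → G)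
    (ε t : ℝ) (X : E × Q) : G :=
  φ X.2 (Hb ε X.1 X.2 (t / ε) t) t

/-- The state with its first-order PWM ripple removed. -/
noncomputable def correctedState (um : ℝ) (g : E → E) (h : E → ℝ) (α : Q → ℝ × ℝ → ℝ → ℝ) (ε t : ℝ)
    (X : E × Q) : E × Q :=
  (X.1 - (ε * s1 um (idealFeedback g h α ε t X) (t / ε)) • g X.1, X.2)

/-- Uniform estimates on the data of the closed loops, for states of norm at most `R`. -/
structure LoopEstimates (um : ℝ) (f g : E → E) (h : E → ℝ) (α : Q → ℝ × ℝ → ℝ → ℝ)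
    (a : Q → ℝ × ℝ → ℝ → Q) (Hb : ℝ → E → Q → ℝ → ℝ → ℝ × ℝ) (R B ε₁ : ℝ) : Prop where
  one_le : 1 ≤ B
  um_pos : 0 < um
  um_le : um ≤ B
  inv_um_le : um⁻¹ ≤ B
  ε₁_le : ε₁ ≤ 1
  field_continuous : Continuous fun z : (E × Q) × ℝ × ℝ => idealField f g h α a z.2.2 z.2.1 z.1
  field : C2Estimates (fun z : (E × Q) × ℝ × ℝ => idealField f g h α a z.2.2 z.2.1 z.1)
    (loopDomain (E × Q) R) B
  duty : C2Estimates (fun z : (E × Q) × ℝ × ℝ => idealFeedback g h α z.2.2 z.2.1 z.1)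
    (loopDomain (E × Q) R) B
  ctrl : C2Estimates (fun z : (E × Q) × ℝ × ℝ => idealFeedback g h a z.2.2 z.2.1 z.1)
    (loopDomain (E × Q) R) B
  drift : C2Estimates f (Metric.closedBall 0 R) B
  input : C2Estimates g (Metric.closedBall 0 R) B
  output : C2Estimates h (Metric.closedBall 0 R) B
  corrected : ∀ ε ∈ Ioo 0 ε₁, ∀ t, 0 ≤ t → ∀ X : E × Q, ‖X‖ ≤ R - 1 →
    ‖correctedState um g h α ε t X‖ ≤ R
  measured_duty : ∀ ε ∈ Ioo 0 ε₁, ∀ t, 0 ≤ t → ∀ X : E × Q, ‖X‖ ≤ R - 1 →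
    |measuredFeedback Hb α ε t X -
      idealFeedback g h α ε t (correctedState um g h α ε t X)| ≤ B * ε ^ 2
  measured_ctrl : ∀ ε ∈ Ioo 0 ε₁, ∀ t, 0 ≤ t → ∀ X : E × Q, ‖X‖ ≤ R - 1 →
    ‖measuredFeedback Hb a ε t X -
      idealFeedback g h a ε t (correctedState um g h α ε t X)‖ ≤ B * ε ^ 2

variable {um : ℝ} {f g : E → E} {h : E → ℝ} {α : Q → ℝ × ℝ → ℝ → ℝ}
  {a : Q → ℝ × ℝ → ℝ → Q} {Hb : ℝ → E → Q → ℝ → ℝ → ℝ × ℝ} {R B ε₁ : ℝ}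

theorem lip_time_of_estimates {φ : Q → ℝ × ℝ → ℝ → G}
    (hφ : C2Estimates (fun z : (E × Q) × ℝ × ℝ => idealFeedback g h φ z.2.2 z.2.1 z.1)
      (loopDomain (E × Q) R) B) (hB : 0 ≤ B) {ε t t' d : ℝ} (hε : ε ∈ Icc (0 : ℝ) 1) (ht : 0 ≤ t)
    (ht' : 0 ≤ t') {X X' : E × Q} (hX : ‖X‖ ≤ R) (hX' : ‖X'‖ ≤ R) (hd : ‖X - X'‖ ≤ d)
    (hdt : |t - t'| ≤ d) :
    ‖idealFeedback g h φ ε t X - idealFeedback g h φ ε t' X'‖ ≤ B * d := by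
  refine (hφ.lip (X, t, ε) ⟨hX, ht, hε⟩ (X', t', ε) ⟨hX', ht', hε⟩).trans ?_
  refine mul_le_mul_of_nonneg_left ?_ hB
  simp only [Prod.mk_sub_mk, sub_self]
  refine norm_prod_le_iff.2 ⟨hd, norm_prod_le_iff.2 ⟨hdt, ?_⟩⟩
  simpa using (norm_nonneg _).trans hd

theorem LoopEstimates.lip_field (hL : LoopEstimates um f g h α a Hb R B ε₁) {ε t t' d : ℝ}
    (hε : ε ∈ Icc (0 : ℝ) 1) (ht : 0 ≤ t)
    (ht' : 0 ≤ t') {X X' : E × Q} (hX : ‖X‖ ≤ R) (hX' : ‖X'‖ ≤ R) (hd : ‖X - X'‖ ≤ d)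
    (hdt : |t - t'| ≤ d) :
    ‖idealField f g h α a ε t X - idealField f g h α a ε t' X'‖ ≤ B * d := by
  refine (hL.field.lip (X, t, ε) ⟨hX, ht, hε⟩ (X', t', ε) ⟨hX', ht', hε⟩).trans ?_
  refine mul_le_mul_of_nonneg_left ?_ (zero_le_one.trans hL.one_le)
  simp only [Prod.mk_sub_mk, sub_self]
  refine norm_prod_le_iff.2 ⟨hd, norm_prod_le_iff.2 ⟨hdt, ?_⟩⟩
  simpa using (norm_nonneg _).trans hd

theorem LoopEstimates.norm_pwmField_le (hL : LoopEstimates um f g h α a Hb R B ε₁) {ε t : ℝ}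
    (hε : ε ∈ Ioo 0 ε₁) (ht : 0 ≤ t) {X : E × Q} (hX : ‖X‖ ≤ R - 1) :
    ‖pwmField um f g α a Hb ε t X‖ ≤ 2 * B ^ 2 := by
  have hB := hL.one_le
  have hε1 : ε ≤ 1 := hε.2.le.trans hL.ε₁_le
  have hx : X.1 ∈ Metric.closedBall (0 : E) R := by
    simpa using (norm_fst_le X).trans (by linarith)
  have h1 := hL.drift.bound _ hx
  have h2 := hL.input.bound _ hx
  have h3 := hL.ctrl.bound (correctedState um g h α ε t X, t, ε)
    ⟨hL.corrected ε hε t ht X hX, ht, hε.1.le, hε1⟩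
  have h4 := hL.measured_ctrl ε hε t ht X hX
  refine norm_prod_le_iff.2 ⟨?_, ?_⟩
  · refine (norm_add_le _ _).trans ?_
    rw [norm_smul, Real.norm_eq_abs, abs_pwm hL.um_pos]
    have : um * ‖g X.1‖ ≤ B * B := mul_le_mul hL.um_le h2 (norm_nonneg _) (by linarith)
    nlinarith
  · have h5 : ‖measuredFeedback Hb a ε t X‖ ≤ B * ε ^ 2 + B := by
      have := norm_add_le (measuredFeedback Hb a ε t X -
        idealFeedback g h a ε t (correctedState um g h α ε t X))
        (idealFeedback g h a ε t (correctedState um g h α ε t X))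
      rw [sub_add_cancel] at this
      exact this.trans (add_le_add h4 h3)
    have h6 : ε ^ 2 ≤ 1 := pow_le_one₀ hε.1.le hε1
    refine h5.trans ?_
    nlinarith

/-- A solution of the PWM-fed loop over (part of) the period number `j`, in normalized time,
with a duty cycle that stays in the range of the encoder near the initial state. -/
structure PeriodSolution (um : ℝ) (f g : E → E) (h : E → ℝ) (α : Q → ℝ × ℝ → ℝ → ℝ)
    (a : Q → ℝ × ℝ → ℝ → Q) (Hb : ℝ → E → Q → ℝ → ℝ → ℝ × ℝ) (R B ε₁ ρ ε : ℝ) (j : ℕ) (c : ℝ)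
    (Z : ℝ → E × Q) : Prop where
  hε : ε ∈ Ioo 0 ε₁
  small : 2 * B ^ 2 * ε < ρ
  hρ : ρ ≤ 1
  norm_init : ‖Z 0‖ ≤ R - 2
  hc : c ∈ Icc (0 : ℝ) 1
  sol : IsSolution (fun θ X => ε • pwmField um f g α a Hb ε (j * ε + ε * θ) X) 0 c Z
  range : ∀ X : E × Q, ‖X - Z 0‖ ≤ ρ → ∀ θ ∈ Icc (0 : ℝ) 1,
    |idealFeedback g h α ε (j * ε + ε * θ) X| ≤ um

/-- The first-order prediction of the ideal loop from `p`, in normalized time. -/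
noncomputable def eulerCurve (f g : E → E) (h : E → ℝ) (α : Q → ℝ × ℝ → ℝ → ℝ)
    (a : Q → ℝ × ℝ → ℝ → Q) (ε τ : ℝ) (p : E × Q) (θ : ℝ) : E × Q :=
  p + (ε * θ) • idealField f g h α a ε τ p

namespace PeriodSolution

variable {ρ ε c : ℝ} {j : ℕ} {Z : ℝ → E × Q}

section
variable (hP : PeriodSolution um f g h α a Hb R B ε₁ ρ ε j c Z)
  (hL : LoopEstimates um f g h α a Hb R B ε₁)
include hP

theorem time_nonneg {θ : ℝ} (hθ : 0 ≤ θ) : 0 ≤ j * ε + ε * θ := by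
  have := hP.hε.1
  positivity

theorem time_div (θ : ℝ) : (j * ε + ε * θ) / ε = j + θ := by
  have := hP.hε.1.ne'
  field_simp

theorem abs_duty_init_le : |idealFeedback g h α ε (j * ε) (Z 0)| ≤ um := by
  have hρ : 0 ≤ ρ := by
    have := hP.small
    have := hP.hε.1
    have : 0 ≤ 2 * B ^ 2 * ε := by positivity
    linarith
  have := hP.range (Z 0) (by simpa using hρ) 0 ⟨le_rfl, zero_le_one⟩
  rwa [mul_zero, add_zero] at this

theorem abs_time_sub_le {θ : ℝ} (hθ : θ ∈ Icc 0 c) : |j * ε + ε * θ - j * ε| ≤ ε := by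
  have h1 : j * ε + ε * θ - j * ε = ε * θ := by ring
  rw [h1, abs_of_nonneg (mul_nonneg hP.hε.1.le hθ.1)]
  exact mul_le_of_le_one_right hP.hε.1.le (hθ.2.trans hP.hc.2)

include hL

theorem eps_le_one : ε ≤ 1 := hP.hε.2.le.trans hL.ε₁_le

theorem norm_sub_init_le {θ : ℝ} (hθ : θ ∈ Icc 0 c) : ‖Z θ - Z 0‖ ≤ 2 * B ^ 2 * ε := by
  have hB := hL.one_le
  have hε := hP.hε.1
  have h1 := hP.sol.norm_sub_le_of_bound hP.hc.2 (S := 2 * B ^ 2 * ε) (by positivity) hP.small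
    (fun θ hθ X hX => by
      rw [norm_smul, Real.norm_eq_abs, abs_of_pos hε, mul_comm]
      refine mul_le_mul_of_nonneg_right (hL.norm_pwmField_le hP.hε (hP.time_nonneg hθ.1) ?_) hε.le
      have := norm_add_le (X - Z 0) (Z 0)
      rw [sub_add_cancel] at this
      linarith [hP.norm_init, hP.hρ]) θ hθ
  refine h1.trans (mul_le_of_le_one_right (by positivity) (hθ.2.trans hP.hc.2))

theorem norm_le {θ : ℝ} (hθ : θ ∈ Icc 0 c) : ‖Z θ‖ ≤ R - 1 := by
  have := norm_add_le (Z θ - Z 0) (Z 0)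
  rw [sub_add_cancel] at this
  linarith [hP.norm_init, hP.hρ, hP.norm_sub_init_le hL hθ, hP.small]

theorem abs_duty_le {θ : ℝ} (hθ : θ ∈ Icc 0 c) :
    |idealFeedback g h α ε (j * ε + ε * θ) (Z θ)| ≤ um :=
  hP.range _ ((hP.norm_sub_init_le hL hθ).trans hP.small.le) θ ⟨hθ.1, hθ.2.trans hP.hc.2⟩

theorem eps_le : ε ≤ B ^ 2 * ε := by
  have : 1 ≤ B ^ 2 := one_le_pow₀ hL.one_le
  nlinarith [hP.hε.1]

theorem norm_input_le {θ : ℝ} (hθ : θ ∈ Icc 0 c) : ‖g (Z θ).1‖ ≤ B :=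
  hL.input.bound _ (by
    simpa using (norm_fst_le (Z θ)).trans (by linarith [hP.norm_le hL hθ]))

theorem norm_corrected_sub_init_le {θ : ℝ} (hθ : θ ∈ Icc 0 c) :
    ‖correctedState um g h α ε (j * ε + ε * θ) (Z θ) - Z 0‖ ≤ 4 * B ^ 2 * ε := by
  have hB := hL.one_le
  have hε := hP.hε.1
  have h1 := hP.norm_sub_init_le hL hθ
  have h2 : ‖correctedState um g h α ε (j * ε + ε * θ) (Z θ) - Z θ‖ ≤ 2 * B ^ 2 * ε := by
    rw [correctedState, hP.time_div]
    refine norm_prod_le_iff.2 ⟨?_, by simp; positivity⟩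
    simp only [Prod.fst_sub, sub_sub_cancel_left, norm_neg]
    rw [norm_smul, norm_mul, Real.norm_eq_abs, Real.norm_eq_abs, abs_of_pos hε]
    have h3 := abs_s1_le_of_abs_le hL.um_pos (hP.abs_duty_le hL hθ) (j + θ)
    have h4 := hP.norm_input_le hL hθ
    have h5 := hL.um_le
    calc _ ≤ ε * (2 * B) * B := by gcongr; linarith
      _ = _ := by ring
  have := norm_add_le (correctedState um g h α ε (j * ε + ε * θ) (Z θ) - Z θ) (Z θ - Z 0)
  rw [sub_add_sub_cancel] at this
  linarith

/-- The crude stage of the bootstrap, for `φ` either of the two feedback functions: freezing the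
feedback at the beginning of the period costs `O(ε)`. For the duty cycle this bounds the measure of
the set where the frozen PWM signal is wrong. -/
theorem norm_measured_sub_init_le {φ : Q → ℝ × ℝ → ℝ → G}
    (hφ : C2Estimates (fun z : (E × Q) × ℝ × ℝ => idealFeedback g h φ z.2.2 z.2.1 z.1)
      (loopDomain (E × Q) R) B)
    (hm : ∀ ε ∈ Ioo 0 ε₁, ∀ t, 0 ≤ t → ∀ X : E × Q, ‖X‖ ≤ R - 1 →
      ‖measuredFeedback Hb φ ε t X -
        idealFeedback g h φ ε t (correctedState um g h α ε t X)‖ ≤ B * ε ^ 2)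
    {θ : ℝ} (hθ : θ ∈ Icc 0 c) :
    ‖measuredFeedback Hb φ ε (j * ε + ε * θ) (Z θ) - idealFeedback g h φ ε (j * ε) (Z 0)‖ ≤
      5 * B ^ 3 * ε := by
  have hB := hL.one_le
  have hε := hP.hε.1
  have hε1 := hP.eps_le_one hL
  have ht := hP.time_nonneg hθ.1
  have h1 := hm ε hP.hε _ ht (Z θ) (hP.norm_le hL hθ)
  have h2 := lip_time_of_estimates hφ (by linarith) ⟨hε.le, hε1⟩ ht
    (t' := j * ε) (by positivity) (hL.corrected ε hP.hε _ ht _ (hP.norm_le hL hθ))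
    (by linarith [hP.norm_init]) (hP.norm_corrected_sub_init_le hL hθ)
    ((hP.abs_time_sub_le hθ).trans (by linarith [hP.eps_le hL]))
  have h3 := norm_sub_le_norm_sub_add_norm_sub (measuredFeedback Hb φ ε (j * ε + ε * θ) (Z θ))
    (idealFeedback g h φ ε (j * ε + ε * θ) (correctedState um g h α ε (j * ε + ε * θ) (Z θ)))
    (idealFeedback g h φ ε (j * ε) (Z 0))
  refine h3.trans ((add_le_add h1 h2).trans ?_)
  have : B * ε ^ 2 ≤ B ^ 3 * ε := by
    have e1 : B ≤ B ^ 3 := le_self_pow₀ hB (by norm_num)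
    have e2 : ε ^ 2 ≤ ε := by nlinarith
    gcongr
  linarith

end

end PeriodSolution

end Period

theorem intervalIntegrable_smul_const {W : Type*} [NormedAddCommGroup W] [NormedSpace ℝ W]
    {φ : ℝ → ℝ} {a b : ℝ} (h : IntervalIntegrable φ volume a b) (w : W) :
    IntervalIntegrable (fun t => φ t • w) volume a b :=
  ⟨h.1.smul_const w, h.2.smul_const w⟩

section Components

variable {E Q : Type*} [NormedAddCommGroup E] [NormedSpace ℝ E] [CompleteSpace E]
  [NormedAddCommGroup Q] [NormedSpace ℝ Q] [CompleteSpace Q] {F : ℝ → E × Q → E × Q}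
  {Z : ℝ → E × Q} {s T t : ℝ}

theorem IsSolution.fst_eq (h : IsSolution F s T Z) (ht : t ∈ Icc s T) :
    IntervalIntegrable (fun τ => (F τ (Z τ)).1) volume s t ∧
      (Z t).1 = (Z s).1 + ∫ τ in s..t, (F τ (Z τ)).1 := by
  have h1 := (h.mono le_rfl ht.1 ht.2).1
  refine ⟨⟨(ContinuousLinearMap.fst ℝ E Q).integrable_comp h1.1,
    (ContinuousLinearMap.fst ℝ E Q).integrable_comp h1.2⟩, ?_⟩
  have h2 := (ContinuousLinearMap.fst ℝ E Q).intervalIntegral_comp_comm h1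
  simp only [ContinuousLinearMap.coe_fst'] at h2
  rw [h2, h.2 t ht, Prod.fst_add]

theorem IsSolution.snd_eq (h : IsSolution F s T Z) (ht : t ∈ Icc s T) :
    IntervalIntegrable (fun τ => (F τ (Z τ)).2) volume s t ∧
      (Z t).2 = (Z s).2 + ∫ τ in s..t, (F τ (Z τ)).2 := by
  have h1 := (h.mono le_rfl ht.1 ht.2).1
  refine ⟨⟨(ContinuousLinearMap.snd ℝ E Q).integrable_comp h1.1,
    (ContinuousLinearMap.snd ℝ E Q).integrable_comp h1.2⟩, ?_⟩
  have h2 := (ContinuousLinearMap.snd ℝ E Q).intervalIntegral_comp_comm h1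
  simp only [ContinuousLinearMap.coe_snd'] at h2
  rw [h2, h.2 t ht, Prod.snd_add]

end Components

theorem abs_pwm_sub_le_indicator {um : ℝ} (hum : 0 < um) {S : Set ℝ} {v w θ : ℝ}
    (h : θ ∉ S → pwm um v θ = pwm um w θ) :
    |pwm um v θ - pwm um w θ| ≤ 2 * um * S.indicator 1 θ := by
  by_cases hS : θ ∈ S
  · rw [indicator_of_mem hS]
    refine (abs_sub _ _).trans ?_
    rw [abs_pwm hum, abs_pwm hum]; simp; linarith
  · rw [h hS, indicator_of_notMem hS]; simp

/-! ### One PWM period: first-order expansion, and feedbacks up to `O(ε²)`. -/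

section Period

variable {E Q G : Type*} [NormedAddCommGroup E] [NormedSpace ℝ E]
  [NormedAddCommGroup Q] [NormedSpace ℝ Q] [NormedAddCommGroup G] [NormedSpace ℝ G]
  {um : ℝ} {f g : E → E} {h : E → ℝ} {α : Q → ℝ × ℝ → ℝ → ℝ}
  {a : Q → ℝ × ℝ → ℝ → Q} {Hb : ℝ → E → Q → ℝ → ℝ → ℝ × ℝ} {R B ε₁ : ℝ}
  {ρ ε c : ℝ} {j : ℕ} {Z : ℝ → E × Q}

namespace PeriodSolution

/-- In normalized time the encoder phase is `j + θ`, which periodicity reduces to `θ`. -/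
theorem fst_pwmField (hP : PeriodSolution um f g h α a Hb R B ε₁ ρ ε j c Z) (θ : ℝ) (X : E × Q) :
    (ε • pwmField um f g α a Hb ε (j * ε + ε * θ) X).1 =
      ε • (f X.1 + pwm um (measuredFeedback Hb α ε (j * ε + ε * θ) X) θ • g X.1) := by
  have := pwm_add_natCast um (measuredFeedback Hb α ε (j * ε + ε * θ) X) θ j
  rw [← this, ← hP.time_div θ]
  rfl

theorem mem_ball_fst (hP : PeriodSolution um f g h α a Hb R B ε₁ ρ ε j c Z)
    (hL : LoopEstimates um f g h α a Hb R B ε₁) {θ : ℝ} (hθ : θ ∈ Icc 0 c) :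
    (Z θ).1 ∈ Metric.closedBall (0 : E) R := by
  simpa using (norm_fst_le (Z θ)).trans (by linarith [hP.norm_le hL hθ])

theorem mem_ball_init (hP : PeriodSolution um f g h α a Hb R B ε₁ ρ ε j c Z)
    (hL : LoopEstimates um f g h α a Hb R B ε₁) :
    (Z 0).1 ∈ Metric.closedBall (0 : E) R :=
  hP.mem_ball_fst hL ⟨le_rfl, hP.hc.1⟩

/-- Disagreement set of the actual PWM output with that of the frozen duty cycle. -/
theorem exists_disagreement_init (hP : PeriodSolution um f g h α a Hb R B ε₁ ρ ε j c Z)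
    (hL : LoopEstimates um f g h α a Hb R B ε₁) :
    ∃ S : Set ℝ, MeasurableSet S ∧ volume.real S ≤ 4 * (5 * B ^ 3 * ε / um) ∧ volume S ≠ ⊤ ∧
      ∀ θ ∈ Icc 0 c, |pwm um (measuredFeedback Hb α ε (j * ε + ε * θ) (Z θ)) θ -
        pwm um (idealFeedback g h α ε (j * ε) (Z 0)) θ| ≤ 2 * um * S.indicator 1 θ := by
  have hB := hL.one_le
  have hε := hP.hε.1
  obtain ⟨S, hS, hSv, hSf, hSd⟩ := exists_pwm_disagreement hL.um_pos
    (υ := fun _ => idealFeedback g h α ε (j * ε) (Z 0)) hP.hc.2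
    (fun θ _ θ' _ => by
      rw [sub_self, abs_zero]
      exact mul_nonneg (by linarith [hL.um_pos]) (abs_nonneg _))
    (D := 5 * B ^ 3 * ε) (by positivity)
  exact ⟨S, hS, hSv, hSf, fun θ hθ => abs_pwm_sub_le_indicator hL.um_pos fun hθS =>
    hSd θ hθ _ (hP.norm_measured_sub_init_le hL hL.duty hL.measured_duty hθ) hθS⟩

/-- With state and duty cycle frozen at their initial values, the field integrates exactly to the
Euler increment plus the ripple. Moving the state costs `4 B⁴ ε²`. The wrong PWM outputs cost `2 um
B ε` times the measure `20 B³ ε / um`, where `um` cancels. -/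
theorem norm_fst_sub_le [CompleteSpace E] [CompleteSpace Q]
    (hP : PeriodSolution um f g h α a Hb R B ε₁ ρ ε j c Z)
    (hL : LoopEstimates um f g h α a Hb R B ε₁) {θ : ℝ} (hθ : θ ∈ Icc 0 c) :
    ‖(Z θ).1 - (eulerCurve f g h α a ε (j * ε) (Z 0) θ).1 -
      (ε * s1 um (idealFeedback g h α ε (j * ε) (Z 0)) θ) • g (Z 0).1‖ ≤ 44 * B ^ 4 * ε ^ 2 := by
  have hB := hL.one_le
  have hε := hP.hε.1
  have hum := hL.um_pos
  set u := idealFeedback g h α ε (j * ε) (Z 0) with hu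
  have hu_le : |u| ≤ um := hP.abs_duty_init_le
  obtain ⟨S, hS, hSv, hSf, hSd⟩ := hP.exists_disagreement_init hL
  have hθ1 : θ ∈ Icc (0 : ℝ) 1 := ⟨hθ.1, hθ.2.trans hP.hc.2⟩
  obtain ⟨hi, he⟩ := hP.sol.fst_eq hθ
  have hpi : IntervalIntegrable (fun σ => pwm um u σ) volume 0 θ :=
    intervalIntegrable_pwm_comp hum measurable_const 0 θ
  have hψi : IntervalIntegrable (fun σ => ε • (f (Z 0).1 + pwm um u σ • g (Z 0).1)) volume 0 θ :=
    ((intervalIntegrable_const).add (intervalIntegrable_smul_const hpi _)).smul ε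
  have hψ : ∫ σ in (0 : ℝ)..θ, ε • (f (Z 0).1 + pwm um u σ • g (Z 0).1) =
      ε • (θ • f (Z 0).1 + (u * θ + s1 um u θ) • g (Z 0).1) := by
    rw [intervalIntegral.integral_smul, intervalIntegral.integral_add intervalIntegrable_const
      (intervalIntegrable_smul_const hpi _), intervalIntegral.integral_const,
      intervalIntegral.integral_smul_const,
      integral_pwm hum hu_le hθ1, sub_zero]
  have key := norm_integral_sub_le_of_indicator hθ1 hi hψi hS hSf MeasurableSet.empty (by simp)
    (b₁ := 4 * B ^ 4 * ε ^ 2) (b₂ := 2 * um * B * ε) (b₃ := 0) (by positivity) (by positivity)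
    le_rfl (fun σ hσ => by
      have hσ' : σ ∈ Icc 0 c := ⟨hσ.1, hσ.2.trans hθ.2⟩
      have h1 := hP.norm_sub_init_le hL hσ'
      have h1' : ‖(Z σ).1 - (Z 0).1‖ ≤ 2 * B ^ 2 * ε := (norm_fst_le (Z σ - Z 0)).trans h1
      have hf := hL.drift.lip _ (hP.mem_ball_fst hL hσ') _ (hP.mem_ball_init hL)
      have hg := hL.input.lip _ (hP.mem_ball_fst hL hσ') _ (hP.mem_ball_init hL)
      have hg0 := hL.input.bound _ (hP.mem_ball_init hL)
      have hd := hSd σ hσ'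
      rw [hP.fst_pwmField]
      set v := measuredFeedback Hb α ε (j * ε + ε * σ) (Z σ)
      have e : ε • (f (Z σ).1 + pwm um v σ • g (Z σ).1) - ε • (f (Z 0).1 + pwm um u σ • g (Z 0).1)
          = ε • ((f (Z σ).1 - f (Z 0).1) + pwm um v σ • (g (Z σ).1 - g (Z 0).1) +
            (pwm um v σ - pwm um u σ) • g (Z 0).1) := by module
      rw [e, norm_smul, Real.norm_eq_abs, abs_of_pos hε]
      have i0 : 0 ≤ S.indicator (1 : ℝ → ℝ) σ := indicator_nonneg (fun _ _ => zero_le_one) _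
      calc _ ≤ ε * (‖f (Z σ).1 - f (Z 0).1‖ + |pwm um v σ| * ‖g (Z σ).1 - g (Z 0).1‖ +
            |pwm um v σ - pwm um u σ| * ‖g (Z 0).1‖) := by
            gcongr
            refine (norm_add₃_le).trans ?_
            rw [norm_smul, norm_smul, Real.norm_eq_abs, Real.norm_eq_abs]
        _ ≤ ε * (B * (2 * B ^ 2 * ε) + B * (B * (2 * B ^ 2 * ε)) +
            2 * um * S.indicator 1 σ * B) := by
            gcongr
            · exact hf.trans (by gcongr)
            · rw [abs_pwm hum]; exact hL.um_le
            · exact hg.trans (by gcongr)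
        _ ≤ 4 * B ^ 4 * ε ^ 2 + 2 * um * B * ε * S.indicator 1 σ + 0 := by
            have : B ^ 3 * ε ^ 2 ≤ B ^ 4 * ε ^ 2 := by gcongr; norm_num
            linarith
        _ = _ := by simp)
  rw [hψ] at key
  have e : (Z θ).1 - (eulerCurve f g h α a ε (j * ε) (Z 0) θ).1 - (ε * s1 um u θ) • g (Z 0).1 =
      (∫ σ in (0 : ℝ)..θ, (ε • pwmField um f g α a Hb ε (j * ε + ε * σ) (Z σ)).1) -
        ε • (θ • f (Z 0).1 + (u * θ + s1 um u θ) • g (Z 0).1) := by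
    rw [he]
    have : (eulerCurve f g h α a ε (j * ε) (Z 0) θ).1 =
      (Z 0).1 + (ε * θ) • (f (Z 0).1 + u • g (Z 0).1) := rfl
    rw [this]
    module
  rw [e]
  refine key.trans ?_
  have : 2 * um * B * ε * volume.real S ≤ 40 * B ^ 4 * ε ^ 2 := by
    calc _ ≤ 2 * um * B * ε * (4 * (5 * B ^ 3 * ε / um)) := by gcongr
      _ = _ := by field_simp; ring
  linarith

/-- The controller state receives the PWM signal only through the measured output, so no ripple
appears at order `ε`. -/
theorem norm_snd_sub_le [CompleteSpace E] [CompleteSpace Q]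
    (hP : PeriodSolution um f g h α a Hb R B ε₁ ρ ε j c Z)
    (hL : LoopEstimates um f g h α a Hb R B ε₁) {θ : ℝ} (hθ : θ ∈ Icc 0 c) :
    ‖(Z θ).2 - (eulerCurve f g h α a ε (j * ε) (Z 0) θ).2‖ ≤ 5 * B ^ 3 * ε ^ 2 := by
  have hB := hL.one_le
  have hε := hP.hε.1
  obtain ⟨hi, he⟩ := hP.sol.snd_eq hθ
  have e : (Z θ).2 - (eulerCurve f g h α a ε (j * ε) (Z 0) θ).2 =
      ∫ σ in (0 : ℝ)..θ, ((ε • pwmField um f g α a Hb ε (j * ε + ε * σ) (Z σ)).2 -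
        ε • idealFeedback g h a ε (j * ε) (Z 0)) := by
    rw [intervalIntegral.integral_sub hi intervalIntegrable_const, he,
      intervalIntegral.integral_const]
    have : (eulerCurve f g h α a ε (j * ε) (Z 0) θ).2 =
      (Z 0).2 + (ε * θ) • idealFeedback g h a ε (j * ε) (Z 0) := rfl
    rw [this, sub_zero]
    module
  rw [e]
  refine (intervalIntegral.norm_integral_le_of_norm_le_const (C := 5 * B ^ 3 * ε ^ 2)
    fun σ hσ => ?_).trans ?_
  · rw [uIoc_of_le hθ.1] at hσ
    have := hP.norm_measured_sub_init_le hL hL.ctrl hL.measured_ctrl (θ := σ)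
      ⟨hσ.1.le, hσ.2.trans hθ.2⟩
    change ‖ε • measuredFeedback Hb a ε (j * ε + ε * σ) (Z σ) - _‖ ≤ _
    rw [← smul_sub, norm_smul, Real.norm_eq_abs, abs_of_pos hε]
    calc _ ≤ ε * (5 * B ^ 3 * ε) := by gcongr
      _ = _ := by ring
  · rw [sub_zero, abs_of_nonneg hθ.1]
    exact mul_le_of_le_one_right (by positivity) (hθ.2.trans hP.hc.2)

section Euler

theorem norm_euler_sub_init_le (hP : PeriodSolution um f g h α a Hb R B ε₁ ρ ε j c Z)
    (hL : LoopEstimates um f g h α a Hb R B ε₁) {θ : ℝ} (hθ : θ ∈ Icc (0 : ℝ) 1) :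
    ‖eulerCurve f g h α a ε (j * ε) (Z 0) θ - Z 0‖ ≤ B * ε := by
  have hB := hL.one_le
  have hε := hP.hε.1
  have := hL.field.bound (Z 0, j * ε, ε) ⟨by linarith [hP.norm_init], by positivity, hε.le,
    hP.eps_le_one hL⟩
  rw [eulerCurve, add_sub_cancel_left, norm_smul, Real.norm_eq_abs,
    abs_of_nonneg (mul_nonneg hε.le hθ.1)]
  calc _ ≤ ε * 1 * B := by
        gcongr
        exact hθ.2
    _ = _ := by ring

theorem eps_mul_lt (hP : PeriodSolution um f g h α a Hb R B ε₁ ρ ε j c Z)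
    (hL : LoopEstimates um f g h α a Hb R B ε₁) : B * ε < ρ := by
  have hB := hL.one_le
  have hε := hP.hε.1
  have : B * ε ≤ 2 * B ^ 2 * ε := by gcongr; nlinarith
  exact this.trans_lt hP.small

theorem norm_euler_le (hP : PeriodSolution um f g h α a Hb R B ε₁ ρ ε j c Z)
    (hL : LoopEstimates um f g h α a Hb R B ε₁) {θ : ℝ} (hθ : θ ∈ Icc (0 : ℝ) 1) :
    ‖eulerCurve f g h α a ε (j * ε) (Z 0) θ‖ ≤ R - 1 := by
  have h1 := hP.norm_euler_sub_init_le hL hθ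
  have h2 := norm_add_le (eulerCurve f g h α a ε (j * ε) (Z 0) θ - Z 0) (Z 0)
  rw [sub_add_cancel] at h2
  linarith [hP.norm_init, hP.hρ, hP.eps_mul_lt hL]

theorem abs_duty_euler_le (hP : PeriodSolution um f g h α a Hb R B ε₁ ρ ε j c Z)
    (hL : LoopEstimates um f g h α a Hb R B ε₁) {θ : ℝ} (hθ : θ ∈ Icc (0 : ℝ) 1) :
    |idealFeedback g h α ε (j * ε + ε * θ) (eulerCurve f g h α a ε (j * ε) (Z 0) θ)| ≤ um :=
  hP.range _ ((hP.norm_euler_sub_init_le hL hθ).trans (hP.eps_mul_lt hL).le) θ hθ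

theorem mem_ball_euler (hP : PeriodSolution um f g h α a Hb R B ε₁ ρ ε j c Z)
    (hL : LoopEstimates um f g h α a Hb R B ε₁) {θ : ℝ} (hθ : θ ∈ Icc (0 : ℝ) 1) :
    (eulerCurve f g h α a ε (j * ε) (Z 0) θ).1 ∈ Metric.closedBall (0 : E) R := by
  simpa using (norm_fst_le (eulerCurve f g h α a ε (j * ε) (Z 0) θ)).trans
    (by linarith [hP.norm_euler_le hL hθ])

end Euler

/-- The correction uses the ripple at the current state, whereas the first-order expansion has it at
the initial state. Both `g` and the duty cycle differ by `O(ε)` between these states, and the ripple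
already carries a factor `ε`. -/
theorem norm_corrected_sub_euler_le [CompleteSpace E] [CompleteSpace Q]
    (hP : PeriodSolution um f g h α a Hb R B ε₁ ρ ε j c Z)
    (hL : LoopEstimates um f g h α a Hb R B ε₁) {θ : ℝ} (hθ : θ ∈ Icc 0 c) :
    ‖correctedState um g h α ε (j * ε + ε * θ) (Z θ) -
      eulerCurve f g h α a ε (j * ε) (Z 0) θ‖ ≤ 50 * B ^ 4 * ε ^ 2 := by
  have hB := hL.one_le
  have hε := hP.hε.1
  have hum := hL.um_pos
  have hε1 := hP.eps_le_one hL
  refine norm_prod_le_iff.2 ⟨?_, ?_⟩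
  · have h1 := hP.norm_fst_sub_le hL hθ
    set u := idealFeedback g h α ε (j * ε) (Z 0) with hu
    set v := idealFeedback g h α ε (j * ε + ε * θ) (Z θ) with hv
    have hv_le : |v| ≤ um := hP.abs_duty_le hL hθ
    have hz := hP.norm_sub_init_le hL hθ
    have hz1 : ‖(Z θ).1 - (Z 0).1‖ ≤ 2 * B ^ 2 * ε := (norm_fst_le (Z θ - Z 0)).trans hz
    have huv : |v - u| ≤ B * (2 * B ^ 2 * ε) :=
      lip_time_of_estimates hL.duty (by linarith) ⟨hε.le, hε1⟩ (hP.time_nonneg hθ.1)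
        (t' := j * ε) (by positivity) (by linarith [hP.norm_le hL hθ]) (by linarith [hP.norm_init])
        hz ((hP.abs_time_sub_le hθ).trans (by nlinarith [hP.eps_le hL]))
    have hs := (abs_s1_sub_le hum v u θ).trans huv
    have hs0 := abs_s1_le_of_abs_le hum hv_le θ
    have hg := hL.input.lip _ (hP.mem_ball_fst hL hθ) _ (hP.mem_ball_init hL)
    have hg0 := hL.input.bound _ (hP.mem_ball_init hL)
    simp only [correctedState, Prod.fst_sub, hP.time_div, s1_add_natCast]
    rw [← hv]
    have e : (Z θ).1 - (ε * s1 um v θ) • g (Z θ).1 -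
        (eulerCurve f g h α a ε (j * ε) (Z 0) θ).1 =
        ((Z θ).1 - (eulerCurve f g h α a ε (j * ε) (Z 0) θ).1 - (ε * s1 um u θ) • g (Z 0).1) +
        ((-ε * s1 um v θ) • (g (Z θ).1 - g (Z 0).1) +
        (-ε * (s1 um v θ - s1 um u θ)) • g (Z 0).1) := by module
    rw [e]
    refine (norm_add_le _ _).trans ?_
    have h2 : ‖(-ε * s1 um v θ) • (g (Z θ).1 - g (Z 0).1)‖ ≤
        ε * (2 * B) * (B * (2 * B ^ 2 * ε)) := by
      rw [norm_smul, norm_mul, norm_neg, Real.norm_eq_abs, Real.norm_eq_abs, abs_of_pos hε]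
      gcongr
      · linarith [hL.um_le]
      · exact hg.trans (by gcongr)
    have h3 : ‖(-ε * (s1 um v θ - s1 um u θ)) • g (Z 0).1‖ ≤ ε * (B * (2 * B ^ 2 * ε)) * B := by
      rw [norm_smul, norm_mul, norm_neg, Real.norm_eq_abs, Real.norm_eq_abs, abs_of_pos hε]
      gcongr
    have h4 := norm_add_le ((-ε * s1 um v θ) • (g (Z θ).1 - g (Z 0).1))
      ((-ε * (s1 um v θ - s1 um u θ)) • g (Z 0).1)
    linarith
  · refine (hP.norm_snd_sub_le hL hθ).trans ?_
    have : B ^ 3 * ε ^ 2 ≤ B ^ 4 * ε ^ 2 := by gcongr; norm_num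
    nlinarith [show 0 ≤ B ^ 4 * ε ^ 2 by positivity]

/-- The gain of one order over `norm_measured_sub_init_le`: the corrected output cancels the ripple,
so the measured feedback sees the Euler curve up to `O(ε²)`. -/
theorem norm_measured_sub_euler_le [CompleteSpace E] [CompleteSpace Q]
    (hP : PeriodSolution um f g h α a Hb R B ε₁ ρ ε j c Z)
    (hL : LoopEstimates um f g h α a Hb R B ε₁) {φ : Q → ℝ × ℝ → ℝ → G}
    (hφ : C2Estimates (fun z : (E × Q) × ℝ × ℝ => idealFeedback g h φ z.2.2 z.2.1 z.1)
      (loopDomain (E × Q) R) B)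
    (hm : ∀ ε ∈ Ioo 0 ε₁, ∀ t, 0 ≤ t → ∀ X : E × Q, ‖X‖ ≤ R - 1 →
      ‖measuredFeedback Hb φ ε t X -
        idealFeedback g h φ ε t (correctedState um g h α ε t X)‖ ≤ B * ε ^ 2)
    {θ : ℝ} (hθ : θ ∈ Icc 0 c) :
    ‖measuredFeedback Hb φ ε (j * ε + ε * θ) (Z θ) -
      idealFeedback g h φ ε (j * ε + ε * θ) (eulerCurve f g h α a ε (j * ε) (Z 0) θ)‖ ≤
      51 * B ^ 5 * ε ^ 2 := by
  have hB := hL.one_le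
  have hε := hP.hε.1
  have hε1 := hP.eps_le_one hL
  have ht := hP.time_nonneg hθ.1
  have hθ1 : θ ∈ Icc (0 : ℝ) 1 := ⟨hθ.1, hθ.2.trans hP.hc.2⟩
  have h1 := hm ε hP.hε _ ht (Z θ) (hP.norm_le hL hθ)
  have h2 := lip_time_of_estimates hφ (by linarith) ⟨hε.le, hε1⟩ ht ht
    (hL.corrected ε hP.hε _ ht _ (hP.norm_le hL hθ))
    (by linarith [hP.norm_euler_le hL hθ1]) (hP.norm_corrected_sub_euler_le hL hθ)
    (by rw [sub_self, abs_zero]; positivity)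
  refine (norm_sub_le_norm_sub_add_norm_sub _
    (idealFeedback g h φ ε (j * ε + ε * θ) (correctedState um g h α ε (j * ε + ε * θ) (Z θ)))
    _).trans ((add_le_add h1 h2).trans ?_)
  have : B * ε ^ 2 ≤ B ^ 5 * ε ^ 2 := by
    have e1 : B ≤ B ^ 5 := le_self_pow₀ hB (by norm_num)
    gcongr
  linarith

end PeriodSolution

/-- Deviation of a `C²` function from its chord along a segment. -/
theorem C2Estimates.chord {Z G : Type*} [NormedAddCommGroup Z] [NormedSpace ℝ Z]
    [NormedAddCommGroup G] [NormedSpace ℝ G] {φ : Z → G} {D : Set Z} {B : ℝ}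
    (h : C2Estimates φ D B) (hB : 0 ≤ B) {z w : Z} (hz : z ∈ D) (hw : z + w ∈ D) {θ : ℝ}
    (hθ : θ ∈ Icc (0 : ℝ) 1) (hθw : z + θ • w ∈ D) :
    ‖φ (z + θ • w) - (φ z + θ • (φ (z + w) - φ z))‖ ≤ 2 * B * ‖w‖ ^ 2 := by
  have h1 := h.taylor z hz _ hθw
  have h2 := h.taylor z hz _ hw
  rw [add_sub_cancel_left] at h1 h2
  have e : φ (z + θ • w) - (φ z + θ • (φ (z + w) - φ z)) =
      (φ (z + θ • w) - φ z - fderiv ℝ φ z (θ • w)) -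
        θ • (φ (z + w) - φ z - fderiv ℝ φ z w) := by
    rw [map_smul]; module
  rw [e]
  refine (norm_sub_le _ _).trans ?_
  have h3 : ‖θ • w‖ ≤ ‖w‖ := by
    rw [norm_smul, Real.norm_eq_abs, abs_of_nonneg hθ.1]
    exact mul_le_of_le_one_left (norm_nonneg _) hθ.2
  have h4 : ‖θ • (φ (z + w) - φ z - fderiv ℝ φ z w)‖ ≤ B * ‖w‖ ^ 2 := by
    rw [norm_smul, Real.norm_eq_abs, abs_of_nonneg hθ.1]
    exact (mul_le_of_le_one_left (norm_nonneg _) hθ.2).trans h2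
  have h5 : B * ‖θ • w‖ ^ 2 ≤ B * ‖w‖ ^ 2 := by gcongr
  linarith

end Period

/-! ### One PWM period: averaging and the `O(ε³)` local error. -/

section Period

variable {E Q G : Type*} [NormedAddCommGroup E] [NormedSpace ℝ E]
  [NormedAddCommGroup Q] [NormedSpace ℝ Q] [NormedAddCommGroup G] [NormedSpace ℝ G]
  {um : ℝ} {f g : E → E} {h : E → ℝ} {α : Q → ℝ × ℝ → ℝ → ℝ}
  {a : Q → ℝ × ℝ → ℝ → Q} {Hb : ℝ → E → Q → ℝ → ℝ → ℝ × ℝ} {R B ε₁ : ℝ}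
  {ρ ε c : ℝ} {j : ℕ} {Z : ℝ → E × Q}

namespace PeriodSolution

/-- Along the Euler curve, the ideal duty cycle is affine in time up to `O(ε²)`. -/
theorem abs_duty_euler_sub_chord_le (hP : PeriodSolution um f g h α a Hb R B ε₁ ρ ε j c Z)
    (hL : LoopEstimates um f g h α a Hb R B ε₁) {θ : ℝ} (hθ : θ ∈ Icc (0 : ℝ) 1) :
    |idealFeedback g h α ε (j * ε + ε * θ) (eulerCurve f g h α a ε (j * ε) (Z 0) θ) -
      (idealFeedback g h α ε (j * ε) (Z 0) + θ *
        (idealFeedback g h α ε (j * ε + ε * 1) (eulerCurve f g h α a ε (j * ε) (Z 0) 1) -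
          idealFeedback g h α ε (j * ε) (Z 0)))| ≤ 2 * B ^ 3 * ε ^ 2 := by
  have hB := hL.one_le
  have hε := hP.hε.1
  have hε1 := hP.eps_le_one hL
  -- State and time both move affinely with `θ` along the Euler curve, with `ε` fixed. The duty
  -- cycle is thus a `C²` function along a segment of length `O(ε)`, to which the chord estimate
  -- applies.
  let z : (E × Q) × ℝ × ℝ := (Z 0, j * ε, ε)
  let w : (E × Q) × ℝ × ℝ := (ε • idealField f g h α a ε (j * ε) (Z 0), ε, 0)
  have hzw : ∀ θ : ℝ, z + θ • w =
      (eulerCurve f g h α a ε (j * ε) (Z 0) θ, j * ε + ε * θ, ε) := fun θ => by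
    simp only [z, w, eulerCurve, Prod.smul_mk, Prod.mk_add_mk, smul_smul, smul_eq_mul, mul_zero,
      add_zero, mul_comm]
  have hmem : ∀ θ ∈ Icc (0 : ℝ) 1, z + θ • w ∈ loopDomain (E × Q) R := fun θ hθ => by
    rw [hzw]
    exact ⟨by linarith [hP.norm_euler_le hL hθ], hP.time_nonneg hθ.1, hε.le, hε1⟩
  have hzw1 := hmem 1 ⟨zero_le_one, le_rfl⟩
  have hz0 := hmem 0 ⟨le_rfl, zero_le_one⟩
  rw [one_smul] at hzw1
  rw [zero_smul, add_zero] at hz0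
  have hw : ‖w‖ ≤ B * ε := by
    refine norm_prod_le_iff.2 ⟨?_, norm_prod_le_iff.2 ⟨?_, ?_⟩⟩
    · rw [norm_smul, Real.norm_eq_abs, abs_of_pos hε, mul_comm]
      exact mul_le_mul_of_nonneg_right (hL.field.bound _ hz0) hε.le
    · simp only [w, Real.norm_eq_abs, abs_of_pos hε]
      nlinarith
    · simp only [w, norm_zero]; positivity
  have h1 := hL.duty.chord (by linarith) hz0 hzw1 hθ (hmem θ hθ)
  have e1 := hzw 1
  rw [one_smul] at e1
  rw [hzw θ, e1, Real.norm_eq_abs] at h1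
  refine h1.trans ?_
  calc _ ≤ 2 * B * (B * ε) ^ 2 := by gcongr
    _ = _ := by ring

theorem abs_duty_euler_sub_init_le (hP : PeriodSolution um f g h α a Hb R B ε₁ ρ ε j c Z)
    (hL : LoopEstimates um f g h α a Hb R B ε₁) {θ : ℝ} (hθ : θ ∈ Icc (0 : ℝ) 1) :
    |idealFeedback g h α ε (j * ε + ε * θ) (eulerCurve f g h α a ε (j * ε) (Z 0) θ) -
      idealFeedback g h α ε (j * ε) (Z 0)| ≤ B ^ 2 * ε := by
  have hB := hL.one_le
  have hε := hP.hε.1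
  have h1 := lip_time_of_estimates hL.duty (by linarith) ⟨hε.le, hP.eps_le_one hL⟩
    (hP.time_nonneg hθ.1) (t' := j * ε) (by positivity) (by linarith [hP.norm_euler_le hL hθ])
    (by linarith [hP.norm_init]) (hP.norm_euler_sub_init_le hL hθ) (by
      have e : j * ε + ε * θ - j * ε = ε * θ := by ring
      rw [e, abs_of_nonneg (mul_nonneg hε.le hθ.1)]
      have := mul_le_of_le_one_right hε.le hθ.2
      nlinarith)
  refine h1.trans (le_of_eq (by ring))

/-- Integrand comparison behind the local error bound, on the first component. -/
theorem norm_fst_integrand_sub_le [CompleteSpace E] [CompleteSpace Q]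
    (hP : PeriodSolution um f g h α a Hb R B ε₁ ρ ε j 1 Z)
    (hL : LoopEstimates um f g h α a Hb R B ε₁) {θ : ℝ} (hθ : θ ∈ Icc (0 : ℝ) 1)
    {u δ i₀ i₁ : ℝ} (hu : u = idealFeedback g h α ε (j * ε) (Z 0))
    (hδ : δ = idealFeedback g h α ε (j * ε + ε * 1) (eulerCurve f g h α a ε (j * ε) (Z 0) 1) - u)
    (hi₀ : |pwm um (measuredFeedback Hb α ε (j * ε + ε * θ) (Z θ)) θ - pwm um u θ| ≤ 2 * um * i₀)
    (hi₁ : |pwm um (measuredFeedback Hb α ε (j * ε + ε * θ) (Z θ)) θ - pwm um (u + θ * δ) θ| ≤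
      2 * um * i₁) :
    ‖(f (Z θ).1 + pwm um (measuredFeedback Hb α ε (j * ε + ε * θ) (Z θ)) θ • g (Z θ).1) -
      ((idealField f g h α a ε (j * ε + ε * θ) (eulerCurve f g h α a ε (j * ε) (Z 0) θ)).1 +
        ((pwm um (u + θ * δ) θ - (u + θ * δ)) • g (Z 0).1 +
          ((ε * s1 um u θ) • fderiv ℝ f (Z 0).1 (g (Z 0).1) +
          ((ε * (θ * (pwm um u θ - u))) •
            fderiv ℝ g (Z 0).1 (idealField f g h α a ε (j * ε) (Z 0)).1 +
          (ε * (s1 um u θ * pwm um u θ)) • fderiv ℝ g (Z 0).1 (g (Z 0).1)))))‖ ≤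
      110 * B ^ 6 * ε ^ 2 + 6 * B ^ 4 * ε * i₀ + 2 * um * B * i₁ := by
  have hB := hL.one_le
  have hε := hP.hε.1
  have hum := hL.um_pos
  have humB := hL.um_le
  have hε1 := hP.eps_le_one hL
  have hi₀n : 0 ≤ i₀ := by
    have := (abs_nonneg _).trans hi₀
    by_contra hn; push Not at hn; nlinarith
  have hu_le : |u| ≤ um := hu ▸ hP.abs_duty_init_le
  have hz := hP.norm_sub_init_le hL hθ
  have hz1 : ‖(Z θ).1 - (Z 0).1‖ ≤ 2 * B ^ 2 * ε := (norm_fst_le (Z θ - Z 0)).trans hz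
  have hy := hP.norm_euler_sub_init_le hL hθ
  have hfst := hP.norm_fst_sub_le hL hθ
  have hchord := hP.abs_duty_euler_sub_chord_le hL hθ
  have hdui := hP.abs_duty_euler_sub_init_le hL hθ
  have hυ := hP.abs_duty_euler_le hL hθ
  have hmZ := hP.mem_ball_fst hL hθ
  have hm0 := hP.mem_ball_init hL
  have hmY := hP.mem_ball_euler hL hθ
  have hF0 : ‖(idealField f g h α a ε (j * ε) (Z 0)).1‖ ≤ B :=
    (norm_fst_le _).trans (hL.field.bound (Z 0, j * ε, ε)
      ⟨by linarith [hP.norm_init], by positivity, hε.le, hε1⟩)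
  have hY1 : (eulerCurve f g h α a ε (j * ε) (Z 0) θ).1 - (Z 0).1 =
      (ε * θ) • (idealField f g h α a ε (j * ε) (Z 0)).1 := by
    simp [eulerCurve]
  have hideal : (idealField f g h α a ε (j * ε + ε * θ)
      (eulerCurve f g h α a ε (j * ε) (Z 0) θ)).1 =
      f (eulerCurve f g h α a ε (j * ε) (Z 0) θ).1 +
      idealFeedback g h α ε (j * ε + ε * θ) (eulerCurve f g h α a ε (j * ε) (Z 0) θ) •
        g (eulerCurve f g h α a ε (j * ε) (Z 0) θ).1 := rfl
  rw [hideal]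
  rw [← hu] at hfst hchord hdui
  rw [← hδ] at hchord
  have hy1 : ‖(eulerCurve f g h α a ε (j * ε) (Z 0) θ).1 - (Z 0).1‖ ≤ B * ε :=
    (norm_fst_le (eulerCurve f g h α a ε (j * ε) (Z 0) θ - Z 0)).trans hy
  generalize idealFeedback g h α ε (j * ε + ε * θ) (eulerCurve f g h α a ε (j * ε) (Z 0) θ) = υ
    at *
  generalize (eulerCurve f g h α a ε (j * ε) (Z 0) θ).1 = y at *
  generalize (idealField f g h α a ε (j * ε) (Z 0)).1 = F₀ at *
  generalize (Z θ).1 = x at *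
  generalize (Z 0).1 = p at *
  have hM1 : |pwm um (measuredFeedback Hb α ε (j * ε + ε * θ) (Z θ)) θ| ≤ B := by
    rw [abs_pwm hum]; exact humB
  have hM0 : |pwm um u θ| ≤ B := by
    rw [abs_pwm hum]; exact humB
  generalize pwm um (measuredFeedback Hb α ε (j * ε + ε * θ) (Z θ)) θ = M at *
  generalize pwm um (u + θ * δ) θ = M₁ at *
  generalize pwm um u θ = M₀ at *
  have hS : |s1 um u θ| ≤ 2 * B := (abs_s1_le_of_abs_le hum hu_le θ).trans (by linarith)
  generalize s1 um u θ = S at *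
  have hg0 := hL.input.bound _ hm0
  have hDf := hL.drift.fderiv_bound _ hm0
  have hDg := hL.input.fderiv_bound _ hm0
  -- Taylor remainders
  have rem : ∀ {φ : E → E}, C2Estimates φ (Metric.closedBall 0 R) B →
      ‖φ x - φ p - fderiv ℝ φ p (y - p) - (ε * S) • fderiv ℝ φ p (g p)‖ ≤ 48 * B ^ 5 * ε ^ 2 ∧
      ‖φ y - φ p - fderiv ℝ φ p (y - p)‖ ≤ B ^ 3 * ε ^ 2 := fun {φ} hφ => by
    have t1 := hφ.taylor _ hm0 _ hmZ
    have t2 := hφ.taylor _ hm0 _ hmY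
    have t3 := hφ.fderiv_bound _ hm0
    constructor
    · have e : φ x - φ p - fderiv ℝ φ p (y - p) - (ε * S) • fderiv ℝ φ p (g p) =
          (φ x - φ p - fderiv ℝ φ p (x - p)) + fderiv ℝ φ p (x - y - (ε * S) • g p) := by
        simp only [map_sub, map_smul]; abel
      rw [e]
      calc _ ≤ B * ‖x - p‖ ^ 2 + B * (44 * B ^ 4 * ε ^ 2) := by
            refine (norm_add_le _ _).trans (add_le_add t1 ?_)
            refine (ContinuousLinearMap.le_opNorm _ _).trans ?_
            gcongr
        _ ≤ B * (2 * B ^ 2 * ε) ^ 2 + B * (44 * B ^ 4 * ε ^ 2) := by gcongr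
        _ = _ := by ring
    · calc _ ≤ B * ‖y - p‖ ^ 2 := t2
        _ ≤ B * (B * ε) ^ 2 := by gcongr
        _ = _ := by ring
  obtain ⟨rfx, rfy⟩ := rem hL.drift
  obtain ⟨rgx, rgy⟩ := rem hL.input
  rw [hY1] at rfx rfy rgx rgy
  have hG1 : ‖fderiv ℝ g p F₀‖ ≤ B * B :=
    (ContinuousLinearMap.le_opNorm _ _).trans (by gcongr)
  have hG2 : ‖fderiv ℝ g p (g p)‖ ≤ B * B :=
    (ContinuousLinearMap.le_opNorm _ _).trans (by gcongr)
  -- The discrepancy is grouped into terms that are small for distinct reasons: Taylor remainders of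
  -- `f` and `g` once the ripple is taken out; the replacements of `M` by `M₁` and of `υ` by its
  -- chord; and terms of order `ε` multiplied by `M - M₀` or `υ - u`.
  have e : (f x + M • g x) - ((f y + υ • g y) + ((M₁ - (u + θ * δ)) • g p +
      ((ε * S) • fderiv ℝ f p (g p) + ((ε * (θ * (M₀ - u))) • fderiv ℝ g p F₀ +
      (ε * (S * M₀)) • fderiv ℝ g p (g p))))) =
      (f x - f p - fderiv ℝ f p ((ε * θ) • F₀) - (ε * S) • fderiv ℝ f p (g p)) -
      (f y - f p - fderiv ℝ f p ((ε * θ) • F₀)) +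
      (M • (g x - g p - fderiv ℝ g p ((ε * θ) • F₀) - (ε * S) • fderiv ℝ g p (g p)) -
      υ • (g y - g p - fderiv ℝ g p ((ε * θ) • F₀))) +
      ((M - M₁) • g p - (υ - (u + θ * δ)) • g p) +
      ((ε * θ * (M - M₀)) • fderiv ℝ g p F₀ - (ε * θ * (υ - u)) • fderiv ℝ g p F₀ +
      (ε * S * (M - M₀)) • fderiv ℝ g p (g p)) := by
    simp only [map_smul]; module
  rw [e]
  have hθε : |ε * θ| ≤ ε := by
    rw [abs_of_nonneg (mul_nonneg hε.le hθ.1)]; exact mul_le_of_le_one_right hε.le hθ.2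
  have b1 : ‖M • (g x - g p - fderiv ℝ g p ((ε * θ) • F₀) - (ε * S) • fderiv ℝ g p (g p))‖ ≤
      B * (48 * B ^ 5 * ε ^ 2) := by
    rw [norm_smul, Real.norm_eq_abs]; gcongr
  have b2 : ‖υ • (g y - g p - fderiv ℝ g p ((ε * θ) • F₀))‖ ≤ B * (B ^ 3 * ε ^ 2) := by
    rw [norm_smul, Real.norm_eq_abs]; gcongr; exact hυ.trans humB
  have b3 : ‖(M - M₁) • g p‖ ≤ 2 * um * i₁ * B := by
    rw [norm_smul, Real.norm_eq_abs]
    exact mul_le_mul hi₁ hg0 (norm_nonneg _) ((abs_nonneg _).trans hi₁)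
  have b4 : ‖(υ - (u + θ * δ)) • g p‖ ≤ 2 * B ^ 3 * ε ^ 2 * B := by
    rw [norm_smul, Real.norm_eq_abs]; gcongr
  have hi₀' : |M - M₀| ≤ 2 * B * i₀ := hi₀.trans (by gcongr)
  have b5 : ‖(ε * θ * (M - M₀)) • fderiv ℝ g p F₀‖ ≤ ε * (2 * B * i₀) * (B * B) := by
    rw [norm_smul, Real.norm_eq_abs, abs_mul]; gcongr
  have b6 : ‖(ε * θ * (υ - u)) • fderiv ℝ g p F₀‖ ≤ ε * (B ^ 2 * ε) * (B * B) := by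
    rw [norm_smul, Real.norm_eq_abs, abs_mul]; gcongr
  have b7 : ‖(ε * S * (M - M₀)) • fderiv ℝ g p (g p)‖ ≤
      ε * (2 * B) * (2 * B * i₀) * (B * B) := by
    rw [norm_smul, Real.norm_eq_abs, abs_mul, abs_mul, abs_of_pos hε]; gcongr
  have n1 := norm_add_le_of_le (norm_add_le_of_le (norm_add_le_of_le (norm_sub_le_of_le rfx rfy)
    (norm_sub_le_of_le b1 b2)) (norm_sub_le_of_le b3 b4))
    (norm_add_le_of_le (norm_sub_le_of_le b5 b6) b7)
  refine n1.trans ?_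
  have p5 : B ^ 5 * ε ^ 2 ≤ B ^ 6 * ε ^ 2 := by gcongr; norm_num
  have p4 : B ^ 4 * ε ^ 2 ≤ B ^ 6 * ε ^ 2 := by gcongr; norm_num
  have p3 : B ^ 3 * ε ^ 2 ≤ B ^ 6 * ε ^ 2 := by gcongr; norm_num
  have q3 : B ^ 3 * (ε * i₀) ≤ B ^ 4 * (ε * i₀) := by gcongr; norm_num
  have q0 : 0 ≤ B ^ 6 * ε ^ 2 := by positivity
  linarith

/-- This is the averaging step: the first-order oscillations integrate to zero, and the affine duty
cycle has the right mean up to `O(ε²)`. Two disagreement sets are needed. Comparison with the frozen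
duty cycle gives a set of measure `O(ε)`, affordable only in terms that already carry a factor `ε`.
Comparison with the affine duty cycle gives measure `O(ε²)`, good enough for the leading term. -/
theorem norm_fst_end_sub_le [CompleteSpace E] [CompleteSpace Q]
    (hP : PeriodSolution um f g h α a Hb R B ε₁ ρ ε j 1 Z)
    (hL : LoopEstimates um f g h α a Hb R B ε₁) (hε2 : B ^ 2 * ε ≤ 2 * um)
    (hint : IntervalIntegrable (fun θ => (idealField f g h α a ε (j * ε + ε * θ)
      (eulerCurve f g h α a ε (j * ε) (Z 0) θ)).1) volume 0 1) :
    ‖(Z 1).1 - ((Z 0).1 + ε • ∫ θ in (0 : ℝ)..1, (idealField f g h α a ε (j * ε + ε * θ)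
      (eulerCurve f g h α a ε (j * ε) (Z 0) θ)).1)‖ ≤ 1000 * B ^ 8 * ε ^ 3 := by
  have hB := hL.one_le
  have hε := hP.hε.1
  have hum := hL.um_pos
  have hε1 := hP.eps_le_one hL
  have h01 : (1 : ℝ) ∈ Icc (0 : ℝ) 1 := ⟨zero_le_one, le_rfl⟩
  obtain ⟨u, hu⟩ : ∃ u, u = idealFeedback g h α ε (j * ε) (Z 0) := ⟨_, rfl⟩
  obtain ⟨δ, hδ⟩ : ∃ δ, δ = idealFeedback g h α ε (j * ε + ε * 1)
    (eulerCurve f g h α a ε (j * ε) (Z 0) 1) - u := ⟨_, rfl⟩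
  have hu_le : |u| ≤ um := hu ▸ hP.abs_duty_init_le
  have huδ : |u + δ| ≤ um := by
    rw [hδ, add_sub_cancel]; exact hP.abs_duty_euler_le hL h01
  have hδ_le : |δ| ≤ B ^ 2 * ε := by
    rw [hδ, hu]; exact hP.abs_duty_euler_sub_init_le hL h01
  obtain ⟨S, hS, hSv, hSf, hSd⟩ := hP.exists_disagreement_init hL
  -- The radius `53` adds the error `51` of the measured duty cycle with respect to the Euler curve
  -- and the deviation `2` from the chord. The slope condition is `|δ| ≤ B² ε ≤ 2 um`.
  obtain ⟨S', hS', hSv', hSf', hSd'⟩ := exists_pwm_disagreement hum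
    (υ := fun θ => u + θ * δ) (c := 1) le_rfl
    (fun θ _ θ' _ => by
      rw [show u + θ * δ - (u + θ' * δ) = δ * (θ - θ') by ring, abs_mul]
      gcongr
      exact hδ_le.trans hε2)
    (D := 53 * B ^ 5 * ε ^ 2) (by positivity)
  have hM : IntervalIntegrable (fun θ => pwm um (u + θ * δ) θ) volume 0 1 :=
    intervalIntegrable_pwm_comp hum (by fun_prop) 0 1
  have hM0 : IntervalIntegrable (fun θ => pwm um u θ) volume 0 1 :=
    intervalIntegrable_pwm_comp hum measurable_const 0 1
  have hlin : IntervalIntegrable (fun θ => u + θ * δ) volume 0 1 :=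
    Continuous.intervalIntegrable (by fun_prop) _ _
  have hs : ContinuousOn (fun θ => s1 um u θ) (uIcc (0 : ℝ) 1) := by
    rw [uIcc_of_le zero_le_one]
    have : LipschitzOnWith (Real.toNNReal (2 * um)) (s1 um u) (Icc 0 1) := by
      refine LipschitzOnWith.of_dist_le_mul fun x hx y hy => ?_
      rw [Real.coe_toNNReal _ (by positivity)]
      exact abs_s1_sub_le_time hum hu_le hx hy
    exact this.continuousOn
  obtain ⟨w₁, hw₁⟩ : ∃ w, w = fderiv ℝ f (Z 0).1 (g (Z 0).1) := ⟨_, rfl⟩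
  obtain ⟨w₂, hw₂⟩ : ∃ w, w = fderiv ℝ g (Z 0).1 (idealField f g h α a ε (j * ε) (Z 0)).1 :=
    ⟨_, rfl⟩
  obtain ⟨w₃, hw₃⟩ : ∃ w, w = fderiv ℝ g (Z 0).1 (g (Z 0).1) := ⟨_, rfl⟩
  have i1 : IntervalIntegrable (fun θ => (pwm um (u + θ * δ) θ - (u + θ * δ)) • g (Z 0).1)
    volume 0 1 := intervalIntegrable_smul_const (hM.sub hlin) _
  have i2 : IntervalIntegrable (fun θ => (ε * s1 um u θ) • w₁) volume 0 1 :=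
    intervalIntegrable_smul_const (hs.intervalIntegrable.const_mul ε) _
  have i3 : IntervalIntegrable (fun θ => (ε * (θ * (pwm um u θ - u))) • w₂) volume 0 1 :=
    intervalIntegrable_smul_const
      (((hM0.sub intervalIntegrable_const).continuousOn_mul continuousOn_id).const_mul ε) _
  have i4 : IntervalIntegrable (fun θ => (ε * (s1 um u θ * pwm um u θ)) • w₃) volume 0 1 :=
    intervalIntegrable_smul_const ((hM0.continuousOn_mul hs).const_mul ε) _
  obtain ⟨hi, he⟩ := hP.sol.fst_eq h01
  have hφ : IntervalIntegrable (fun θ => f (Z θ).1 +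
      pwm um (measuredFeedback Hb α ε (j * ε + ε * θ) (Z θ)) θ • g (Z θ).1) volume 0 1 := by
    have := hi.smul ε⁻¹
    refine this.congr fun θ _ => ?_
    simp only [Pi.smul_apply, hP.fst_pwmField, inv_smul_smul₀ hε.ne']
  have key := norm_integral_sub_le_of_indicator h01 hφ (hint.add (i1.add (i2.add (i3.add i4))))
    hS hSf hS' hSf' (b₁ := 110 * B ^ 6 * ε ^ 2) (b₂ := 6 * B ^ 4 * ε) (b₃ := 2 * um * B)
    (by positivity) (by positivity) (by positivity) (fun θ hθ => by
      have h3 := hP.norm_measured_sub_euler_le hL hL.duty hL.measured_duty hθ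
      have h4 := hP.abs_duty_euler_sub_chord_le hL hθ
      rw [← hu, ← hδ] at h4
      have h5 : |measuredFeedback Hb α ε (j * ε + ε * θ) (Z θ) - (u + θ * δ)| ≤
          53 * B ^ 5 * ε ^ 2 := by
        refine (abs_sub_le _ _ _).trans ((add_le_add h3 h4).trans ?_)
        have : B ^ 3 * ε ^ 2 ≤ B ^ 5 * ε ^ 2 := by gcongr; norm_num
        linarith
      have h6 := hSd θ hθ
      rw [← hu] at h6
      have := hP.norm_fst_integrand_sub_le hL hθ hu hδ h6
        (abs_pwm_sub_le_indicator hum (S := S') fun hn => hSd' θ hθ _ h5 hn)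
      rw [← hw₁, ← hw₂, ← hw₃] at this
      exact this)
  have esum : ∫ θ in (0 : ℝ)..1, ((idealField f g h α a ε (j * ε + ε * θ)
      (eulerCurve f g h α a ε (j * ε) (Z 0) θ)).1 +
        ((pwm um (u + θ * δ) θ - (u + θ * δ)) • g (Z 0).1 + ((ε * s1 um u θ) • w₁ +
          ((ε * (θ * (pwm um u θ - u))) • w₂ + (ε * (s1 um u θ * pwm um u θ)) • w₃)))) =
      (∫ θ in (0 : ℝ)..1, (idealField f g h α a ε (j * ε + ε * θ)
        (eulerCurve f g h α a ε (j * ε) (Z 0) θ)).1) +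
        ((∫ θ in (0 : ℝ)..1, pwm um (u + θ * δ) θ) - (u + δ / 2)) • g (Z 0).1 := by
    rw [intervalIntegral.integral_add hint (i1.add (i2.add (i3.add i4))),
      intervalIntegral.integral_add i1 (i2.add (i3.add i4)),
      intervalIntegral.integral_add i2 (i3.add i4), intervalIntegral.integral_add i3 i4]
    simp only [intervalIntegral.integral_smul_const, intervalIntegral.integral_const_mul]
    rw [integral_s1, integral_id_mul_pwm_sub hum hu_le, integral_s1_mul_pwm hum hu_le,
      intervalIntegral.integral_sub hM hlin]
    have : ∫ θ in (0 : ℝ)..1, (u + θ * δ) = u + δ / 2 := by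
      rw [intervalIntegral.integral_add intervalIntegrable_const
        (Continuous.intervalIntegrable (by fun_prop) _ _), intervalIntegral.integral_mul_const,
        integral_id]
      simp; ring
    rw [this]
    simp
  rw [esum] at key
  have hmean := abs_integral_pwm_affine_sub_le hum hu_le huδ
  have hg0 := hL.input.bound _ (hP.mem_ball_init hL)
  have hmean' : ‖((∫ θ in (0 : ℝ)..1, pwm um (u + θ * δ) θ) - (u + δ / 2)) • g (Z 0).1‖ ≤
      B ^ 6 * ε ^ 2 := by
    rw [norm_smul, Real.norm_eq_abs]
    have h1 : δ ^ 2 ≤ (B ^ 2 * ε) ^ 2 := sq_le_sq' (by linarith [(abs_le.1 hδ_le).1])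
      (abs_le.1 hδ_le).2
    have h2 : δ ^ 2 / (8 * um) ≤ B ^ 5 * ε ^ 2 := by
      calc δ ^ 2 / (8 * um) = δ ^ 2 * um⁻¹ / 8 := by field_simp
        _ ≤ (B ^ 2 * ε) ^ 2 * B / 8 := by
          gcongr
          exact hL.inv_um_le
        _ ≤ B ^ 5 * ε ^ 2 := by
          have : 0 ≤ B ^ 5 * ε ^ 2 := by positivity
          linarith
    calc _ ≤ B ^ 5 * ε ^ 2 * B := by
          gcongr
          exact hmean.trans h2
      _ = _ := by ring
  have hSb : 6 * B ^ 4 * ε * volume.real S ≤ 120 * B ^ 8 * ε ^ 2 := by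
    calc _ ≤ 6 * B ^ 4 * ε * (4 * (5 * B ^ 3 * ε * um⁻¹)) := by
          gcongr
          simpa [div_eq_mul_inv] using hSv
      _ ≤ 6 * B ^ 4 * ε * (4 * (5 * B ^ 3 * ε * B)) := by
          gcongr
          exact hL.inv_um_le
      _ = _ := by ring
  have hSb' : 2 * um * B * volume.real S' ≤ 424 * B ^ 6 * ε ^ 2 := by
    calc _ ≤ 2 * um * B * (4 * (53 * B ^ 5 * ε ^ 2 / um)) := by gcongr
      _ = _ := by field_simp; ring
  have hZ1 : (Z 1).1 = (Z 0).1 + ε • ∫ θ in (0 : ℝ)..1, (f (Z θ).1 +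
      pwm um (measuredFeedback Hb α ε (j * ε + ε * θ) (Z θ)) θ • g (Z θ).1) := by
    rw [he, ← intervalIntegral.integral_smul]
    simp only [hP.fst_pwmField]
  rw [hZ1, add_sub_add_left_eq_sub, ← smul_sub, norm_smul, Real.norm_eq_abs, abs_of_pos hε]
  have p6 : B ^ 6 * ε ^ 2 ≤ B ^ 8 * ε ^ 2 := by gcongr; norm_num
  have hfin : ‖(∫ θ in (0 : ℝ)..1, (f (Z θ).1 +
      pwm um (measuredFeedback Hb α ε (j * ε + ε * θ) (Z θ)) θ • g (Z θ).1)) -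
      ∫ θ in (0 : ℝ)..1, (idealField f g h α a ε (j * ε + ε * θ)
        (eulerCurve f g h α a ε (j * ε) (Z 0) θ)).1‖ ≤ 1000 * B ^ 8 * ε ^ 2 := by
    have n := norm_add_le_of_le key hmean'
    rw [← sub_sub, sub_add_cancel] at n
    have q0 : 0 ≤ B ^ 8 * ε ^ 2 := by positivity
    linarith
  calc _ ≤ ε * (1000 * B ^ 8 * ε ^ 2) := by gcongr
    _ = _ := by ring

end PeriodSolution

end Period

/-! ### One PWM period: comparison with ideal solutions; uniform constants. -/

section Period

variable {E Q G : Type*} [NormedAddCommGroup E] [NormedSpace ℝ E]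
  [NormedAddCommGroup Q] [NormedSpace ℝ Q] [NormedAddCommGroup G] [NormedSpace ℝ G]
  {um : ℝ} {f g : E → E} {h : E → ℝ} {α : Q → ℝ × ℝ → ℝ → ℝ}
  {a : Q → ℝ × ℝ → ℝ → Q} {Hb : ℝ → E → Q → ℝ → ℝ → ℝ × ℝ} {R B ε₁ : ℝ}
  {ρ ε c : ℝ} {j : ℕ} {Z W : ℝ → E × Q}

theorem LoopEstimates.continuousOn_field (hL : LoopEstimates um f g h α a Hb R B ε₁)
    {X : ℝ → E × Q} {τ : ℝ → ℝ} {S : Set ℝ} (hX : ContinuousOn X S) (hτ : ContinuousOn τ S) :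
    ContinuousOn (fun t => idealField f g h α a ε (τ t) (X t)) S :=
  hL.field_continuous.comp_continuousOn (hX.prodMk (hτ.prodMk continuousOn_const))

namespace PeriodSolution

/-- The second component needs no averaging: its integrand is already correct to `O(ε²)` pointwise,
and normalized time contributes another factor `ε`. -/
theorem norm_end_sub_le [CompleteSpace E] [CompleteSpace Q]
    (hP : PeriodSolution um f g h α a Hb R B ε₁ ρ ε j 1 Z)
    (hL : LoopEstimates um f g h α a Hb R B ε₁) (hε2 : B ^ 2 * ε ≤ 2 * um) :
    ‖Z 1 - (Z 0 + ε • ∫ θ in (0 : ℝ)..1, idealField f g h α a ε (j * ε + ε * θ)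
      (eulerCurve f g h α a ε (j * ε) (Z 0) θ))‖ ≤ 1000 * B ^ 8 * ε ^ 3 := by
  have hB := hL.one_le
  have hε := hP.hε.1
  have h01 : (1 : ℝ) ∈ Icc (0 : ℝ) 1 := ⟨zero_le_one, le_rfl⟩
  have hc : ContinuousOn (fun θ => idealField f g h α a ε (j * ε + ε * θ)
      (eulerCurve f g h α a ε (j * ε) (Z 0) θ)) (uIcc (0 : ℝ) 1) :=
    hL.continuousOn_field (by unfold eulerCurve; fun_prop) (by fun_prop)
  have hi := hc.intervalIntegrable (μ := volume)
  have h1 := hP.norm_fst_end_sub_le hL hε2 (ContinuousOn.intervalIntegrable (μ := volume) hc.fst)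
  have e1 := (ContinuousLinearMap.fst ℝ E Q).intervalIntegral_comp_comm hi
  have e2 := (ContinuousLinearMap.snd ℝ E Q).intervalIntegral_comp_comm hi
  simp only [ContinuousLinearMap.coe_fst', ContinuousLinearMap.coe_snd'] at e1 e2
  refine norm_prod_le_iff.2 ⟨?_, ?_⟩
  · rw [e1] at h1
    exact h1
  · rw [Prod.snd_sub, Prod.snd_add, Prod.smul_snd, ← e2]
    obtain ⟨hi', he⟩ := hP.sol.snd_eq h01
    have i2 : IntervalIntegrable (fun θ => ε • (idealField f g h α a ε (j * ε + ε * θ)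
      (eulerCurve f g h α a ε (j * ε) (Z 0) θ)).2) volume 0 1 :=
      (ContinuousOn.intervalIntegrable (μ := volume) hc.snd).smul ε
    rw [he, add_sub_add_left_eq_sub, ← intervalIntegral.integral_smul,
      ← intervalIntegral.integral_sub hi' i2]
    have := intervalIntegral.norm_integral_le_of_norm_le_const (a := (0 : ℝ)) (b := 1)
      (f := fun θ => (ε • pwmField um f g α a Hb ε (j * ε + ε * θ) (Z θ)).2 -
        ε • (idealField f g h α a ε (j * ε + ε * θ)
          (eulerCurve f g h α a ε (j * ε) (Z 0) θ)).2) (C := ε * (51 * B ^ 5 * ε ^ 2))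
      (fun θ hθ => by
        rw [uIoc_of_le zero_le_one] at hθ
        have h3 := hP.norm_measured_sub_euler_le hL hL.ctrl hL.measured_ctrl
          (Ioc_subset_Icc_self hθ)
        rw [Prod.smul_snd, ← smul_sub, norm_smul, Real.norm_eq_abs, abs_of_pos hε]
        exact mul_le_mul_of_nonneg_left h3 hε.le)
    refine this.trans ?_
    have p : B ^ 5 * ε ^ 3 ≤ B ^ 8 * ε ^ 3 := by gcongr; norm_num
    have p0 : 0 ≤ B ^ 8 * ε ^ 3 := by positivity
    simp only [sub_zero, abs_one, mul_one]
    linarith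

theorem ideal_norm_sub_init_le (hP : PeriodSolution um f g h α a Hb R B ε₁ ρ ε j c Z)
    (hL : LoopEstimates um f g h α a Hb R B ε₁)
    (hW : IsSolution (fun θ X => ε • idealField f g h α a ε (j * ε + ε * θ) X) 0 c W)
    (hWR : ∀ θ ∈ Icc 0 c, ‖W θ‖ ≤ R) {θ : ℝ} (hθ : θ ∈ Icc 0 c) : ‖W θ - W 0‖ ≤ B * ε := by
  have hB := hL.one_le
  have hε := hP.hε.1
  rw [hW.2 θ hθ, add_sub_cancel_left]
  refine (intervalIntegral.norm_integral_le_of_norm_le_const (C := B * ε) fun σ hσ => ?_).trans ?_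
  · rw [uIoc_of_le hθ.1] at hσ
    rw [norm_smul, Real.norm_eq_abs, abs_of_pos hε, mul_comm]
    exact mul_le_mul_of_nonneg_right (hL.field.bound (W σ, j * ε + ε * σ, ε)
      ⟨hWR σ ⟨hσ.1.le, hσ.2.trans hθ.2⟩, hP.time_nonneg hσ.1.le, hε.le, hP.eps_le_one hL⟩) hε.le
  · rw [sub_zero, abs_of_nonneg hθ.1]
    exact mul_le_of_le_one_right (by positivity) (hθ.2.trans hP.hc.2)

/-- An `O(ε²)` accuracy of the Euler curve is enough, since it enters the one-step estimate only
inside an integral multiplied by `ε`. -/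
theorem norm_euler_sub_ideal_le [CompleteSpace E] [CompleteSpace Q]
    (hP : PeriodSolution um f g h α a Hb R B ε₁ ρ ε j c Z)
    (hL : LoopEstimates um f g h α a Hb R B ε₁)
    (hW : IsSolution (fun θ X => ε • idealField f g h α a ε (j * ε + ε * θ) X) 0 c W)
    (hWR : ∀ θ ∈ Icc 0 c, ‖W θ‖ ≤ R) {θ : ℝ} (hθ : θ ∈ Icc 0 c) :
    ‖eulerCurve f g h α a ε (j * ε) (Z 0) θ - W θ‖ ≤
      (1 + B * ε) * ‖Z 0 - W 0‖ + B ^ 2 * ε ^ 2 := by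
  have hB := hL.one_le
  have hε := hP.hε.1
  have hi := (hW.mono le_rfl hθ.1 hθ.2).1
  have e : eulerCurve f g h α a ε (j * ε) (Z 0) θ - W θ = (Z 0 - W 0) +
      ∫ σ in (0 : ℝ)..θ, (ε • idealField f g h α a ε (j * ε) (Z 0) -
        ε • idealField f g h α a ε (j * ε + ε * σ) (W σ)) := by
    rw [intervalIntegral.integral_sub intervalIntegrable_const hi, hW.2 θ hθ,
      intervalIntegral.integral_const, eulerCurve, sub_zero]
    module
  rw [e]
  have hn : 0 ≤ ‖Z 0 - W 0‖ := norm_nonneg _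
  have h1 := intervalIntegral.norm_integral_le_of_norm_le_const (a := (0 : ℝ)) (b := θ)
    (f := fun σ => ε • idealField f g h α a ε (j * ε) (Z 0) -
        ε • idealField f g h α a ε (j * ε + ε * σ) (W σ))
    (C := ε * (B * (‖Z 0 - W 0‖ + B * ε))) (fun σ hσ => by
      rw [uIoc_of_le hθ.1] at hσ
      have hσ' : σ ∈ Icc 0 c := ⟨hσ.1.le, hσ.2.trans hθ.2⟩
      rw [← smul_sub, norm_smul, Real.norm_eq_abs, abs_of_pos hε]
      refine mul_le_mul_of_nonneg_left ?_ hε.le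
      refine hL.lip_field ⟨hε.le, hP.eps_le_one hL⟩ (by positivity) (hP.time_nonneg hσ.1.le)
        (by linarith [hP.norm_init]) (hWR σ hσ') ?_ ?_
      · have := hP.ideal_norm_sub_init_le hL hW hWR hσ'
        rw [norm_sub_rev] at this
        exact (norm_sub_le_norm_sub_add_norm_sub _ (W 0) _).trans (by linarith)
      · rw [abs_sub_comm]
        refine (hP.abs_time_sub_le hσ').trans ?_
        nlinarith)
  have h2 : ε * (B * (‖Z 0 - W 0‖ + B * ε)) * |θ - 0| ≤ ε * (B * (‖Z 0 - W 0‖ + B * ε)) := by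
    rw [sub_zero, abs_of_nonneg hθ.1]
    exact mul_le_of_le_one_right (by positivity) (hθ.2.trans hP.hc.2)
  refine (norm_add_le _ _).trans ?_
  linarith

/-- Propagation of the error with respect to an ideal solution over a period. -/
theorem norm_end_sub_ideal_le [CompleteSpace E] [CompleteSpace Q]
    (hP : PeriodSolution um f g h α a Hb R B ε₁ ρ ε j 1 Z)
    (hL : LoopEstimates um f g h α a Hb R B ε₁) (hε2 : B ^ 2 * ε ≤ 2 * um)
    (hW : IsSolution (fun θ X => ε • idealField f g h α a ε (j * ε + ε * θ) X) 0 1 W)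
    (hWR : ∀ θ ∈ Icc (0 : ℝ) 1, ‖W θ‖ ≤ R) :
    ‖Z 1 - W 1‖ ≤ (1 + 2 * B ^ 2 * ε) * ‖Z 0 - W 0‖ + 1001 * B ^ 8 * ε ^ 3 := by
  have hB := hL.one_le
  have hε := hP.hε.1
  have hε1 := hP.eps_le_one hL
  have h01 : (1 : ℝ) ∈ Icc (0 : ℝ) 1 := ⟨zero_le_one, le_rfl⟩
  have hc : ContinuousOn (fun θ => idealField f g h α a ε (j * ε + ε * θ)
      (eulerCurve f g h α a ε (j * ε) (Z 0) θ)) (uIcc (0 : ℝ) 1) :=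
    hL.continuousOn_field (by unfold eulerCurve; fun_prop) (by fun_prop)
  have h1 := hP.norm_end_sub_le hL hε2
  have hn : 0 ≤ ‖Z 0 - W 0‖ := norm_nonneg _
  -- The three terms are the local defect, the initial error, and the difference of the ideal fields
  -- along the Euler curve and along `W`; the last one accounts for the growth factor.
  have e : Z 1 - W 1 = (Z 1 - (Z 0 + ε • ∫ θ in (0 : ℝ)..1, idealField f g h α a ε (j * ε + ε * θ)
      (eulerCurve f g h α a ε (j * ε) (Z 0) θ))) + (Z 0 - W 0) +
      ∫ θ in (0 : ℝ)..1, (ε • idealField f g h α a ε (j * ε + ε * θ)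
      (eulerCurve f g h α a ε (j * ε) (Z 0) θ) -
        ε • idealField f g h α a ε (j * ε + ε * θ) (W θ)) := by
    have i1 : IntervalIntegrable (fun θ => ε • idealField f g h α a ε (j * ε + ε * θ)
      (eulerCurve f g h α a ε (j * ε) (Z 0) θ)) volume 0 1 := hc.intervalIntegrable.smul ε
    have i2 : IntervalIntegrable (fun θ => ε • idealField f g h α a ε (j * ε + ε * θ) (W θ))
      volume 0 1 := hW.1
    rw [intervalIntegral.integral_sub i1 i2, hW.2 1 h01]
    simp only [intervalIntegral.integral_smul]
    abel
  have h2 := intervalIntegral.norm_integral_le_of_norm_le_const (a := (0 : ℝ)) (b := 1)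
    (f := fun θ => ε • idealField f g h α a ε (j * ε + ε * θ)
      (eulerCurve f g h α a ε (j * ε) (Z 0) θ) -
        ε • idealField f g h α a ε (j * ε + ε * θ) (W θ))
    (C := ε * (B * ((1 + B * ε) * ‖Z 0 - W 0‖ + B ^ 2 * ε ^ 2))) (fun σ hσ => by
      rw [uIoc_of_le zero_le_one] at hσ
      have hσ' : σ ∈ Icc (0 : ℝ) 1 := Ioc_subset_Icc_self hσ
      rw [← smul_sub, norm_smul, Real.norm_eq_abs, abs_of_pos hε]
      refine mul_le_mul_of_nonneg_left ?_ hε.le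
      refine hL.lip_field ⟨hε.le, hε1⟩ (hP.time_nonneg hσ'.1) (hP.time_nonneg hσ'.1)
        (by linarith [hP.norm_euler_le hL hσ']) (hWR σ hσ')
        (hP.norm_euler_sub_ideal_le hL hW hWR hσ') ?_
      rw [sub_self, abs_zero]; positivity)
  rw [sub_zero, abs_one, mul_one] at h2
  rw [e]
  refine (norm_add₃_le).trans ?_
  have p1 : ε * (B * (B * ε * ‖Z 0 - W 0‖)) ≤ ε * (B * (B * 1 * ‖Z 0 - W 0‖)) := by gcongr
  have p2 : B * (ε * ‖Z 0 - W 0‖) ≤ B ^ 2 * (ε * ‖Z 0 - W 0‖) := by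
    gcongr; exact le_self_pow₀ hB (by norm_num)
  have p3 : B ^ 3 * ε ^ 3 ≤ B ^ 8 * ε ^ 3 := by gcongr; norm_num
  linarith

/-- Estimates at an arbitrary time of the period, with respect to a nearby ideal solution. -/
theorem estimates_ideal [CompleteSpace E] [CompleteSpace Q]
    (hP : PeriodSolution um f g h α a Hb R B ε₁ ρ ε j c Z)
    (hL : LoopEstimates um f g h α a Hb R B ε₁)
    (hW : IsSolution (fun θ X => ε • idealField f g h α a ε (j * ε + ε * θ) X) 0 c W)
    (hWR : ∀ θ ∈ Icc 0 c, ‖W θ‖ ≤ R) {d : ℝ} (hd : ‖Z 0 - W 0‖ ≤ d) (hd1 : d ≤ 1)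
    {θ : ℝ} (hθ : θ ∈ Icc 0 c) :
    ‖(Z θ).1 - ((W θ).1 + (ε * s1 um (idealFeedback g h α ε (j * ε + ε * θ) (W θ)) θ) •
      g (W θ).1)‖ ≤ 66 * B ^ 5 * ε ^ 2 + 7 * B ^ 3 * d ∧
    ‖(Z θ).2 - (W θ).2‖ ≤ 66 * B ^ 5 * ε ^ 2 + 7 * B ^ 3 * d ∧
    |h (Z θ).1 - (h (W θ).1 + virtualOutput g h ε (W θ).1 *
      s1 um (idealFeedback g h α ε (j * ε + ε * θ) (W θ)) θ)| ≤
      66 * B ^ 5 * ε ^ 2 + 7 * B ^ 3 * d := by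
  have hB := hL.one_le
  have hε := hP.hε.1
  have hε1 := hP.eps_le_one hL
  have hd0 : 0 ≤ d := (norm_nonneg _).trans hd
  have hθ1 : θ ∈ Icc (0 : ℝ) 1 := ⟨hθ.1, hθ.2.trans hP.hc.2⟩
  have hYW : ‖eulerCurve f g h α a ε (j * ε) (Z 0) θ - W θ‖ ≤ 2 * B * d + B ^ 2 * ε ^ 2 := by
    refine (hP.norm_euler_sub_ideal_le hL hW hWR hθ).trans ?_
    have : (1 + B * ε) * ‖Z 0 - W 0‖ ≤ (B + B * 1) * d := by gcongr
    linarith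
  have hpW : ‖Z 0 - W θ‖ ≤ B * ε + d := by
    have := hP.ideal_norm_sub_init_le hL hW hWR hθ
    rw [norm_sub_rev] at this
    exact (norm_sub_le_norm_sub_add_norm_sub _ (W 0) _).trans (by linarith)
  have hZW : ‖Z θ - W θ‖ ≤ 3 * B ^ 2 * ε + d := by
    have h1 := hP.norm_sub_init_le hL hθ
    refine (norm_sub_le_norm_sub_add_norm_sub _ (Z 0) _).trans ?_
    have : B * ε ≤ B ^ 2 * ε := by gcongr; exact le_self_pow₀ hB (by norm_num)
    linarith
  have hfst := hP.norm_fst_sub_le hL hθ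
  have hsnd := hP.norm_snd_sub_le hL hθ
  have hu_le := hP.abs_duty_init_le
  have huv := lip_time_of_estimates hL.duty (by linarith) ⟨hε.le, hε1⟩ (t := j * ε) (by positivity)
    (hP.time_nonneg hθ.1) (by linarith [hP.norm_init]) (hWR θ hθ) hpW (by
      rw [abs_sub_comm]
      refine (hP.abs_time_sub_le hθ).trans ?_
      nlinarith)
  have hWm : (W θ).1 ∈ Metric.closedBall (0 : E) R := by
    simpa using (norm_fst_le (W θ)).trans (hWR θ hθ)
  set u := idealFeedback g h α ε (j * ε) (Z 0)
  set v := idealFeedback g h α ε (j * ε + ε * θ) (W θ)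
  have hs := (abs_s1_sub_le hL.um_pos u v θ).trans huv
  have hs0 : |s1 um u θ| ≤ 2 * B :=
    (abs_s1_le_of_abs_le hL.um_pos hu_le θ).trans (by linarith [hL.um_le])
  have hg0 := hL.input.bound _ hWm
  have hgl : ‖g (Z 0).1 - g (W θ).1‖ ≤ B * (B * ε + d) :=
    (hL.input.lip _ (hP.mem_ball_init hL) _ hWm).trans (by
      gcongr
      exact (norm_fst_le (Z 0 - W θ)).trans hpW)
  have hYW1 : ‖(eulerCurve f g h α a ε (j * ε) (Z 0) θ).1 - (W θ).1‖ ≤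
      2 * B * d + B ^ 2 * ε ^ 2 := (norm_fst_le (_ - W θ)).trans hYW
  have hYW2 : ‖(eulerCurve f g h α a ε (j * ε) (Z 0) θ).2 - (W θ).2‖ ≤
      2 * B * d + B ^ 2 * ε ^ 2 := (norm_snd_le (_ - W θ)).trans hYW
  have q0 : 0 ≤ B ^ 5 * ε ^ 2 := by positivity
  have q1 : 0 ≤ B ^ 3 * d := by positivity
  have p1 : B * d ≤ B ^ 2 * d := by gcongr; exact le_self_pow₀ hB (by norm_num)
  have p2 : B ^ 2 * ε ^ 2 ≤ B ^ 4 * ε ^ 2 := by gcongr; norm_num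
  have p3 : B ^ 3 * ε ^ 2 ≤ B ^ 4 * ε ^ 2 := by gcongr; norm_num
  have p4 : B ^ 4 * ε ^ 2 ≤ B ^ 5 * ε ^ 2 := by gcongr; norm_num
  have p5 : B ^ 2 * d ≤ B ^ 3 * d := by gcongr; norm_num
  have hx : ‖(Z θ).1 - ((W θ).1 + (ε * s1 um v θ) • g (W θ).1)‖ ≤
      48 * B ^ 4 * ε ^ 2 + 5 * B ^ 2 * d := by
    have e : (Z θ).1 - ((W θ).1 + (ε * s1 um v θ) • g (W θ).1) =
        ((Z θ).1 - (eulerCurve f g h α a ε (j * ε) (Z 0) θ).1 - (ε * s1 um u θ) • g (Z 0).1) +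
        ((eulerCurve f g h α a ε (j * ε) (Z 0) θ).1 - (W θ).1) +
        ((ε * s1 um u θ) • (g (Z 0).1 - g (W θ).1) +
          (ε * (s1 um u θ - s1 um v θ)) • g (W θ).1) := by module
    have b1 : ‖(ε * s1 um u θ) • (g (Z 0).1 - g (W θ).1)‖ ≤ ε * (2 * B) * (B * (B * ε + d)) := by
      rw [norm_smul, norm_mul, Real.norm_eq_abs, Real.norm_eq_abs, abs_of_pos hε]; gcongr
    have b2 : ‖(ε * (s1 um u θ - s1 um v θ)) • g (W θ).1‖ ≤ ε * (B * (B * ε + d)) * B := by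
      rw [norm_smul, norm_mul, Real.norm_eq_abs, Real.norm_eq_abs, abs_of_pos hε]; gcongr
    rw [e]
    refine (norm_add_le_of_le (norm_add_le_of_le hfst hYW1) (norm_add_le_of_le b1 b2)).trans ?_
    have p6 : B ^ 2 * d * ε ≤ B ^ 2 * d := mul_le_of_le_one_right (by positivity) hε1
    linarith
  refine ⟨hx.trans (by linarith), ?_, ?_⟩
  · have := norm_add_le_of_le hsnd hYW2
    rw [sub_add_sub_cancel] at this
    linarith
  · have t1 := hL.output.taylor _ hWm _ (hP.mem_ball_fst hL hθ)
    have t2 := hL.output.fderiv_bound _ hWm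
    -- Expanding `h` at the ideal state leaves a remainder quadratic in an `O(ε) + d` displacement.
    -- The linear term turns the ripple on the state into the virtual output times `s1`.
    have e : h (Z θ).1 - (h (W θ).1 + virtualOutput g h ε (W θ).1 * s1 um v θ) =
        (h (Z θ).1 - h (W θ).1 - fderiv ℝ h (W θ).1 ((Z θ).1 - (W θ).1)) +
        fderiv ℝ h (W θ).1 ((Z θ).1 - ((W θ).1 + (ε * s1 um v θ) • g (W θ).1)) := by
      simp only [virtualOutput, map_sub, map_add, map_smul, smul_eq_mul]; ring
    rw [← Real.norm_eq_abs, e]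
    have t3 : ‖fderiv ℝ h (W θ).1 ((Z θ).1 - ((W θ).1 + (ε * s1 um v θ) • g (W θ).1))‖ ≤
        B * (48 * B ^ 4 * ε ^ 2 + 5 * B ^ 2 * d) :=
      (ContinuousLinearMap.le_opNorm _ _).trans (by gcongr)
    have t4 : B * ‖(Z θ).1 - (W θ).1‖ ^ 2 ≤ B * (18 * B ^ 4 * ε ^ 2 + 2 * d) := by
      gcongr
      calc ‖(Z θ).1 - (W θ).1‖ ^ 2 ≤ (3 * B ^ 2 * ε + d) ^ 2 := by
            gcongr
            exact (norm_fst_le (Z θ - W θ)).trans hZW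
        _ ≤ 18 * B ^ 4 * ε ^ 2 + 2 * d := by
            nlinarith [sq_nonneg (3 * B ^ 2 * ε - d)]
    refine (norm_add_le_of_le (t1.trans t4) t3).trans ?_
    have p7 : B * d ≤ B ^ 3 * d := by gcongr; exact le_self_pow₀ hB (by norm_num)
    linarith

end PeriodSolution

theorem norm_measuredFeedback_sub_le {φ : Q → ℝ × ℝ → ℝ → G} {B' R' C' t : ℝ}
    (hφ : C2Estimates (fun z : Q × (ℝ × ℝ) × ℝ => φ z.1 z.2.1 z.2.2)
      {z | ‖z.1‖ ≤ R' ∧ ‖z.2.1‖ ≤ R' ∧ 0 ≤ z.2.2} B') (ht : 0 ≤ t) {X : E × Q}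
    (hX : ‖X.2‖ ≤ R') (hH : ‖Hb ε X.1 X.2 (t / ε) t‖ ≤ R')
    (hH' : ‖extOutput g h ε (correctedState um g h α ε t X).1‖ ≤ R')
    (hC : ‖Hb ε X.1 X.2 (t / ε) t - extOutput g h ε (correctedState um g h α ε t X).1‖ ≤ C') :
    ‖measuredFeedback Hb φ ε t X - idealFeedback g h φ ε t (correctedState um g h α ε t X)‖ ≤
      |B'| * C' := by
  have := hφ.lip (X.2, Hb ε X.1 X.2 (t / ε) t, t) ⟨hX, hH, ht⟩
    (X.2, extOutput g h ε (correctedState um g h α ε t X).1, t) ⟨hX, hH', ht⟩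
  refine this.trans (mul_le_mul (le_abs_self _) ?_ (norm_nonneg _) (abs_nonneg _))
  have hC0 := (norm_nonneg _).trans hC
  simp only [Prod.mk_sub_mk, sub_self]
  exact norm_prod_le_iff.2 ⟨by simpa using hC0, norm_prod_le_iff.2 ⟨hC, by simpa using hC0⟩⟩

/-- The estimates hold on every ball, for `ε` small enough. -/
theorem exists_loopEstimates [FiniteDimensional ℝ E] [FiniteDimensional ℝ Q] (hum : 0 < um)
    (hf : ContDiff ℝ 2 f) (hg : ContDiff ℝ 2 g) (hh : ContDiff ℝ 3 h)
    (hα : UniformC2 α) (ha : UniformC2 a) (hHb : IsCorrectedOutput um g h α Hb) (R : ℝ) :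
    ∃ B ε₁ : ℝ, 0 < ε₁ ∧ LoopEstimates um f g h α a Hb R B ε₁ := by
  have := FiniteDimensional.proper ℝ E
  have := FiniteDimensional.proper ℝ Q
  have hcF := c2BoundedOn_idealField hf hg hh hα ha R
  obtain ⟨B₁, h₁⟩ := hcF.exists_estimates (convex_loopDomain _ R)
  obtain ⟨B₂, h₂⟩ := (hα.c2BoundedOn_feedback (E := E) hg hh R).exists_estimates
    (convex_loopDomain _ R)
  obtain ⟨B₃, h₃⟩ := (ha.c2BoundedOn_feedback (E := E) hg hh R).exists_estimates
    (convex_loopDomain _ R)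
  obtain ⟨B₄, h₄⟩ := (C2BoundedOn.of_isCompact hf
    (isCompact_closedBall (0 : E) R)).exists_estimates (convex_closedBall _ _)
  obtain ⟨B₅, h₅⟩ := (C2BoundedOn.of_isCompact hg
    (isCompact_closedBall (0 : E) R)).exists_estimates (convex_closedBall _ _)
  obtain ⟨B₆, h₆⟩ := (C2BoundedOn.of_isCompact (hh.of_le (by norm_num))
    (isCompact_closedBall (0 : E) R)).exists_estimates (convex_closedBall _ _)
  obtain ⟨B₇, h₇⟩ := (c2BoundedOn_extOutput (Q := Q) hg hh R).exists_estimates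
    (convex_loopDomain _ R)
  -- The radius leaves room for the exact output, bounded by `B₇`, and for a measured output at
  -- distance at most `1` from it.
  have hconv : Convex ℝ {z : Q × (ℝ × ℝ) × ℝ | ‖z.1‖ ≤ max R (B₇ + 1) ∧
      ‖z.2.1‖ ≤ max R (B₇ + 1) ∧ 0 ≤ z.2.2} := by
    have e : {z : Q × (ℝ × ℝ) × ℝ | ‖z.1‖ ≤ max R (B₇ + 1) ∧
      ‖z.2.1‖ ≤ max R (B₇ + 1) ∧ 0 ≤ z.2.2} = Metric.closedBall 0 (max R (B₇ + 1)) ×ˢ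
        (Metric.closedBall 0 (max R (B₇ + 1)) ×ˢ Ici (0 : ℝ)) := by
      ext z; simp
    rw [e]
    exact (convex_closedBall _ _).prod ((convex_closedBall _ _).prod (convex_Ici _))
  obtain ⟨B₈, h₈⟩ := (hα.c2BoundedOn (max R (B₇ + 1))).exists_estimates hconv
  obtain ⟨B₉, h₉⟩ := (ha.c2BoundedOn (max R (B₇ + 1))).exists_estimates hconv
  obtain ⟨C, ε₂, hε₂, hC⟩ := hHb (Metric.closedBall 0 (R - 1)) (isCompact_closedBall _ _)
  obtain ⟨B, hB⟩ : ∃ B, B = 1 + um + um⁻¹ + |B₁| + |B₂| + |B₃| + |B₄| + |B₅| + |B₆| +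
    |B₈| * |C| + |B₉| * |C| := ⟨_, rfl⟩
  have hi := inv_pos.2 hum
  have n8 : 0 ≤ |B₈| * |C| := by positivity
  have n9 : 0 ≤ |B₉| * |C| := by positivity
  have a1 := abs_nonneg B₁
  have a2 := abs_nonneg B₂
  have a3 := abs_nonneg B₃
  have a4 := abs_nonneg B₄
  have a5 := abs_nonneg B₅
  have a6 := abs_nonneg B₆
  have hB1 : 1 ≤ B := by rw [hB]; linarith
  have hum' : um ≤ B := by rw [hB]; linarith
  have m2 := h₂.mono (B' := B) (by rw [hB]; linarith [le_abs_self B₂])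
  have m5 := h₅.mono (B' := B) (by rw [hB]; linarith [le_abs_self B₅])
  -- The cap `(2 B²)⁻¹` keeps the ripple correction below `1`, so that states of norm at most `R -
  -- 1` stay in the ball of radius `R`. The cap `(|C| + 1)⁻¹` keeps the output remainder below `1`.
  refine ⟨B, min ε₂ (min 1 (min (2 * B ^ 2)⁻¹ (|C| + 1)⁻¹)), by positivity, ?_⟩
  have hε : ∀ ε ∈ Ioo 0 (min ε₂ (min 1 (min (2 * B ^ 2)⁻¹ (|C| + 1)⁻¹))),
      ε ∈ Ioo 0 ε₂ ∧ ε ≤ 1 ∧ ε * (2 * B ^ 2) ≤ 1 ∧ ε * (|C| + 1) ≤ 1 := by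
    intro ε hε
    have h1 := hε.2
    simp only [lt_min_iff] at h1
    refine ⟨⟨hε.1, h1.1⟩, h1.2.1.le, ?_, ?_⟩
    · rw [← le_div_iff₀ (by positivity), one_div]; exact h1.2.2.1.le
    · rw [← le_div_iff₀ (by positivity), one_div]; exact h1.2.2.2.le
  have hcorr : ∀ ε ∈ Ioo 0 (min ε₂ (min 1 (min (2 * B ^ 2)⁻¹ (|C| + 1)⁻¹))), ∀ t, 0 ≤ t →
      ∀ X : E × Q, ‖X‖ ≤ R - 1 → ‖correctedState um g h α ε t X‖ ≤ R := by
    intro ε hε' t ht X hX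
    obtain ⟨he, he1, he2, -⟩ := hε ε hε'
    have hx : X.1 ∈ Metric.closedBall (0 : E) R := by
      simpa using (norm_fst_le X).trans (by linarith)
    have hu : |idealFeedback g h α ε t X| ≤ B :=
      m2.bound (X, t, ε) ⟨by linarith, ht, he.1.le, he1⟩
    have hg0 := m5.bound _ hx
    have hs : |s1 um (idealFeedback g h α ε t X) (t / ε)| ≤ 2 * B := by
      refine (abs_s1_le hum _ _).trans ((abs_sub _ _).trans ?_)
      rw [abs_of_pos hum]; linarith
    refine norm_prod_le_iff.2 ⟨?_, (norm_snd_le X).trans (by linarith)⟩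
    refine (norm_sub_le _ _).trans ?_
    have : ‖(ε * s1 um (idealFeedback g h α ε t X) (t / ε)) • g X.1‖ ≤ ε * (2 * B) * B := by
      rw [norm_smul, norm_mul, Real.norm_eq_abs, Real.norm_eq_abs, abs_of_pos he.1]
      have := he.1
      gcongr
    have := norm_fst_le X
    linarith
  have hbase : ∀ ε ∈ Ioo 0 (min ε₂ (min 1 (min (2 * B ^ 2)⁻¹ (|C| + 1)⁻¹))), ∀ t, 0 ≤ t →
      ∀ X : E × Q, ‖X‖ ≤ R - 1 →
      ‖X.2‖ ≤ max R (B₇ + 1) ∧ ‖Hb ε X.1 X.2 (t / ε) t‖ ≤ max R (B₇ + 1) ∧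
      ‖extOutput g h ε (correctedState um g h α ε t X).1‖ ≤ max R (B₇ + 1) ∧
      ‖Hb ε X.1 X.2 (t / ε) t - extOutput g h ε (correctedState um g h α ε t X).1‖ ≤
        |C| * ε ^ 2 := by
    intro ε hε' t ht X hX
    obtain ⟨he, he1, -, he3⟩ := hε ε hε'
    have hc := hC ε he X (by simpa using hX) (t / ε) t ht
    change ‖Hb ε X.1 X.2 (t / ε) t - extOutput g h ε (correctedState um g h α ε t X).1‖ ≤ _ at hc
    have hH := h₇.bound (correctedState um g h α ε t X, t, ε)
      ⟨hcorr ε hε' t ht X hX, ht, he.1.le, he1⟩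
    have hCε : C * ε ^ 2 ≤ |C| * ε ^ 2 := by gcongr; exact le_abs_self C
    have hC1 : |C| * ε ^ 2 ≤ 1 := by
      have : ε ^ 2 ≤ ε := by nlinarith [he.1]
      nlinarith [abs_nonneg C, he.1]
    have hHb1 : ‖Hb ε X.1 X.2 (t / ε) t‖ ≤ B₇ + 1 := by
      have := norm_add_le_of_le hc hH
      rw [sub_add_cancel] at this
      linarith
    exact ⟨((norm_snd_le X).trans (by linarith)).trans (le_max_left _ _),
      hHb1.trans (le_max_right _ _), (by linarith [hH] : _ ≤ B₇ + 1).trans (le_max_right _ _),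
      hc.trans hCε⟩
  exact
    { one_le := hB1
      um_pos := hum
      um_le := hum'
      inv_um_le := by rw [hB]; linarith
      ε₁_le := (min_le_right _ _).trans (min_le_left _ _)
      field_continuous := hcF.1.continuous
      field := h₁.mono (by rw [hB]; linarith [le_abs_self B₁])
      duty := m2
      ctrl := h₃.mono (by rw [hB]; linarith [le_abs_self B₃])
      drift := h₄.mono (by rw [hB]; linarith [le_abs_self B₄])
      input := m5
      output := h₆.mono (by rw [hB]; linarith [le_abs_self B₆])
      corrected := hcorr
      measured_duty := fun ε hε' t ht X hX => by
        obtain ⟨k1, k2, k3, k4⟩ := hbase ε hε' t ht X hX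
        refine (norm_measuredFeedback_sub_le h₈ ht k1 k2 k3 k4).trans ?_
        rw [← mul_assoc]
        gcongr
        rw [hB]; linarith
      measured_ctrl := fun ε hε' t ht X hX => by
        obtain ⟨k1, k2, k3, k4⟩ := hbase ε hε' t ht X hX
        refine (norm_measuredFeedback_sub_le h₉ ht k1 k2 k3 k4).trans ?_
        rw [← mul_assoc]
        gcongr
        rw [hB]; linarith }

end Period

/-! ### Contraction from exponential stability, and accumulation of errors. -/

section Stability

variable {V : Type*} [NormedAddCommGroup V] [NormedSpace ℝ V]

/-- Regularity of a time-dependent vector field on a ball, uniformly in time. -/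
structure RegularField (F : ℝ → V → V) (R B : ℝ) : Prop where
  cont : ∀ (X : ℝ → V) (S : Set ℝ), ContinuousOn X S → ContinuousOn (fun t => F t (X t)) S
  lip : ∀ t, 0 ≤ t → ∀ x y, ‖x‖ ≤ R → ‖y‖ ≤ R → ‖F t x - F t y‖ ≤ B * ‖x - y‖
  second_diff : ∀ t, 0 ≤ t → ∀ x y z w, ‖x‖ ≤ R → ‖y‖ ≤ R → ‖z‖ ≤ R → ‖w‖ ≤ R →
    ‖F t x - F t y - (F t z - F t w)‖ ≤
      B * (‖x - y - (z - w)‖ + (‖x - z‖ + ‖y - w‖) * ‖z - w‖)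

variable [CompleteSpace V] {F : ℝ → V → V} {X Y Z : ℝ → V} {s T r k lam : ℝ}

/-- `ExpStable` provides one solution with the exponential estimate; uniqueness transfers the
estimate to any solution with the same initial state. -/
theorem IsSolution.eqOn_of_regular (hF : ∀ R, ∃ B, RegularField F R B) (hs : 0 ≤ s) (hsT : s ≤ T)
    (hX : IsSolution F s T X) (hY : IsSolution F s T Y) (h : X s = Y s) : EqOn X Y (Icc s T) := by
  obtain ⟨C, hC⟩ := isCompact_Icc.exists_bound_of_continuousOn (hX.continuousOn hsT)
  obtain ⟨C', hC'⟩ := isCompact_Icc.exists_bound_of_continuousOn (hY.continuousOn hsT)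
  obtain ⟨B, hB⟩ := hF (max C C')
  intro t ht
  have := hX.norm_sub_le (K := B) (S := {x | ‖x‖ ≤ max C C'}) hsT hY
    (hB.cont _ _ (hX.continuousOn hsT)) (hB.cont _ _ (hY.continuousOn hsT))
    (fun t ht => (hC t ht).trans (le_max_left _ _))
    (fun t ht => (hC' t ht).trans (le_max_right _ _))
    (fun t ht x hx y hy => hB.lip t (hs.trans ht.1) x y hx hy) t ht
  rw [h, sub_self, norm_zero, zero_mul] at this
  exact sub_eq_zero.1 (norm_le_zero_iff.1 this)

/-- Every solution starting in the region of attraction obeys the exponential estimate. -/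
theorem ExpStable.norm_sub_le (hE : ExpStable F r k lam Z) (hF : ∀ R, ∃ B, RegularField F R B)
    (hs : 0 ≤ s) (hX : IsSolution F s T X) (h : ‖X s - Z s‖ ≤ r) {t : ℝ} (ht : t ∈ Icc s T) :
    ‖X t - Z t‖ ≤ |k| * Real.exp (-lam * (t - s)) * ‖X s - Z s‖ := by
  obtain ⟨Y, hY0, hY, hYe⟩ := hE.2 s hs (X s) h
  have hsT := ht.1.trans ht.2
  rw [hX.eqOn_of_regular hF hs hsT (hY T hsT) hY0.symm ht]
  refine (hYe t ht.1).trans ?_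
  gcongr
  exact le_abs_self k

theorem ExpStable.norm_sub_le_mul (hE : ExpStable F r k lam Z)
    (hF : ∀ R, ∃ B, RegularField F R B) (hlam : 0 ≤ lam)
    (hs : 0 ≤ s) (hX : IsSolution F s T X) (h : ‖X s - Z s‖ ≤ r) {t : ℝ} (ht : t ∈ Icc s T) :
    ‖X t - Z t‖ ≤ |k| * ‖X s - Z s‖ := by
  refine (hE.norm_sub_le hF hs hX h ht).trans ?_
  have h1 : Real.exp (-lam * (t - s)) ≤ 1 := Real.exp_le_one_iff.2 (by nlinarith [ht.1])
  have : |k| * Real.exp (-lam * (t - s)) ≤ |k| := mul_le_of_le_one_right (abs_nonneg _) h1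
  gcongr

/-- Exponential stability of a reference solution makes the flow of a `C²` field contracting,
over a fixed time, near the reference. -/
theorem exists_contraction_of_expStable (r k lam B : ℝ) (hr : 0 < r) (hlam : 0 < lam)
    (hB : 1 ≤ B) :
    ∃ δ T₀ : ℝ, 0 < δ ∧ 2 * δ ≤ r ∧ 0 < T₀ ∧ ∀ (F : ℝ → V → V) (Z : ℝ → V) (R₀ : ℝ),
      ExpStable F r k lam Z → (∀ R, ∃ B, RegularField F R B) →
      RegularField F (R₀ + |k| * r) B → (∀ t, 0 ≤ t → ‖Z t‖ ≤ R₀) →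
      ∀ (s : ℝ) (X Y : ℝ → V), 0 ≤ s → IsSolution F s (s + 2 * T₀) X →
        IsSolution F s (s + 2 * T₀) Y → ‖X s - Z s‖ ≤ δ → ‖Y s - Z s‖ ≤ δ →
        ∀ t ∈ Icc (s + T₀) (s + 2 * T₀), ‖X t - Y t‖ ≤ 1 / 2 * ‖X s - Y s‖ := by
  set κ := |k| + 1 with hκ
  have hk0 := abs_nonneg k
  have hκ1 : 1 ≤ κ := by linarith
  -- Chosen so that the exponential estimate brings the distance to `Z` down to a quarter.
  set T₀ := Real.log (4 * κ) / lam with hT₀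
  have hT₀pos : 0 < T₀ := div_pos (Real.log_pos (by linarith)) hlam
  have hexp : |k| * Real.exp (-lam * T₀) ≤ 1 / 4 := by
    have : -lam * T₀ = -Real.log (4 * κ) := by rw [hT₀]; field_simp
    rw [this, Real.exp_neg, Real.exp_log (by linarith), ← div_eq_mul_inv,
      div_le_div_iff₀ (by linarith) (by norm_num)]
    linarith
  set M := 16 * κ ^ 2 * Real.exp (B * (2 * T₀)) with hM
  have hMpos : 0 < M := by positivity
  refine ⟨min (r / 2) M⁻¹, T₀, by positivity, ?_, hT₀pos, ?_⟩
  · have := min_le_left (r / 2) M⁻¹; linarith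
  intro F Z R₀ hE hloc hF hZ s X Y hs hX hY hXδ hYδ t ht
  set δ := min (r / 2) M⁻¹ with hδ
  have hδ0 : 0 ≤ δ := (norm_nonneg _).trans hXδ
  have hδr : 2 * δ ≤ r := by have := min_le_left (r / 2) M⁻¹; linarith
  have hδM : M * δ ≤ 1 := by
    calc M * δ ≤ M * M⁻¹ := by gcongr; exact min_le_right _ _
      _ = 1 := mul_inv_cancel₀ hMpos.ne'
  set d := ‖X s - Y s‖ with hd
  have hd2 : d ≤ 2 * δ := by
    have := norm_sub_le_norm_sub_add_norm_sub (X s) (Z s) (Y s)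
    rw [norm_sub_rev (Z s)] at this
    linarith
  have hWr : ‖Z s + (X s - Y s) - Z s‖ ≤ r := by
    rw [add_sub_cancel_left]; linarith
  -- Stability compares solutions with `Z` only. The solution `W` starts from `Z` displaced by the
  -- same vector as `X` from `Y`, so `W - Z` decays exponentially, and it remains to compare `X - Y`
  -- with `W - Z`.
  obtain ⟨W, hW0, hW, hWe⟩ := hE.2 s hs (Z s + (X s - Y s)) hWr
  have hT : s ≤ s + 2 * T₀ := by linarith
  have hWs := hW _ hT
  have hZs := (hE.1 (s + 2 * T₀) (hs.trans hT)).mono hs hT le_rfl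
  have hWn : ‖W s - Z s‖ = d := by rw [hW0, add_sub_cancel_left]
  have hWr' : ‖W s - Z s‖ ≤ r := by rw [hWn]; linarith
  have bX : ∀ τ ∈ Icc s (s + 2 * T₀), ‖X τ - Z τ‖ ≤ |k| * δ := fun τ hτ =>
    (hE.norm_sub_le_mul hloc hlam.le hs hX (by linarith) hτ).trans (by gcongr)
  have bY : ∀ τ ∈ Icc s (s + 2 * T₀), ‖Y τ - Z τ‖ ≤ |k| * δ := fun τ hτ =>
    (hE.norm_sub_le_mul hloc hlam.le hs hY (by linarith) hτ).trans (by gcongr)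
  have bW : ∀ τ ∈ Icc s (s + 2 * T₀), ‖W τ - Z τ‖ ≤ |k| * d := fun τ hτ =>
    (hE.norm_sub_le_mul hloc hlam.le hs hWs hWr' hτ).trans (by rw [hWn])
  have ball : ∀ {U : ℝ → V} {τ e : ℝ}, 0 ≤ τ → ‖U τ - Z τ‖ ≤ |k| * e → e ≤ r →
      ‖U τ‖ ≤ R₀ + |k| * r := fun {U τ e} hτ hU he => by
    have h1 := norm_add_le (U τ - Z τ) (Z τ)
    rw [sub_add_cancel] at h1
    have h2 : |k| * e ≤ |k| * r := by gcongr
    linarith [hZ τ hτ]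
  have hcont : ∀ {U : ℝ → V}, IsSolution F s (s + 2 * T₀) U →
      ContinuousOn (fun t => F t (U t)) (Icc s (s + 2 * T₀)) := fun hU =>
    hF.cont _ _ (hU.continuousOn hT)
  -- Both differences start equal, and the second-difference estimate makes the forcing quadratic,
  -- of size `δ d`. Grönwall over time `2 T₀` then keeps them within `d / 4` of each other, by the
  -- choice of `M` and `δ`.
  have gr := norm_le_gronwallBound_of_norm_deriv_right_le
    (f := fun τ => X τ - Y τ - (W τ - Z τ))
    (f' := fun τ => F τ (X τ) - F τ (Y τ) - (F τ (W τ) - F τ (Z τ)))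
    (δ := 0) (K := B) (ε := B * (4 * κ ^ 2 * δ * d)) (a := s) (b := s + 2 * T₀)
    (((hX.continuousOn hT).sub (hY.continuousOn hT)).sub
      ((hWs.continuousOn hT).sub (hZs.continuousOn hT)))
    (fun τ hτ => ((hX.hasDerivWithinAt (hcont hX) hτ).sub
      (hY.hasDerivWithinAt (hcont hY) hτ)).sub ((hWs.hasDerivWithinAt (hcont hWs) hτ).sub
      (hZs.hasDerivWithinAt (hcont hZs) hτ)))
    (by rw [hW0]; simp) (fun τ hτ => by
      have hτ' := Ico_subset_Icc_self hτ
      have h0 : 0 ≤ τ := hs.trans hτ.1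
      have b1 := bX τ hτ'
      have b2 := bY τ hτ'
      have b3 := bW τ hτ'
      refine (hF.second_diff τ h0 _ _ _ _ (ball h0 b1 (by linarith)) (ball h0 b2 (by linarith))
        (ball h0 b3 (by linarith)) ((hZ τ h0).trans (by nlinarith))).trans ?_
      rw [← mul_add]
      refine mul_le_mul_of_nonneg_left (add_le_add le_rfl ?_) (by linarith)
      have b4 : ‖X τ - W τ‖ ≤ |k| * δ + |k| * (2 * δ) := by
        have := norm_sub_le_norm_sub_add_norm_sub (X τ) (Z τ) (W τ)
        rw [norm_sub_rev (Z τ)] at this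
        have : |k| * d ≤ |k| * (2 * δ) := by gcongr
        linarith
      have hkκ : |k| ≤ κ := by linarith
      have hd0 : 0 ≤ d := norm_nonneg _
      calc (‖X τ - W τ‖ + ‖Y τ - Z τ‖) * ‖W τ - Z τ‖
          ≤ (|k| * δ + |k| * (2 * δ) + |k| * δ) * (|k| * d) := by gcongr
        _ = 4 * |k| ^ 2 * δ * d := by ring
        _ ≤ 4 * κ ^ 2 * δ * d := by gcongr) t ⟨by linarith [ht.1], ht.2⟩
  rw [gronwallBound_of_K_ne_0 (by linarith : B ≠ 0)] at gr
  have hd0 : 0 ≤ d := norm_nonneg _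
  have hgr : ‖X t - Y t - (W t - Z t)‖ ≤ 1 / 4 * d := by
    refine gr.trans ?_
    have h1 : Real.exp (B * (t - s)) ≤ Real.exp (B * (2 * T₀)) := by
      gcongr; linarith [ht.2]
    have h2 : B * (4 * κ ^ 2 * δ * d) / B = 4 * κ ^ 2 * δ * d := by field_simp
    simp only [zero_mul, zero_add, h2]
    calc 4 * κ ^ 2 * δ * d * (Real.exp (B * (t - s)) - 1)
        ≤ 4 * κ ^ 2 * δ * d * Real.exp (B * (2 * T₀)) := by gcongr; linarith
      _ = M * δ * d / 4 := by rw [hM]; ring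
      _ ≤ 1 * d / 4 := by gcongr
      _ = _ := by ring
  have hWt : ‖W t - Z t‖ ≤ 1 / 4 * d := by
    refine (hE.norm_sub_le hloc hs hWs hWr' ⟨by linarith [ht.1], ht.2⟩).trans ?_
    rw [hWn]
    have h1 : Real.exp (-lam * (t - s)) ≤ Real.exp (-lam * T₀) := by
      apply Real.exp_le_exp.2
      nlinarith [ht.1]
    gcongr
    exact (mul_le_mul_of_nonneg_left h1 hk0).trans hexp
  have := norm_add_le_of_le hgr hWt
  rw [sub_add_cancel] at this
  linarith

/-- Accumulation of small local errors along an exponentially stable reference. -/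
theorem grid_error_le {F : ℝ → V → V} {Z bar : ℝ → V} {r k lam R₀ δ T₀ A C ε K : ℝ} {m J : ℕ}
    {p : ℕ → V} (hE : ExpStable F r k lam Z) (hF : ∀ R, ∃ B, RegularField F R B)
    (hlam : 0 < lam) (hZ : ∀ t, 0 ≤ t → ‖Z t‖ ≤ R₀) (hδ2 : 2 * δ ≤ r)
    (hT₀ : 0 < T₀) (hA : 0 ≤ A) (hC : 0 ≤ C) (hε : 0 < ε) (hεT : ε ≤ T₀)
    (hcontr : ∀ (s : ℝ) (X Y : ℝ → V), 0 ≤ s → IsSolution F s (s + 2 * T₀) X →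
        IsSolution F s (s + 2 * T₀) Y → ‖X s - Z s‖ ≤ δ → ‖Y s - Z s‖ ≤ δ →
        ∀ t ∈ Icc (s + T₀) (s + 2 * T₀), ‖X t - Y t‖ ≤ 1 / 2 * ‖X s - Y s‖)
    (hbar : ∀ T, 0 ≤ T → IsSolution F 0 T bar) (hbarr : ‖bar 0 - Z 0‖ ≤ r)
    (hm : |k| * Real.exp (-lam * (m * T₀)) * r ≤ δ / 2)
    (hK : 2 * (C * ((m + 1) * (2 * T₀)) * Real.exp (A * ((m + 1) * (2 * T₀)))) ≤ K)
    (hKε : K * ε ^ 2 ≤ δ / 2) (hp0 : p 0 = bar 0)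
    (hstep : ∀ i < J, ‖p i - bar (i * ε)‖ ≤ K * ε ^ 2 → ∀ W : ℝ → V,
      IsSolution F (i * ε) (i * ε + ε) W →
      (∀ t ∈ Icc (i * ε) (i * ε + ε), ‖W t‖ ≤ R₀ + |k| * r) →
      ‖p (i + 1) - W (i * ε + ε)‖ ≤ (1 + A * ε) * ‖p i - W (i * ε)‖ + C * ε ^ 3) :
    ∀ j ≤ J, ‖p j - bar (j * ε)‖ ≤ K * ε ^ 2 := by
  have hr : 0 ≤ r := (norm_nonneg _).trans hbarr
  have hbarZ : ∀ t, 0 ≤ t → ‖bar t - Z t‖ ≤ |k| * Real.exp (-lam * t) * r := fun t ht => by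
    have := hE.norm_sub_le hF le_rfl (hbar t ht) hbarr ⟨ht, le_rfl⟩
    rw [sub_zero] at this
    refine this.trans ?_
    gcongr
  have hball : ∀ {U : ℝ → V} {t : ℝ}, 0 ≤ t → ‖U t - Z t‖ ≤ |k| * r → ‖U t‖ ≤ R₀ + |k| * r :=
    fun {U t} ht hU => by
      have h1 := norm_add_le (U t - Z t) (Z t)
      rw [sub_add_cancel] at h1
      linarith [hZ t ht]
  -- A window of `N` steps lasts between `T₀` and `2 T₀`, the range where the contraction is
  -- available.
  obtain ⟨N, hN⟩ : ∃ N, N = ⌈T₀ / ε⌉₊ := ⟨_, rfl⟩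
  have hN1 : T₀ ≤ N * ε := by
    rw [← div_le_iff₀ hε, hN]; exact Nat.le_ceil _
  have hN2 : N * ε ≤ 2 * T₀ := by
    have := Nat.ceil_lt_add_one (div_nonneg hT₀.le hε.le)
    rw [← hN] at this
    have h2 : (N : ℝ) * ε ≤ (T₀ / ε + 1) * ε := by gcongr
    rw [add_mul, div_mul_cancel₀ _ hε.ne'] at h2
    linarith
  set T₂ := (m + 1) * (2 * T₀) with hT₂
  have hT₂0 : 2 * T₀ ≤ T₂ := by
    rw [hT₂]; have : (0 : ℝ) ≤ m := Nat.cast_nonneg m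
    nlinarith
  have hT₂pos : 0 ≤ T₂ := by linarith
  -- accumulation of errors with respect to a given ideal solution
  have hacc : ∀ (i₀ n : ℕ) (W : ℝ → V), i₀ + n ≤ J →
      (∀ i < i₀ + n, ‖p i - bar (i * ε)‖ ≤ K * ε ^ 2) →
      IsSolution F (i₀ * ε) ((i₀ + n : ℕ) * ε) W →
      (∀ t ∈ Icc (i₀ * ε) ((i₀ + n : ℕ) * ε), ‖W t‖ ≤ R₀ + |k| * r) → p i₀ = W (i₀ * ε) →
      n * ε ≤ T₂ → ‖p (i₀ + n) - W ((i₀ + n : ℕ) * ε)‖ ≤ C * T₂ * Real.exp (A * T₂) * ε ^ 2 := by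
    intro i₀ n W hJ hi hW hWR h0 hn
    have := discrete_gronwall_affine (e := fun i => ‖p (i₀ + i) - W ((i₀ + i : ℕ) * ε)‖)
      (A := A * ε) (B := C * ε ^ 3) (by positivity) (by positivity) (N := n) (fun i hi' => by
        have h1 : ((i₀ + i : ℕ) : ℝ) * ε + ε = ((i₀ + (i + 1) : ℕ) : ℝ) * ε := by push_cast; ring
        have h2 : ((i₀ + (i + 1) : ℕ) : ℝ) * ε ≤ ((i₀ + n : ℕ) : ℝ) * ε := by
          gcongr; omega
        have h3 : (i₀ : ℝ) * ε ≤ ((i₀ + i : ℕ) : ℝ) * ε := by gcongr; omega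
        have := hstep (i₀ + i) (by omega) (hi _ (by omega)) W
          (hW.mono h3 (by linarith) (by linarith)) (fun t ht => hWR t
            ⟨h3.trans ht.1, ht.2.trans (by linarith)⟩)
        rw [h1] at this
        exact this) (norm_nonneg _) n le_rfl
    refine this.trans ?_
    simp only [add_zero, h0, sub_self, norm_zero, zero_add]
    calc (n : ℝ) * (C * ε ^ 3) * Real.exp (A * ε * n)
        = C * (n * ε) * Real.exp (A * (n * ε)) * ε ^ 2 := by ring_nf
      _ ≤ C * T₂ * Real.exp (A * T₂) * ε ^ 2 := by gcongr
  -- Local errors use up half of `K ε²`; the other half is left for the contracted past error.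
  have hKb : C * T₂ * Real.exp (A * T₂) * ε ^ 2 ≤ 1 / 2 * (K * ε ^ 2) := by
    have := mul_le_mul_of_nonneg_right hK (sq_nonneg ε)
    linarith
  have hK0 : 0 ≤ K * ε ^ 2 := by
    have : 0 ≤ C * T₂ * Real.exp (A * T₂) * ε ^ 2 := by positivity
    linarith
  intro j
  induction j using Nat.strong_induction_on with
  | _ j ih =>
    intro hj
    have ih' : ∀ i < j, ‖p i - bar (i * ε)‖ ≤ K * ε ^ 2 := fun i hi => ih i hi (by omega)
    -- In the initial phase errors are accumulated directly with respect to `bar`. It lasts until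
    -- `bar` has had the time `m T₀` to come within `δ / 2` of `Z`, plus one window.
    rcases le_or_gt j ((m + 1) * N) with hjN | hjN
    · have hjT : (j : ℝ) * ε ≤ T₂ := by
        calc (j : ℝ) * ε ≤ (((m + 1) * N : ℕ) : ℝ) * ε := by gcongr
          _ = (m + 1) * (N * ε) := by push_cast; ring
          _ ≤ T₂ := by rw [hT₂]; gcongr
      have h0j : (0 : ℝ) ≤ j * ε := by positivity
      have := hacc 0 j bar (by omega) (fun i hi => ih' i (by omega))
        (by simpa using hbar _ h0j)
        (fun t ht => by
          have ht0 : 0 ≤ t := by simpa using ht.1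
          refine hball ht0 ((hbarZ t ht0).trans ?_)
          have : Real.exp (-lam * t) ≤ 1 := Real.exp_le_one_iff.2 (by nlinarith)
          have : |k| * Real.exp (-lam * t) ≤ |k| := mul_le_of_le_one_right (abs_nonneg _) this
          gcongr)
        (by simpa using hp0) hjT
      rw [zero_add] at this
      linarith
    -- Afterwards, an ideal solution `W` is restarted from `p` one window earlier. Over that window
    -- `p` departs from `W` by at most half the bound, and contraction halves the earlier distance
    -- between `W` and `bar`.
    · obtain ⟨i₀, rfl⟩ : ∃ i₀, j = i₀ + N := ⟨j - N, by
        have : N ≤ (m + 1) * N := Nat.le_mul_of_pos_left N (by omega)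
        omega⟩
      have hNpos : 0 < N := by
        rw [hN]; exact Nat.ceil_pos.2 (by positivity)
      have hi₀m : m * N ≤ i₀ := by
        have : (m + 1) * N = m * N + N := by ring
        omega
      set s : ℝ := i₀ * ε with hs
      have hs0 : 0 ≤ s := by positivity
      have hsm : m * T₀ ≤ s := by
        calc m * T₀ ≤ m * (N * ε) := by gcongr
          _ = ((m * N : ℕ) : ℝ) * ε := by push_cast; ring
          _ ≤ s := by rw [hs]; gcongr
      have hbs : ‖bar s - Z s‖ ≤ δ / 2 := by
        refine (hbarZ s hs0).trans (le_trans ?_ hm)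
        have : Real.exp (-lam * s) ≤ Real.exp (-lam * (m * T₀)) :=
          Real.exp_le_exp.2 (by nlinarith)
        gcongr
      have hps := ih' i₀ (by omega)
      have hpZ : ‖p i₀ - Z s‖ ≤ δ := by
        have := norm_sub_le_norm_sub_add_norm_sub (p i₀) (bar s) (Z s)
        linarith
      have hδ0 : 0 ≤ δ := (norm_nonneg _).trans hpZ
      obtain ⟨W, hW0, hW, hWe⟩ := hE.2 s hs0 (p i₀) (by linarith)
      have hcast : ((i₀ + N : ℕ) : ℝ) * ε = s + N * ε := by push_cast; ring
      have hle : s ≤ ((i₀ + N : ℕ) : ℝ) * ε := by rw [hcast]; linarith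
      have h1 := hacc i₀ N W hj ih' (hW _ hle)
        (fun t ht => by
          have ht0 : 0 ≤ t := hs0.trans ht.1
          refine hball ht0 ((hE.norm_sub_le_mul hF hlam.le hs0 (hW _ ht.1)
            (by rw [hW0]; linarith) ⟨ht.1, le_rfl⟩).trans ?_)
          rw [hW0]
          gcongr
          linarith) hW0.symm (by linarith)
      have hmem : ((i₀ + N : ℕ) : ℝ) * ε ∈ Icc (s + T₀) (s + 2 * T₀) := by
        rw [hcast]; constructor <;> linarith
      have h2 := hcontr s W bar hs0 (hW _ (by linarith))
        ((hbar (s + 2 * T₀) (by linarith)).mono hs0 (by linarith) le_rfl)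
        (by rw [hW0]; exact hpZ) (by linarith) _ hmem
      rw [hW0] at h2
      have h3 := norm_sub_le_norm_sub_add_norm_sub (p (i₀ + N)) (W (((i₀ + N : ℕ) : ℝ) * ε))
        (bar (((i₀ + N : ℕ) : ℝ) * ε))
      linarith

end Stability

/-! ### Tracking of the ideal solution for all times. -/

section Tracking

variable {E Q : Type*} [NormedAddCommGroup E] [NormedSpace ℝ E]
  [NormedAddCommGroup Q] [NormedSpace ℝ Q]
  {um : ℝ} {f g : E → E} {h : E → ℝ} {α : Q → ℝ × ℝ → ℝ → ℝ}
  {a : Q → ℝ × ℝ → ℝ → Q} {Hb : ℝ → E → Q → ℝ → ℝ → ℝ × ℝ}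

theorem RegularField.mono {V : Type*} [NormedAddCommGroup V] {F : ℝ → V → V}
    {R R' B : ℝ} (hF : RegularField F R B) (hR : R' ≤ R) : RegularField F R' B where
  cont := hF.cont
  lip t ht x y hx hy := hF.lip t ht x y (hx.trans hR) (hy.trans hR)
  second_diff t ht x y z w hx hy hz hw := hF.second_diff t ht x y z w (hx.trans hR)
    (hy.trans hR) (hz.trans hR) (hw.trans hR)

theorem regularField_of_estimates {R B ε : ℝ}
    (hc : Continuous fun z : (E × Q) × ℝ × ℝ => idealField f g h α a z.2.2 z.2.1 z.1)
    (hF : C2Estimates (fun z : (E × Q) × ℝ × ℝ => idealField f g h α a z.2.2 z.2.1 z.1)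
      (loopDomain (E × Q) R) B) (hε : ε ∈ Icc (0 : ℝ) 1) :
    RegularField (idealField f g h α a ε) R B where
  cont X S hX := hc.comp_continuousOn (hX.prodMk (continuousOn_id.prodMk continuousOn_const))
  lip t ht x y hx hy := by
    have := hF.lip (x, t, ε) ⟨hx, ht, hε⟩ (y, t, ε) ⟨hy, ht, hε⟩
    simpa [Prod.norm_def] using this
  second_diff t ht x y z w hx hy hz hw := by
    have := hF.second_diff (x, t, ε) ⟨hx, ht, hε⟩ (y, t, ε) ⟨hy, ht, hε⟩ (z, t, ε) ⟨hz, ht, hε⟩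
      (w, t, ε) ⟨hw, ht, hε⟩
    simpa [Prod.norm_def] using this

theorem regularField_idealField [FiniteDimensional ℝ E] [FiniteDimensional ℝ Q]
    (hf : ContDiff ℝ 2 f) (hg : ContDiff ℝ 2 g) (hh : ContDiff ℝ 3 h)
    (hα : UniformC2 α) (ha : UniformC2 a) {ε : ℝ} (hε : ε ∈ Icc (0 : ℝ) 1) (R : ℝ) :
    ∃ B, RegularField (idealField f g h α a ε) R B := by
  have hc := c2BoundedOn_idealField (E := E) hf hg hh hα ha R
  obtain ⟨B, hB⟩ := hc.exists_estimates (convex_loopDomain _ R)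
  exact ⟨B, regularField_of_estimates hc.1.continuous hB hε⟩

/-- An ideal solution `bar`, attracted by an exponentially stable solution `Z`, together with
a choice of constants (and `ε` small enough) for which solutions of the PWM-fed loop track it. -/
structure TrackingData (um : ℝ) (f g : E → E) (h : E → ℝ) (α : Q → ℝ × ℝ → ℝ → ℝ)
    (a : Q → ℝ × ℝ → ℝ → Q) (Hb : ℝ → E → Q → ℝ → ℝ → ℝ × ℝ) (R B ε₁ r k lam R₀ δ T₀ : ℝ) (m : ℕ)
    (K ρ ε : ℝ) (Z bar : ℝ → E × Q) : Prop where
  loop : LoopEstimates um f g h α a Hb R B ε₁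
  hε : ε ∈ Ioo 0 ε₁
  regular : ∀ R, ∃ B, RegularField (idealField f g h α a ε) R B
  stable : ExpStable (idealField f g h α a ε) r k lam Z
  lam_pos : 0 < lam
  ref_bound : ∀ t, 0 ≤ t → ‖Z t‖ ≤ R₀
  radius : R₀ + |k| * r + 3 ≤ R
  δ_le : 2 * δ ≤ r
  T₀_pos : 0 < T₀
  ε_le : ε ≤ T₀
  contraction : ∀ (s : ℝ) (X Y : ℝ → E × Q), 0 ≤ s →
    IsSolution (idealField f g h α a ε) s (s + 2 * T₀) X →
    IsSolution (idealField f g h α a ε) s (s + 2 * T₀) Y → ‖X s - Z s‖ ≤ δ → ‖Y s - Z s‖ ≤ δ →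
    ∀ t ∈ Icc (s + T₀) (s + 2 * T₀), ‖X t - Y t‖ ≤ 1 / 2 * ‖X s - Y s‖
  bar_sol : ∀ T, 0 ≤ T → IsSolution (idealField f g h α a ε) 0 T bar
  bar_init : ‖bar 0 - Z 0‖ ≤ r
  hm : |k| * Real.exp (-lam * (m * T₀)) * r ≤ δ / 2
  hK : 2 * (1001 * B ^ 8 * ((m + 1) * (2 * T₀)) *
    Real.exp (2 * B ^ 2 * ((m + 1) * (2 * T₀)))) ≤ K
  Kε_le : K * ε ^ 2 ≤ δ / 2
  Kε_le_ρ : K * ε ^ 2 ≤ ρ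
  ρ_le : ρ ≤ 1
  Bε_lt : 2 * B ^ 2 * ε < ρ
  Bε_le_um : B ^ 2 * ε ≤ 2 * um
  range : ∀ t, 0 ≤ t → ∀ X : E × Q, ‖X - bar t‖ ≤ 3 * ρ → |idealFeedback g h α ε t X| ≤ um

namespace TrackingData

variable {R B ε₁ r k lam R₀ δ T₀ : ℝ} {m : ℕ} {K ρ ε : ℝ} {Z bar : ℝ → E × Q}

section
variable (D : TrackingData um f g h α a Hb R B ε₁ r k lam R₀ δ T₀ m K ρ ε Z bar)
include D

theorem rescale_bar (j : ℕ) {c : ℝ} (hc : 0 ≤ c) :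
    IsSolution (fun θ X => ε • idealField f g h α a ε (j * ε + ε * θ) X) 0 c
      (fun θ => bar (j * ε + ε * θ)) := by
  have hε := D.hε.1
  refine IsSolution.rescale hε ?_
  have h0 : 0 ≤ (j : ℝ) * ε := by positivity
  rw [mul_zero, add_zero]
  exact (D.bar_sol (j * ε + ε * c) (by positivity)).mono h0
    (le_add_of_nonneg_right (by positivity)) le_rfl

theorem rescale_pwm {X : ℝ → E × Q} {T : ℝ} (hX : IsSolution (pwmField um f g α a Hb ε) 0 T X)
    {j : ℕ} {c : ℝ} (hc : 0 ≤ c) (hjT : j * ε + ε * c ≤ T) :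
    IsSolution (fun θ X => ε • pwmField um f g α a Hb ε (j * ε + ε * θ) X) 0 c
      (fun θ => X (j * ε + ε * θ)) := by
  have hε := D.hε.1
  refine IsSolution.rescale hε ?_
  have h0 : 0 ≤ (j : ℝ) * ε := by positivity
  rw [mul_zero, add_zero]
  exact hX.mono h0 (le_add_of_nonneg_right (by positivity)) hjT

variable [CompleteSpace E] [CompleteSpace Q]

theorem norm_bar_le {t : ℝ} (ht : 0 ≤ t) : ‖bar t‖ ≤ R₀ + |k| * r := by
  have h1 := D.stable.norm_sub_le_mul D.regular D.lam_pos.le le_rfl (D.bar_sol t ht) D.bar_init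
    ⟨ht, le_rfl⟩
  have h2 := norm_add_le (bar t - Z t) (Z t)
  rw [sub_add_cancel] at h2
  have h3 : |k| * ‖bar 0 - Z 0‖ ≤ |k| * r := by gcongr; exact D.bar_init
  linarith [D.ref_bound t ht]

theorem norm_le_of_near {j : ℕ} {p : E × Q} (hp : ‖p - bar (j * ε)‖ ≤ K * ε ^ 2) :
    ‖p‖ ≤ R - 2 := by
  have hε := D.hε.1
  have h1 := D.norm_bar_le (t := j * ε) (by positivity)
  have h2 := norm_add_le (p - bar (j * ε)) (bar (j * ε))
  rw [sub_add_cancel] at h2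
  linarith [D.radius, D.Kε_le_ρ, D.ρ_le]

theorem norm_bar_sub_le (j : ℕ) {θ : ℝ} (hθ : θ ∈ Icc (0 : ℝ) 1) :
    ‖bar (j * ε + ε * θ) - bar (j * ε)‖ ≤ B * ε := by
  have hε := D.hε.1
  have hB := D.loop.one_le
  have h0 : 0 ≤ (j : ℝ) * ε := by positivity
  have h1 : (j : ℝ) * ε ≤ j * ε + ε * θ := le_add_of_nonneg_right (mul_nonneg hε.le hθ.1)
  have hs := (D.bar_sol (j * ε + ε * θ) (h0.trans h1)).mono h0 h1 le_rfl
  rw [hs.2 _ ⟨h1, le_rfl⟩, add_sub_cancel_left]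
  refine (intervalIntegral.norm_integral_le_of_norm_le_const (C := B) fun σ hσ => ?_).trans ?_
  · rw [uIoc_of_le h1] at hσ
    have hσ0 := h0.trans hσ.1.le
    exact D.loop.field.bound (bar σ, σ, ε) ⟨by linarith [D.norm_bar_le hσ0, D.radius], hσ0, hε.le,
      D.hε.2.le.trans D.loop.ε₁_le⟩
  · rw [add_sub_cancel_left, abs_of_nonneg (mul_nonneg hε.le hθ.1)]
    gcongr
    exact mul_le_of_le_one_right hε.le hθ.2

/-- The radius `3 ρ` in `range` is shared between the distance from `X` to `p`, that from `p` to
`bar` at the grid time, and the motion of `bar` during the period. -/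
theorem abs_duty_le_of_near {j : ℕ} {p : E × Q} (hp : ‖p - bar (j * ε)‖ ≤ K * ε ^ 2) (X : E × Q)
    (hX : ‖X - p‖ ≤ ρ) (θ : ℝ) (hθ : θ ∈ Icc (0 : ℝ) 1) :
    |idealFeedback g h α ε (j * ε + ε * θ) X| ≤ um := by
  have hε := D.hε.1
  have hB := D.loop.one_le
  refine D.range _ (add_nonneg (by positivity) (mul_nonneg hε.le hθ.1)) X ?_
  have h1 := norm_sub_le_norm_sub_add_norm_sub X p (bar (j * ε + ε * θ))
  have h2 := norm_sub_le_norm_sub_add_norm_sub p (bar (j * ε)) (bar (j * ε + ε * θ))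
  have h3 := D.norm_bar_sub_le j hθ
  rw [norm_sub_rev] at h3
  have h4 : B * ε ≤ 2 * B ^ 2 * ε := by gcongr; nlinarith
  linarith [D.Kε_le_ρ, D.Bε_lt]

theorem periodSolution {j : ℕ} {c : ℝ} (hc : c ∈ Icc (0 : ℝ) 1) {Y : ℝ → E × Q}
    (hY : IsSolution (fun θ X => ε • pwmField um f g α a Hb ε (j * ε + ε * θ) X) 0 c Y)
    (hp : ‖Y 0 - bar (j * ε)‖ ≤ K * ε ^ 2) :
    PeriodSolution um f g h α a Hb R B ε₁ ρ ε j c Y where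
  hε := D.hε
  small := D.Bε_lt
  hρ := D.ρ_le
  norm_init := D.norm_le_of_near hp
  hc := hc
  sol := hY
  range := D.abs_duty_le_of_near hp

/-- Solutions of the PWM-fed loop are `O(ε²)`-close to the ideal solution at the end of
every period. -/
theorem norm_sub_bar_le {X : ℝ → E × Q} {T : ℝ} (hX : IsSolution (pwmField um f g α a Hb ε) 0 T X)
    (h0 : X 0 = bar 0) {j : ℕ} (hj : j * ε ≤ T) : ‖X (j * ε) - bar (j * ε)‖ ≤ K * ε ^ 2 := by
  have hε := D.hε.1
  have hB := D.loop.one_le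
  refine grid_error_le (J := j) (p := fun i => X (i * ε)) (C := 1001 * B ^ 8) (A := 2 * B ^ 2)
    D.stable D.regular D.lam_pos D.ref_bound D.δ_le D.T₀_pos (by positivity) (by positivity) hε
    D.ε_le D.contraction D.bar_sol D.bar_init D.hm D.hK D.Kε_le (by simpa using h0) ?_ j le_rfl
  intro i hi hp W hW hWR
  have hiT : (i : ℝ) * ε + ε * 1 ≤ T := by
    have : ((i + 1 : ℕ) : ℝ) * ε ≤ j * ε := by gcongr; omega
    push_cast at this
    linarith
  have hP := D.periodSolution (c := 1) ⟨zero_le_one, le_rfl⟩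
    (D.rescale_pwm hX zero_le_one hiT) (by simpa using hp)
  have h1 := hP.norm_end_sub_ideal_le D.loop D.Bε_le_um (W := fun θ => W (i * ε + ε * θ))
    (IsSolution.rescale hε (by simpa using hW)) (fun θ hθ => by
      have := hWR (i * ε + ε * θ) ⟨le_add_of_nonneg_right (mul_nonneg hε.le hθ.1), by
        have := mul_le_of_le_one_right hε.le hθ.2
        linarith⟩
      linarith [D.radius])
  have e : ((i : ℝ) + 1) * ε = i * ε + ε := by ring
  simpa [e] using h1

/-- The last grid time before `t` carries an error `K ε²`, and the first-order expansion covers the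
remaining fraction of a period. No averaging is needed there, since the ripple is part of the
claimed approximation. -/
theorem estimates {X : ℝ → E × Q} {T : ℝ} (hX : IsSolution (pwmField um f g α a Hb ε) 0 T X)
    (h0 : X 0 = bar 0) {t : ℝ} (ht : t ∈ Icc 0 T) :
    ‖(X t).1 - ((bar t).1 + (ε * s1 um (idealFeedback g h α ε t (bar t)) (t / ε)) •
      g (bar t).1)‖ ≤ (66 * B ^ 5 + 7 * B ^ 3 * K) * ε ^ 2 ∧
    ‖(X t).2 - (bar t).2‖ ≤ (66 * B ^ 5 + 7 * B ^ 3 * K) * ε ^ 2 ∧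
    |h (X t).1 - (h (bar t).1 + virtualOutput g h ε (bar t).1 *
      s1 um (idealFeedback g h α ε t (bar t)) (t / ε))| ≤
      (66 * B ^ 5 + 7 * B ^ 3 * K) * ε ^ 2 := by
  have hε := D.hε.1
  obtain ⟨j, hj⟩ : ∃ j, j = ⌊t / ε⌋₊ := ⟨_, rfl⟩
  have hj1 : (j : ℝ) * ε ≤ t := by
    rw [← le_div_iff₀ hε, hj]; exact Nat.floor_le (div_nonneg ht.1 hε.le)
  have hj2 : t < (j + 1) * ε := by
    rw [← div_lt_iff₀ hε, hj]; exact Nat.lt_floor_add_one _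
  set θ := (t - j * ε) / ε with hθ
  have hθ0 : 0 ≤ θ := div_nonneg (by linarith) hε.le
  have hθ1 : θ ≤ 1 := by rw [hθ, div_le_one hε]; linarith
  have et : j * ε + ε * θ = t := by rw [hθ]; field_simp; ring
  have ed : t / ε = j + θ := by rw [hθ]; field_simp; ring
  have hp := D.norm_sub_bar_le hX h0 (hj1.trans ht.2)
  have hP := D.periodSolution ⟨hθ0, hθ1⟩ (D.rescale_pwm hX hθ0 (et.trans_le ht.2))
    (by simpa using hp)
  have := hP.estimates_ideal D.loop (D.rescale_bar j hθ0) (fun σ hσ => by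
    have := D.norm_bar_le (t := j * ε + ε * σ) (add_nonneg (by positivity)
      (mul_nonneg hε.le hσ.1))
    linarith [D.radius]) (d := K * ε ^ 2) (by simpa using hp) (D.Kε_le_ρ.trans D.ρ_le)
    (θ := θ) ⟨hθ0, le_rfl⟩
  rw [et] at this
  rw [ed, s1_add_natCast, add_mul]
  rwa [mul_assoc (7 * B ^ 3)]

end

end TrackingData

open Filter Topology in
theorem eventually_mul_lt (c : ℝ) {d : ℝ} (hd : 0 < d) : ∀ᶠ ε in 𝓝[>] (0 : ℝ), c * ε < d := by
  have : Tendsto (fun ε : ℝ => c * ε) (𝓝[>] 0) (𝓝 (c * 0)) :=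
    ((continuous_const_mul c).tendsto 0).mono_left nhdsWithin_le_nhds
  rw [mul_zero] at this
  exact this.eventually_lt_const hd

open Filter Topology in
theorem eventually_mul_sq_lt (c : ℝ) {d : ℝ} (hd : 0 < d) :
    ∀ᶠ ε in 𝓝[>] (0 : ℝ), c * ε ^ 2 < d := by
  have : Tendsto (fun ε : ℝ => c * ε ^ 2) (𝓝[>] 0) (𝓝 (c * 0 ^ 2)) :=
    ((by fun_prop : Continuous fun ε : ℝ => c * ε ^ 2).tendsto 0).mono_left nhdsWithin_le_nhds
  rw [zero_pow (by norm_num), mul_zero] at this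
  exact this.eventually_lt_const hd

open Filter Topology in
/-- Near an exponentially attracted ideal solution, tracking constants exist for all small `ε`. -/
theorem exists_trackingData [FiniteDimensional ℝ E] [FiniteDimensional ℝ Q] (hum : 0 < um)
    (hf : ContDiff ℝ 2 f) (hg : ContDiff ℝ 2 g) (hh : ContDiff ℝ 3 h)
    (hα : UniformC2 α) (ha : UniformC2 a) (hHb : IsCorrectedOutput um g h α Hb)
    {ε₂ r k lam R₀ ρ : ℝ} (hε₂ : 0 < ε₂) (hr : 0 < r) (hlam : 0 < lam) (hρ : 0 < ρ)
    {Z bar : ℝ → ℝ → E × Q}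
    (hZ : ∀ ε ∈ Ioo 0 ε₂, ExpStable (idealField f g h α a ε) r k lam (Z ε))
    (hZR : ∀ ε ∈ Ioo 0 ε₂, ∀ t, 0 ≤ t → ‖Z ε t‖ ≤ R₀)
    (hbar : ∀ ε ∈ Ioo 0 ε₂, ∀ T, 0 ≤ T → IsSolution (idealField f g h α a ε) 0 T (bar ε))
    (hbar0 : ∀ ε ∈ Ioo 0 ε₂, ‖bar ε 0 - Z ε 0‖ ≤ r)
    (hrange : ∀ ε ∈ Ioo 0 ε₂, ∀ t, 0 ≤ t → ∀ X : E × Q, ‖X - bar ε t‖ ≤ ρ →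
      |idealFeedback g h α ε t X| ≤ um) :
    ∃ (R B ε₁ δ T₀ : ℝ) (m : ℕ) (K ρ' : ℝ), 0 < K ∧ 0 < B ∧ ∀ᶠ ε in 𝓝[>] 0,
      TrackingData um f g h α a Hb R B ε₁ r k lam R₀ δ T₀ m K ρ' ε (Z ε) (bar ε) := by
  have := FiniteDimensional.complete ℝ E
  have := FiniteDimensional.complete ℝ Q
  -- The constants form a chain free of circularity: `B` depends on the radius, `δ` and `T₀` on `B`,
  -- `m` on these, and `K` on all of them. Only then is `ε` taken small.
  obtain ⟨B, ε₁, hε₁, hL⟩ := exists_loopEstimates hum hf hg hh hα ha hHb (R₀ + |k| * r + 3)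
  have hB := hL.one_le
  obtain ⟨δ, T₀, hδ, hδr, hT₀, hcontr⟩ := exists_contraction_of_expStable (V := E × Q)
    r k lam B hr hlam hB
  obtain ⟨m, hm⟩ : ∃ m : ℕ, |k| * Real.exp (-lam * (m * T₀)) * r ≤ δ / 2 := by
    have h1 : Tendsto (fun m : ℕ => |k| * Real.exp (-lam * (m * T₀)) * r) atTop
        (𝓝 (|k| * 0 * r)) := by
      refine (Tendsto.const_mul _ (Real.tendsto_exp_atBot.comp ?_)).mul_const _
      have : Tendsto (fun m : ℕ => (m : ℝ) * (-lam * T₀)) atTop atBot :=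
        tendsto_natCast_atTop_atTop.atTop_mul_const_of_neg (by nlinarith)
      refine this.congr fun m => by ring
    rw [mul_zero, zero_mul] at h1
    exact ((h1.eventually_lt_const (half_pos hδ)).exists).imp fun m hm => hm.le
  obtain ⟨K, hK⟩ : ∃ K, K = 1 + 2 * (1001 * B ^ 8 * ((m + 1) * (2 * T₀)) *
    Real.exp (2 * B ^ 2 * ((m + 1) * (2 * T₀)))) := ⟨_, rfl⟩
  have hKpos : 0 < K := by rw [hK]; positivity
  have hρ' : 0 < min (ρ / 3) 1 := by positivity
  refine ⟨R₀ + |k| * r + 3, B, ε₁, δ, T₀, m, K, min (ρ / 3) 1, hKpos, by linarith, ?_⟩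
  filter_upwards [Ioo_mem_nhdsGT hε₁, Ioo_mem_nhdsGT hε₂, Ioo_mem_nhdsGT hT₀,
    eventually_mul_sq_lt K (half_pos hδ), eventually_mul_sq_lt K hρ',
    eventually_mul_lt (2 * B ^ 2) hρ', eventually_mul_lt (B ^ 2) (by linarith : 0 < 2 * um)]
    with ε h1 h2 h3 h4 h5 h6 h7
  have hε1 : ε ∈ Icc (0 : ℝ) 1 := ⟨h1.1.le, h1.2.le.trans hL.ε₁_le⟩
  have hreg := regularField_idealField (E := E) hf hg hh hα ha hε1
  exact
    { loop := hL
      hε := h1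
      regular := hreg
      stable := hZ ε h2
      lam_pos := hlam
      ref_bound := hZR ε h2
      radius := le_rfl
      δ_le := hδr
      T₀_pos := hT₀
      ε_le := h3.2.le
      contraction := hcontr _ _ R₀ (hZ ε h2) hreg ((regularField_of_estimates hL.field_continuous
        hL.field hε1).mono (by linarith)) (hZR ε h2)
      bar_sol := hbar ε h2
      bar_init := hbar0 ε h2
      hm := hm
      hK := by rw [hK]; linarith
      Kε_le := h4.le
      Kε_le_ρ := h5.le
      ρ_le := min_le_right _ _
      Bε_lt := h6
      Bε_le_um := h7.le
      range := fun t ht X hX => hrange ε h2 t ht X (hX.trans (by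
        have := min_le_left (ρ / 3) 1
        linarith)) }

end Tracking

/-! ### Lipschitz dependence of the measured feedback. -/

section MeasuredLipschitz

variable {E Q G : Type*} [NormedAddCommGroup E] [NormedSpace ℝ E]
  [NormedAddCommGroup Q] [NormedSpace ℝ Q] [NormedAddCommGroup G] [NormedSpace ℝ G]
  {um : ℝ} {f g : E → E} {h : E → ℝ} {α : Q → ℝ × ℝ → ℝ → ℝ}
  {a : Q → ℝ × ℝ → ℝ → Q} {Hb : ℝ → E → Q → ℝ → ℝ → ℝ × ℝ}

/-- Within a period, the feedback `φ` fed by the measured output is Lipschitz in state and time. -/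
def MeasuredLipschitz (um : ℝ) (g : E → E) (h : E → ℝ) (α : Q → ℝ × ℝ → ℝ → ℝ)
    (Hb : ℝ → E → Q → ℝ → ℝ → ℝ × ℝ) (φ : Q → ℝ × ℝ → ℝ → G) (R L ε : ℝ) : Prop :=
  ∀ (j : ℕ), ∀ θ ∈ Icc (0 : ℝ) 1, ∀ θ' ∈ Icc (0 : ℝ) 1, ∀ X X' : E × Q, ‖X‖ ≤ R - 1 →
    ‖X'‖ ≤ R - 1 → |idealFeedback g h α ε (j * ε + ε * θ') X'| ≤ um →
    ‖measuredFeedback Hb φ ε (j * ε + ε * θ) X - measuredFeedback Hb φ ε (j * ε + ε * θ') X'‖ ≤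
      L * (‖X - X'‖ + ε * |θ - θ'|)

/-- Only the duty cycle at `X'` has to be in range: the ripple is Lipschitz in the duty cycle
without restriction, so the change of `θ` can be made at `X'` alone. -/
theorem LoopEstimates.norm_correctedState_sub_le {R B ε₁ ε : ℝ}
    (hL : LoopEstimates um f g h α a Hb R B ε₁) (hε : ε ∈ Ioo 0 ε₁) (j : ℕ) {θ θ' : ℝ}
    (hθ : θ ∈ Icc (0 : ℝ) 1) (hθ' : θ' ∈ Icc (0 : ℝ) 1) {X X' : E × Q} (hX : ‖X‖ ≤ R - 1)
    (hX' : ‖X'‖ ≤ R - 1) (hu : |idealFeedback g h α ε (j * ε + ε * θ') X'| ≤ um) :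
    ‖correctedState um g h α ε (j * ε + ε * θ) X - correctedState um g h α ε (j * ε + ε * θ') X'‖ ≤
      6 * B ^ 2 * (‖X - X'‖ + ε * |θ - θ'|) := by
  have hB := hL.one_le
  have hε0 := hε.1
  have hε1 : ε ≤ 1 := hε.2.le.trans hL.ε₁_le
  obtain ⟨d, hd⟩ : ∃ d, d = ‖X - X'‖ + ε * |θ - θ'| := ⟨_, rfl⟩
  have hn := norm_nonneg (X - X')
  have hn' : 0 ≤ ε * |θ - θ'| := by positivity
  have hd0 : 0 ≤ d := by rw [hd]; positivity
  have ht : ∀ θ : ℝ, 0 ≤ θ → 0 ≤ j * ε + ε * θ := fun θ hθ => by positivity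
  have hdu := lip_time_of_estimates hL.duty (by linarith) ⟨hε0.le, hε1⟩ (ht θ hθ.1) (ht θ' hθ'.1)
    (by linarith : ‖X‖ ≤ R) (by linarith : ‖X'‖ ≤ R) (d := d) (by linarith) (by
      rw [add_sub_add_left_eq_sub, ← mul_sub, abs_mul, abs_of_pos hε0]; linarith)
  have td : ∀ θ : ℝ, (j * ε + ε * θ) / ε = j + θ := fun θ => by field_simp
  have hxm : ∀ {X : E × Q}, ‖X‖ ≤ R - 1 → X.1 ∈ Metric.closedBall (0 : E) R := fun {X} hX => by
    simpa using (norm_fst_le X).trans (by linarith)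
  have hg := hL.input.bound _ (hxm hX)
  have hgl := hL.input.lip _ (hxm hX) _ (hxm hX')
  have hfst : ‖X.1 - X'.1‖ ≤ d := (norm_fst_le (X - X')).trans (by linarith)
  have hsnd : ‖X.2 - X'.2‖ ≤ d := (norm_snd_le (X - X')).trans (by linarith)
  have hB2 : 1 ≤ B ^ 2 := one_le_pow₀ hB
  rw [← hd]
  simp only [correctedState, td, s1_add_natCast]
  set u := idealFeedback g h α ε (j * ε + ε * θ) X
  set u' := idealFeedback g h α ε (j * ε + ε * θ') X'
  refine norm_prod_le_iff.2 ⟨?_, ?_⟩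
  · simp only [Prod.fst_sub]
    have e : X.1 - (ε * s1 um u θ) • g X.1 - (X'.1 - (ε * s1 um u' θ') • g X'.1) =
        (X.1 - X'.1) + (-((ε * (s1 um u θ - s1 um u' θ)) • g X.1) -
          (ε * (s1 um u' θ - s1 um u' θ')) • g X.1 -
          (ε * s1 um u' θ') • (g X.1 - g X'.1)) := by module
    have s1' : |s1 um u θ - s1 um u' θ| ≤ B * d := (abs_s1_sub_le hL.um_pos u u' θ).trans hdu
    have s2 := abs_s1_sub_le_time hL.um_pos hu hθ hθ'
    have s3 := abs_s1_le_of_abs_le hL.um_pos hu θ'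
    have b1 : ‖-((ε * (s1 um u θ - s1 um u' θ)) • g X.1)‖ ≤ B ^ 2 * d := by
      rw [norm_neg, norm_smul, norm_mul, Real.norm_eq_abs, Real.norm_eq_abs, abs_of_pos hε0]
      calc ε * |s1 um u θ - s1 um u' θ| * ‖g X.1‖ ≤ 1 * (B * d) * B := by gcongr
        _ = _ := by ring
    have b2 : ‖(ε * (s1 um u' θ - s1 um u' θ')) • g X.1‖ ≤ 2 * B ^ 2 * d := by
      rw [norm_smul, norm_mul, Real.norm_eq_abs, Real.norm_eq_abs, abs_of_pos hε0]
      have := hL.um_pos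
      calc ε * |s1 um u' θ - s1 um u' θ'| * ‖g X.1‖ ≤ ε * (2 * um * |θ - θ'|) * B := by gcongr
        _ = 2 * um * (ε * |θ - θ'|) * B := by ring
        _ ≤ 2 * B * d * B := by
          have := hL.um_le
          have := hL.um_pos
          gcongr
          linarith
        _ = _ := by ring
    have b3 : ‖(ε * s1 um u' θ') • (g X.1 - g X'.1)‖ ≤ 2 * B ^ 2 * d := by
      rw [norm_smul, norm_mul, Real.norm_eq_abs, Real.norm_eq_abs, abs_of_pos hε0]
      calc ε * |s1 um u' θ'| * ‖g X.1 - g X'.1‖ ≤ 1 * (2 * B) * (B * d) := by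
            have := hL.um_le
            gcongr
            · linarith
            · exact hgl.trans (by gcongr)
        _ = _ := by ring
    rw [e]
    refine (norm_add_le_of_le hfst (norm_sub_le_of_le (norm_sub_le_of_le b1 b2) b3)).trans ?_
    nlinarith
  · simp only [Prod.snd_sub]
    nlinarith

open Filter Topology in
-- The phase varies by `|θ - θ'|`, without a factor `ε`. The `ε²` in the Lipschitz constant of the
-- remainder absorbs this, since `ε² |θ - θ'| ≤ ε |θ - θ'|`, so the duty cycle along a slow curve
-- still varies slowly in normalized time.
theorem exists_measuredLipschitz [FiniteDimensional ℝ E] [FiniteDimensional ℝ Q] {R B ε₁ : ℝ}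
    (hL : LoopEstimates um f g h α a Hb R B ε₁) (hε₁ : 0 < ε₁) (hg : ContDiff ℝ 2 g)
    (hh : ContDiff ℝ 3 h) {φ : Q → ℝ × ℝ → ℝ → G} (hφ : UniformC2 φ)
    (hHb : IsCorrectedOutput um g h α Hb) (hLip : LipschitzRemainder um g h α Hb) :
    ∃ L, 0 ≤ L ∧ ∀ᶠ ε in 𝓝[>] 0, MeasuredLipschitz um g h α Hb φ R L ε := by
  have := FiniteDimensional.proper ℝ E
  have := FiniteDimensional.proper ℝ Q
  obtain ⟨B₇, h₇⟩ := (c2BoundedOn_extOutput (Q := Q) hg hh R).exists_estimates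
    (convex_loopDomain _ R)
  have hconv : Convex ℝ {z : Q × (ℝ × ℝ) × ℝ | ‖z.1‖ ≤ max R (B₇ + 1) ∧
      ‖z.2.1‖ ≤ max R (B₇ + 1) ∧ 0 ≤ z.2.2} := by
    have e : {z : Q × (ℝ × ℝ) × ℝ | ‖z.1‖ ≤ max R (B₇ + 1) ∧
      ‖z.2.1‖ ≤ max R (B₇ + 1) ∧ 0 ≤ z.2.2} = Metric.closedBall 0 (max R (B₇ + 1)) ×ˢ
        (Metric.closedBall 0 (max R (B₇ + 1)) ×ˢ Ici (0 : ℝ)) := by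
      ext z; simp
    rw [e]
    exact (convex_closedBall _ _).prod ((convex_closedBall _ _).prod (convex_Ici _))
  obtain ⟨B₈, h₈⟩ := (hφ.c2BoundedOn (max R (B₇ + 1))).exists_estimates hconv
  obtain ⟨C, ε₂, hε₂, hC⟩ := hHb (Metric.closedBall 0 (R - 1)) (isCompact_closedBall _ _)
  obtain ⟨C', ε₃, hε₃, hC'⟩ := hLip (Metric.closedBall 0 (R - 1)) (isCompact_closedBall _ _)
  have hB := hL.one_le
  refine ⟨|B₈| * (1 + |B₇| * (6 * B ^ 2) + 2 * |C'|), by positivity, ?_⟩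
  filter_upwards [Ioo_mem_nhdsGT hε₁, Ioo_mem_nhdsGT hε₂, Ioo_mem_nhdsGT hε₃,
    eventually_mul_sq_lt C one_pos] with ε h1 h2 h3 h4
  intro j θ hθ θ' hθ' X X' hX hX' hu
  have hε0 := h1.1
  have hε1 : ε ≤ 1 := h1.2.le.trans hL.ε₁_le
  have ht : ∀ θ : ℝ, 0 ≤ θ → 0 ≤ j * ε + ε * θ := fun θ hθ => by positivity
  have td : ∀ θ : ℝ, (j * ε + ε * θ) / ε = j + θ := fun θ => by field_simp
  have key : ∀ θ ∈ Icc (0 : ℝ) 1, ∀ X : E × Q, ‖X‖ ≤ R - 1 →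
      ‖X.2‖ ≤ max R (B₇ + 1) ∧
      ‖Hb ε X.1 X.2 ((j * ε + ε * θ) / ε) (j * ε + ε * θ)‖ ≤ max R (B₇ + 1) := by
    intro θ hθ X hX
    have hc := hC ε h2 X (by simpa using hX) ((j * ε + ε * θ) / ε) _ (ht θ hθ.1)
    have hH := h₇.bound (correctedState um g h α ε (j * ε + ε * θ) X, j * ε + ε * θ, ε)
      ⟨hL.corrected ε h1 _ (ht θ hθ.1) X hX, ht θ hθ.1, hε0.le, hε1⟩
    have := norm_add_le_of_le hc hH
    simp only [correctedOutput, correctedState, idealFeedback, sub_add_cancel] at this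
    exact ⟨((norm_snd_le X).trans (by linarith)).trans (le_max_left _ _),
      (by linarith : _ ≤ B₇ + 1).trans (le_max_right _ _)⟩
  obtain ⟨k1, k2⟩ := key θ hθ X hX
  obtain ⟨k1', k2'⟩ := key θ' hθ' X' hX'
  obtain ⟨d, hd⟩ : ∃ d, d = ‖X - X'‖ + ε * |θ - θ'| := ⟨_, rfl⟩
  have hn := norm_nonneg (X - X')
  have hn' : 0 ≤ ε * |θ - θ'| := by positivity
  have hd0 : 0 ≤ d := by rw [hd]; positivity
  have hcs := hL.norm_correctedState_sub_le h1 j hθ hθ' hX hX' hu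
  have ho := h₇.lip (correctedState um g h α ε (j * ε + ε * θ) X, 0, ε)
    ⟨hL.corrected ε h1 _ (ht θ hθ.1) X hX, le_rfl, hε0.le, hε1⟩
    (correctedState um g h α ε (j * ε + ε * θ') X', 0, ε)
    ⟨hL.corrected ε h1 _ (ht θ' hθ'.1) X' hX', le_rfl, hε0.le, hε1⟩
  have hr := hC' ε h3 X (by simpa using hX) X' (by simpa using hX') ((j * ε + ε * θ) / ε)
    ((j * ε + ε * θ') / ε) _ _ (ht θ hθ.1) (ht θ' hθ'.1)
  have hdt : |j * ε + ε * θ - (j * ε + ε * θ')| = ε * |θ - θ'| := by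
    rw [add_sub_add_left_eq_sub, ← mul_sub, abs_mul, abs_of_pos hε0]
  have hdσ : |(j * ε + ε * θ) / ε - (j * ε + ε * θ') / ε| = |θ - θ'| := by
    rw [td, td, add_sub_add_left_eq_sub]
  rw [hdt, hdσ] at hr
  have hr' : C' * ε ^ 2 * (‖X - X'‖ + |θ - θ'| + ε * |θ - θ'|) ≤ 2 * |C'| * d := by
    have e1 : ε ^ 2 ≤ 1 := pow_le_one₀ hε0.le hε1
    have e2 : ε ^ 2 * |θ - θ'| ≤ ε * |θ - θ'| := by
      gcongr; nlinarith
    calc C' * ε ^ 2 * (‖X - X'‖ + |θ - θ'| + ε * |θ - θ'|)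
        ≤ |C'| * ε ^ 2 * (‖X - X'‖ + |θ - θ'| + ε * |θ - θ'|) := by gcongr; exact le_abs_self _
      _ = |C'| * (ε ^ 2 * ‖X - X'‖ + ε ^ 2 * |θ - θ'| + ε ^ 2 * (ε * |θ - θ'|)) := by ring
      _ ≤ |C'| * (1 * ‖X - X'‖ + ε * |θ - θ'| + 1 * (ε * |θ - θ'|)) := by gcongr
      _ ≤ |C'| * (2 * d) := by gcongr; linarith
      _ = _ := by ring
  have ho' : ‖extOutput g h ε (correctedState um g h α ε (j * ε + ε * θ) X).1 -
      extOutput g h ε (correctedState um g h α ε (j * ε + ε * θ') X').1‖ ≤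
        |B₇| * (6 * B ^ 2 * d) := by
    refine ho.trans ?_
    have e : ∀ u v : E × Q, ‖((u, 0, ε) : (E × Q) × ℝ × ℝ) - (v, 0, ε)‖ = ‖u - v‖ :=
      fun u v => by simp [Prod.norm_def]
    rw [e]
    exact mul_le_mul (le_abs_self _) (by rw [hd]; exact hcs) (norm_nonneg _) (abs_nonneg _)
  have hH : ‖Hb ε X.1 X.2 ((j * ε + ε * θ) / ε) (j * ε + ε * θ) -
      Hb ε X'.1 X'.2 ((j * ε + ε * θ') / ε) (j * ε + ε * θ')‖ ≤
        |B₇| * (6 * B ^ 2 * d) + 2 * |C'| * d := by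
    have := norm_add_le_of_le ho' (hr.trans hr')
    refine le_of_eq_of_le (congrArg norm ?_) this
    simp only [correctedOutput, correctedState, idealFeedback]
    abel
  rw [← hd]
  have hfin := h₈.lip (X.2, Hb ε X.1 X.2 ((j * ε + ε * θ) / ε) (j * ε + ε * θ), j * ε + ε * θ)
    ⟨k1, k2, ht θ hθ.1⟩
    (X'.2, Hb ε X'.1 X'.2 ((j * ε + ε * θ') / ε) (j * ε + ε * θ'), j * ε + ε * θ')
    ⟨k1', k2', ht θ' hθ'.1⟩
  refine hfin.trans ?_
  rw [mul_assoc]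
  refine mul_le_mul (le_abs_self _) ?_ (norm_nonneg _) (abs_nonneg _)
  have p1 : 0 ≤ |B₇| * (6 * B ^ 2 * d) := by positivity
  have p2 : 0 ≤ 2 * |C'| * d := by positivity
  have p3 : (1 + |B₇| * (6 * B ^ 2) + 2 * |C'|) * d =
    d + |B₇| * (6 * B ^ 2 * d) + 2 * |C'| * d := by ring
  rw [p3]
  refine norm_prod_le_iff.2 ⟨?_, norm_prod_le_iff.2 ⟨hH.trans (by linarith), ?_⟩⟩
  · exact (norm_snd_le (X - X')).trans (by linarith)
  · change |j * ε + ε * θ - (j * ε + ε * θ')| ≤ _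
    rw [hdt]; linarith

end MeasuredLipschitz

/-! ### Existence and uniqueness over one period. -/

section WellPosed

variable {E Q G : Type*} [NormedAddCommGroup E] [NormedSpace ℝ E]
  [NormedAddCommGroup Q] [NormedSpace ℝ Q] [NormedAddCommGroup G]
  {um : ℝ} {f g : E → E} {h : E → ℝ} {α : Q → ℝ × ℝ → ℝ → ℝ}
  {a : Q → ℝ × ℝ → ℝ → Q} {Hb : ℝ → E → Q → ℝ → ℝ → ℝ × ℝ}

/-- Conditions under which the integral operator of the PWM-fed loop is a contraction, over the
period number `j`, on the curves of speed at most `2 * B ^ 2 * ε` starting at `p`. -/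
structure PicardData (um : ℝ) (f g : E → E) (h : E → ℝ) (α : Q → ℝ × ℝ → ℝ → ℝ)
    (a : Q → ℝ × ℝ → ℝ → Q) (Hb : ℝ → E → Q → ℝ → ℝ → ℝ × ℝ) (R B ε₁ ρ L ε : ℝ) (j : ℕ)
    (p : E × Q) : Prop where
  loop : LoopEstimates um f g h α a Hb R B ε₁
  hε : ε ∈ Ioo 0 ε₁
  L_nonneg : 0 ≤ L
  duty : MeasuredLipschitz um g h α Hb α R L ε
  ctrl : MeasuredLipschitz um g h α Hb a R L ε
  slope : L * (2 * B ^ 2 + 1) * ε ≤ 2 * um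
  contraction : (2 * B ^ 2 + L + 8 * B ^ 3 * L) * ε ≤ 1 / 2
  small : 2 * B ^ 2 * ε < ρ
  hρ : ρ ≤ 1
  norm_init : ‖p‖ ≤ R - 2
  range : ∀ X : E × Q, ‖X - p‖ ≤ ρ → ∀ θ ∈ Icc (0 : ℝ) 1,
    |idealFeedback g h α ε (j * ε + ε * θ) X| ≤ um

/-- Curves of speed at most `S` starting at `p`. -/
structure SlowCurve {V : Type*} [NormedAddCommGroup V] (S c : ℝ) (p : V) (Z : ℝ → V) : Prop where
  init : Z 0 = p
  lip : ∀ θ ∈ Icc 0 c, ∀ θ' ∈ Icc 0 c, ‖Z θ - Z θ'‖ ≤ S * |θ - θ'|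

theorem continuousOn_of_norm_sub_le {V : Type*} [NormedAddCommGroup V] {S : ℝ} (hS : 0 ≤ S)
    {A : Set ℝ} {Z : ℝ → V} (h : ∀ θ ∈ A, ∀ θ' ∈ A, ‖Z θ - Z θ'‖ ≤ S * |θ - θ'|) :
    ContinuousOn Z A := by
  have : LipschitzOnWith S.toNNReal Z A := LipschitzOnWith.of_dist_le_mul fun x hx y hy => by
    rw [dist_eq_norm, Real.dist_eq, Real.coe_toNNReal _ hS]
    exact h x hx y hy
  exact this.continuousOn

namespace PicardData

variable {R B ε₁ ρ L ε c : ℝ} {j : ℕ} {p : E × Q} {Z Z' : ℝ → E × Q}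

section
variable (P : PicardData um f g h α a Hb R B ε₁ ρ L ε j p)
include P

theorem norm_sub_init_le (hc : c ≤ 1) (hZ : SlowCurve (2 * B ^ 2 * ε) c p Z) {θ : ℝ}
    (hθ : θ ∈ Icc 0 c) : ‖Z θ - p‖ ≤ ρ := by
  have h1 := hZ.lip θ hθ 0 ⟨le_rfl, hθ.1.trans hθ.2⟩
  rw [hZ.init, sub_zero, abs_of_nonneg hθ.1] at h1
  have hε := P.hε.1
  have : 2 * B ^ 2 * ε * θ ≤ 2 * B ^ 2 * ε :=
    mul_le_of_le_one_right (by positivity) (hθ.2.trans hc)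
  linarith [P.small]

theorem norm_le (hc : c ≤ 1) (hZ : SlowCurve (2 * B ^ 2 * ε) c p Z) {θ : ℝ}
    (hθ : θ ∈ Icc 0 c) : ‖Z θ‖ ≤ R - 1 := by
  have := norm_add_le (Z θ - p) p
  rw [sub_add_cancel] at this
  linarith [P.norm_sub_init_le hc hZ hθ, P.norm_init, P.hρ]

theorem fst_mem (hc : c ≤ 1) (hZ : SlowCurve (2 * B ^ 2 * ε) c p Z) {θ : ℝ}
    (hθ : θ ∈ Icc 0 c) : (Z θ).1 ∈ Metric.closedBall (0 : E) R := by
  simpa using (norm_fst_le (Z θ)).trans (by linarith [P.norm_le hc hZ hθ])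

theorem abs_duty_le (hc : c ≤ 1) (hZ : SlowCurve (2 * B ^ 2 * ε) c p Z) {θ : ℝ}
    (hθ : θ ∈ Icc 0 c) : |idealFeedback g h α ε (j * ε + ε * θ) (Z θ)| ≤ um :=
  P.range _ (P.norm_sub_init_le hc hZ hθ) θ ⟨hθ.1, hθ.2.trans hc⟩

theorem continuousOn_curve (hZ : SlowCurve (2 * B ^ 2 * ε) c p Z) : ContinuousOn Z (Icc 0 c) :=
  continuousOn_of_norm_sub_le (by have := P.hε.1; positivity) hZ.lip

theorem measured_lip {φ : Q → ℝ × ℝ → ℝ → G} (hφ : MeasuredLipschitz um g h α Hb φ R L ε)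
    (hc : c ≤ 1) (hZ : SlowCurve (2 * B ^ 2 * ε) c p Z) {θ θ' : ℝ} (hθ : θ ∈ Icc 0 c)
    (hθ' : θ' ∈ Icc 0 c) :
    ‖measuredFeedback Hb φ ε (j * ε + ε * θ) (Z θ) -
      measuredFeedback Hb φ ε (j * ε + ε * θ') (Z θ')‖ ≤ L * (2 * B ^ 2 + 1) * ε * |θ - θ'| := by
  refine (hφ j θ ⟨hθ.1, hθ.2.trans hc⟩ θ' ⟨hθ'.1, hθ'.2.trans hc⟩ _ _ (P.norm_le hc hZ hθ)
    (P.norm_le hc hZ hθ') (P.abs_duty_le hc hZ hθ')).trans ?_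
  have := mul_le_mul_of_nonneg_left (hZ.lip θ hθ θ' hθ') P.L_nonneg
  linarith

theorem norm_measured_sub_le {φ : Q → ℝ × ℝ → ℝ → G}
    (hφ : MeasuredLipschitz um g h α Hb φ R L ε) (hc : c ≤ 1)
    (hZ : SlowCurve (2 * B ^ 2 * ε) c p Z) (hZ' : SlowCurve (2 * B ^ 2 * ε) c p Z') {θ d : ℝ}
    (hθ : θ ∈ Icc 0 c) (hd : ‖Z θ - Z' θ‖ ≤ d) :
    ‖measuredFeedback Hb φ ε (j * ε + ε * θ) (Z θ) -
      measuredFeedback Hb φ ε (j * ε + ε * θ) (Z' θ)‖ ≤ L * d := by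
  refine (hφ j θ ⟨hθ.1, hθ.2.trans hc⟩ θ ⟨hθ.1, hθ.2.trans hc⟩ _ _ (P.norm_le hc hZ hθ)
    (P.norm_le hc hZ' hθ) (P.abs_duty_le hc hZ' hθ)).trans ?_
  rw [sub_self, abs_zero, mul_zero, add_zero]
  exact mul_le_mul_of_nonneg_left hd P.L_nonneg

theorem continuousOn_measured {φ : Q → ℝ × ℝ → ℝ → G}
    (hφ : MeasuredLipschitz um g h α Hb φ R L ε) (hc : c ≤ 1)
    (hZ : SlowCurve (2 * B ^ 2 * ε) c p Z) :
    ContinuousOn (fun θ => measuredFeedback Hb φ ε (j * ε + ε * θ) (Z θ)) (Icc 0 c) :=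
  continuousOn_of_norm_sub_le (by have := P.hε.1; have := P.L_nonneg; positivity)
    fun _ hθ _ hθ' => P.measured_lip hφ hc hZ hθ hθ'

theorem pwmField_eq (θ : ℝ) (X : E × Q) :
    pwmField um f g α a Hb ε (j * ε + ε * θ) X =
      (f X.1 + pwm um (measuredFeedback Hb α ε (j * ε + ε * θ) X) θ • g X.1,
        measuredFeedback Hb a ε (j * ε + ε * θ) X) := by
  have h1 : (j * ε + ε * θ) / ε = j + θ := by
    have := P.hε.1.ne'
    field_simp
  have := pwm_add_natCast um (measuredFeedback Hb α ε (j * ε + ε * θ) X) θ j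
  rw [← this, ← h1]
  rfl

theorem intervalIntegrable_pwmField (hf : Continuous f) (hg : Continuous g) (hc0 : 0 ≤ c)
    (hc : c ≤ 1) (hZ : SlowCurve (2 * B ^ 2 * ε) c p Z) :
    IntervalIntegrable (fun θ => pwmField um f g α a Hb ε (j * ε + ε * θ) (Z θ)) volume 0 c := by
  have hum := P.loop.um_pos
  set υ : ℝ → ℝ := fun θ => measuredFeedback Hb α ε (j * ε + ε * θ) (Z θ) with hυ
  have hυc : ContinuousOn υ (Icc 0 c) := P.continuousOn_measured P.duty hc hZ
  -- The duty cycle is controlled only on `[0, c]`; its continuous extension by the endpoint values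
  -- is measurable on the whole line.
  have hυm : Measurable (IccExtend hc0 ((Icc 0 c).domRestrict υ)) :=
    (continuousOn_iff_continuous_domRestrict.1 hυc).Icc_extend'.measurable
  have h1 := intervalIntegrable_pwm_comp hum hυm 0 c
  have hZc := P.continuousOn_curve hZ
  have h2 : ContinuousOn (fun θ => g (Z θ).1) (uIcc 0 c) := by
    rw [uIcc_of_le hc0]; exact hg.comp_continuousOn hZc.fst
  have h3 : ContinuousOn (fun θ => f (Z θ).1) (uIcc 0 c) := by
    rw [uIcc_of_le hc0]; exact hf.comp_continuousOn hZc.fst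
  have h4 : ContinuousOn (fun θ => measuredFeedback Hb a ε (j * ε + ε * θ) (Z θ)) (uIcc 0 c) := by
    rw [uIcc_of_le hc0]; exact P.continuousOn_measured P.ctrl hc hZ
  have h5 := h3.intervalIntegrable.add (h1.smul_continuousOn h2)
  have h6 : IntervalIntegrable (fun θ => ((f (Z θ).1 +
      pwm um (IccExtend hc0 ((Icc 0 c).domRestrict υ) θ) θ • g (Z θ).1 : E),
      measuredFeedback Hb a ε (j * ε + ε * θ) (Z θ))) volume 0 c :=
    ⟨h5.1.prodMk h4.intervalIntegrable.1, h5.2.prodMk h4.intervalIntegrable.2⟩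
  refine h6.congr fun θ hθ => ?_
  rw [uIoc_of_le hc0] at hθ
  rw [P.pwmField_eq, IccExtend_of_mem _ _ (Ioc_subset_Icc_self hθ)]
  rfl

/-- The integral operator of the PWM-fed loop is a contraction for the uniform distance. -/
theorem norm_integral_sub_le (hZ : SlowCurve (2 * B ^ 2 * ε) c p Z)
    (hZ' : SlowCurve (2 * B ^ 2 * ε) c p Z') (hc : c ≤ 1)
    (hi : IntervalIntegrable (fun θ => ε • pwmField um f g α a Hb ε (j * ε + ε * θ) (Z θ))
      volume 0 c)
    (hi' : IntervalIntegrable (fun θ => ε • pwmField um f g α a Hb ε (j * ε + ε * θ) (Z' θ))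
      volume 0 c) {d : ℝ} (hd : ∀ θ ∈ Icc 0 c, ‖Z θ - Z' θ‖ ≤ d) {θ : ℝ} (hθ : θ ∈ Icc 0 c) :
    ‖(∫ σ in (0 : ℝ)..θ, ε • pwmField um f g α a Hb ε (j * ε + ε * σ) (Z σ)) -
      ∫ σ in (0 : ℝ)..θ, ε • pwmField um f g α a Hb ε (j * ε + ε * σ) (Z' σ)‖ ≤ 1 / 2 * d := by
  have hB := P.loop.one_le
  have hum := P.loop.um_pos
  have hε := P.hε.1
  have hL := P.L_nonneg
  have hd0 : 0 ≤ d := (norm_nonneg _).trans (hd θ hθ)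
  -- Along a slow curve the duty cycle has slope at most `2 um`. Passing from `Z'` to `Z` perturbs
  -- it by at most `L d`, hence alters the output on a set of measure at most `4 L d / um`. This is
  -- linear in `d`, so the integral operator is Lipschitz although the field is discontinuous.
  obtain ⟨S, hS, hSv, hSf, hSd⟩ := exists_pwm_disagreement hum
    (υ := fun θ => measuredFeedback Hb α ε (j * ε + ε * θ) (Z' θ)) hc
    (fun θ hθ θ' hθ' => (P.measured_lip P.duty hc hZ' hθ hθ').trans
      (mul_le_mul_of_nonneg_right P.slope (abs_nonneg _)))
    (D := L * d) (by positivity)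
  have hsub : uIcc 0 θ ⊆ uIcc 0 c := by
    rw [uIcc_of_le hθ.1, uIcc_of_le (hθ.1.trans hθ.2)]
    exact Icc_subset_Icc_right hθ.2
  have key := norm_integral_sub_le_of_indicator (S := S) (S' := ∅) (b₃ := 0)
    (b₁ := ε * ((2 * B ^ 2 + L) * d)) (b₂ := ε * (2 * B ^ 2)) ⟨hθ.1, hθ.2.trans hc⟩
    (hi.mono_set hsub) (hi'.mono_set hsub) hS hSf MeasurableSet.empty (by simp) (by positivity)
    (by positivity) le_rfl (fun σ hσ => by
      have hσ' : σ ∈ Icc 0 c := ⟨hσ.1, hσ.2.trans hθ.2⟩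
      rw [zero_mul, add_zero, ← smul_sub, norm_smul, Real.norm_eq_abs, abs_of_pos hε, mul_assoc,
        ← mul_add]
      refine mul_le_mul_of_nonneg_left ?_ hε.le
      have hI : 0 ≤ S.indicator (1 : ℝ → ℝ) σ := indicator_nonneg (fun _ _ => zero_le_one) _
      have hx := P.fst_mem hc hZ hσ'
      have hx' := P.fst_mem hc hZ' hσ'
      have hdx : ‖(Z σ).1 - (Z' σ).1‖ ≤ d := (norm_fst_le (Z σ - Z' σ)).trans (hd σ hσ')
      have f1 : ‖f (Z σ).1 - f (Z' σ).1‖ ≤ B * d :=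
        (P.loop.drift.lip _ hx _ hx').trans (by gcongr)
      have g1 : ‖g (Z σ).1 - g (Z' σ).1‖ ≤ B * d :=
        (P.loop.input.lip _ hx _ hx').trans (by gcongr)
      have g0 := P.loop.input.bound _ hx'
      rw [P.pwmField_eq, P.pwmField_eq]
      have hpw := abs_pwm_sub_le_indicator hum (S := S) (θ := σ)
        (hSd σ hσ' (measuredFeedback Hb α ε (j * ε + ε * σ) (Z σ))
          (P.norm_measured_sub_le P.duty hc hZ hZ' hσ' (hd σ hσ')))
      set v := measuredFeedback Hb α ε (j * ε + ε * σ) (Z σ)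
      set v' := measuredFeedback Hb α ε (j * ε + ε * σ) (Z' σ)
      refine norm_prod_le_iff.2 ⟨?_, ?_⟩
      · simp only [Prod.fst_sub]
        have e : f (Z σ).1 + pwm um v σ • g (Z σ).1 - (f (Z' σ).1 + pwm um v' σ • g (Z' σ).1) =
            (f (Z σ).1 - f (Z' σ).1) + (pwm um v σ • (g (Z σ).1 - g (Z' σ).1) +
              (pwm um v σ - pwm um v' σ) • g (Z' σ).1) := by module
        have b1 : ‖pwm um v σ • (g (Z σ).1 - g (Z' σ).1)‖ ≤ B * (B * d) := by
          rw [norm_smul, Real.norm_eq_abs, abs_pwm hum]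
          have := P.loop.um_le
          gcongr
        have b2 : ‖(pwm um v σ - pwm um v' σ) • g (Z' σ).1‖ ≤ 2 * B * S.indicator 1 σ * B := by
          rw [norm_smul, Real.norm_eq_abs]
          have := P.loop.um_le
          refine mul_le_mul (hpw.trans ?_) g0 (norm_nonneg _) (by positivity)
          gcongr
        rw [e]
        refine (norm_add_le_of_le f1 (norm_add_le_of_le b1 b2)).trans ?_
        have q1 : B * d ≤ B ^ 2 * d := by gcongr; exact le_self_pow₀ hB (by norm_num)
        have q2 : 0 ≤ L * d := by positivity
        linarith
      · simp only [Prod.snd_sub]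
        refine (P.norm_measured_sub_le P.ctrl hc hZ hZ' hσ' (hd σ hσ')).trans ?_
        have q1 : 0 ≤ B ^ 2 * d := by positivity
        have q2 : 0 ≤ B ^ 2 * S.indicator (1 : ℝ → ℝ) σ := by positivity
        linarith)
  refine key.trans ?_
  rw [zero_mul, add_zero]
  have h1 : 4 * (L * d / um) ≤ 4 * (L * d * B) := by
    rw [div_eq_mul_inv]
    have := P.loop.inv_um_le
    gcongr
  calc ε * ((2 * B ^ 2 + L) * d) + ε * (2 * B ^ 2) * volume.real S
      ≤ ε * ((2 * B ^ 2 + L) * d) + ε * (2 * B ^ 2) * (4 * (L * d * B)) := by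
        gcongr; exact hSv.trans h1
    _ = (2 * B ^ 2 + L + 8 * B ^ 3 * L) * ε * d := by ring
    _ ≤ 1 / 2 * d := by gcongr; exact P.contraction

theorem norm_integral_le (hc : c ≤ 1) (hZ : SlowCurve (2 * B ^ 2 * ε) c p Z) {θ θ' : ℝ}
    (hθ : θ ∈ Icc 0 c) (hθ' : θ' ∈ Icc 0 c) :
    ‖∫ σ in θ'..θ, ε • pwmField um f g α a Hb ε (j * ε + ε * σ) (Z σ)‖ ≤
      2 * B ^ 2 * ε * |θ - θ'| := by
  have hε := P.hε.1
  refine intervalIntegral.norm_integral_le_of_norm_le_const fun σ hσ => ?_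
  have hσ' : σ ∈ Icc 0 c := uIcc_subset_Icc hθ' hθ (uIoc_subset_uIcc hσ)
  rw [norm_smul, Real.norm_eq_abs, abs_of_pos hε, mul_comm]
  exact mul_le_mul_of_nonneg_right (P.loop.norm_pwmField_le P.hε
    (add_nonneg (by positivity) (mul_nonneg hε.le hσ'.1)) (P.norm_le hc hZ hσ')) hε.le

/-- Every solution belongs to the class of curves on which the operator contracts, so uniqueness
holds among all solutions. -/
theorem slowCurve_of_isSolution (hc : c ≤ 1)
    (hZ : IsSolution (fun θ X => ε • pwmField um f g α a Hb ε (j * ε + ε * θ) X) 0 c Z)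
    (h0 : Z 0 = p) : SlowCurve (2 * B ^ 2 * ε) c p Z := by
  have hε := P.hε.1
  refine ⟨h0, fun θ hθ θ' hθ' => ?_⟩
  have hc0 : 0 ≤ c := hθ.1.trans hθ.2
  have hP : PeriodSolution um f g h α a Hb R B ε₁ ρ ε j c Z :=
    { hε := P.hε
      small := P.small
      hρ := P.hρ
      norm_init := by rw [h0]; exact P.norm_init
      hc := ⟨hc0, hc⟩
      sol := hZ
      range := by rw [h0]; exact P.range }
  have hi := (hZ.mono le_rfl hθ.1 hθ.2).1
  have hi' := (hZ.mono le_rfl hθ'.1 hθ'.2).1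
  rw [hZ.2 θ hθ, hZ.2 θ' hθ', add_sub_add_left_eq_sub,
    intervalIntegral.integral_interval_sub_left hi hi']
  refine intervalIntegral.norm_integral_le_of_norm_le_const fun σ hσ => ?_
  have hσ' : σ ∈ Icc 0 c := uIcc_subset_Icc hθ' hθ (uIoc_subset_uIcc hσ)
  rw [norm_smul, Real.norm_eq_abs, abs_of_pos hε, mul_comm]
  exact mul_le_mul_of_nonneg_right (P.loop.norm_pwmField_le P.hε
    (hP.time_nonneg hσ'.1) (hP.norm_le P.loop hσ')) hε.le

/-- The maximal distance between two solutions is at most half of itself. -/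
theorem eqOn_of_isSolution (hc0 : 0 ≤ c) (hc : c ≤ 1)
    (hZ : IsSolution (fun θ X => ε • pwmField um f g α a Hb ε (j * ε + ε * θ) X) 0 c Z)
    (hZ' : IsSolution (fun θ X => ε • pwmField um f g α a Hb ε (j * ε + ε * θ) X) 0 c Z')
    (h0 : Z 0 = p) (h0' : Z' 0 = p) : EqOn Z Z' (Icc 0 c) := by
  have s := P.slowCurve_of_isSolution hc hZ h0
  have s' := P.slowCurve_of_isSolution hc hZ' h0'
  obtain ⟨m, hm, hmax⟩ := isCompact_Icc.exists_isMaxOn (nonempty_Icc.2 hc0)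
    ((hZ.continuousOn hc0).sub (hZ'.continuousOn hc0)).norm
  have hd : ∀ θ ∈ Icc 0 c, ‖Z θ - Z' θ‖ ≤ ‖Z m - Z' m‖ := fun θ hθ => hmax hθ
  have h1 := P.norm_integral_sub_le s s' hc hZ.1 hZ'.1 hd hm
  have h2 : Z m - Z' m = (∫ σ in (0 : ℝ)..m, ε • pwmField um f g α a Hb ε (j * ε + ε * σ) (Z σ)) -
      ∫ σ in (0 : ℝ)..m, ε • pwmField um f g α a Hb ε (j * ε + ε * σ) (Z' σ) := by
    rw [hZ.2 m hm, hZ'.2 m hm, h0, h0', add_sub_add_left_eq_sub]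
  rw [← h2] at h1
  intro θ hθ
  have h3 := hd θ hθ
  have h4 := norm_nonneg (Z θ - Z' θ)
  exact sub_eq_zero.1 (norm_le_zero_iff.1 (by linarith))

/-- Existence over a period, by the contraction principle. -/
theorem exists_isSolution [CompleteSpace E] [CompleteSpace Q] (hf : Continuous f)
    (hg : Continuous g) :
    ∃ Z : ℝ → E × Q, Z 0 = p ∧
      IsSolution (fun θ X => ε • pwmField um f g α a Hb ε (j * ε + ε * θ) X) 0 1 Z := by
  have hε := P.hε.1
  have h01 : (0 : ℝ) ≤ 1 := zero_le_one
  let F : ℝ → E × Q → E × Q := fun θ X => ε • pwmField um f g α a Hb ε (j * ε + ε * θ) X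
  -- Slow curves are cut out by pointwise closed conditions, so they form a complete metric space
  -- for the uniform distance. Extension by endpoint values turns its elements into functions on the
  -- line.
  let A : Set C(Icc (0 : ℝ) 1, E × Q) :=
    {z | SlowCurve (2 * B ^ 2 * ε) 1 p (IccExtend h01 z)}
  have hA : A = {z : C(Icc (0 : ℝ) 1, E × Q) | z ⟨0, le_rfl, h01⟩ = p} ∩
      ⋂ θ : Icc (0 : ℝ) 1, ⋂ θ' : Icc (0 : ℝ) 1,
        {z | ‖z θ - z θ'‖ ≤ 2 * B ^ 2 * ε * |(θ : ℝ) - θ'|} := by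
    ext z
    simp only [mem_inter_iff, mem_iInter]
    constructor
    · intro hz
      refine ⟨?_, fun θ θ' => ?_⟩
      · have := hz.init
        rwa [IccExtend_of_mem h01 z ⟨le_rfl, h01⟩] at this
      · have := hz.lip θ θ.2 θ' θ'.2
        rwa [IccExtend_val, IccExtend_val] at this
    · rintro ⟨h1, h2⟩
      refine ⟨?_, fun θ hθ θ' hθ' => ?_⟩
      · rw [IccExtend_of_mem h01 z ⟨le_rfl, h01⟩]; exact h1
      · rw [IccExtend_of_mem h01 z hθ, IccExtend_of_mem h01 z hθ']
        exact h2 ⟨θ, hθ⟩ ⟨θ', hθ'⟩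
  have hclosed : IsClosed A := by
    rw [hA]
    refine IsClosed.inter (isClosed_eq (by fun_prop) continuous_const) ?_
    exact isClosed_iInter fun θ => isClosed_iInter fun θ' =>
      isClosed_le (by fun_prop) continuous_const
  have hint : ∀ z ∈ A, IntervalIntegrable (fun θ => F θ (IccExtend h01 z θ)) volume 0 1 :=
    fun z hz => (P.intervalIntegrable_pwmField hf hg h01 le_rfl hz).smul ε
  have hlip : ∀ z ∈ A, ∀ θ ∈ Icc (0 : ℝ) 1, ∀ θ' ∈ Icc (0 : ℝ) 1,
      ‖(p + ∫ σ in (0 : ℝ)..θ, F σ (IccExtend h01 z σ)) -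
        (p + ∫ σ in (0 : ℝ)..θ', F σ (IccExtend h01 z σ))‖ ≤ 2 * B ^ 2 * ε * |θ - θ'| := by
    intro z hz θ hθ θ' hθ'
    have hs : ∀ τ ∈ Icc (0 : ℝ) 1,
        IntervalIntegrable (fun θ => F θ (IccExtend h01 z θ)) volume 0 τ := fun τ hτ =>
      (hint z hz).mono_set (by
        rw [uIcc_of_le hτ.1, uIcc_of_le h01]; exact Icc_subset_Icc_right hτ.2)
    rw [add_sub_add_left_eq_sub,
      intervalIntegral.integral_interval_sub_left (hs θ hθ) (hs θ' hθ')]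
    exact P.norm_integral_le le_rfl hz hθ hθ'
  let Φ : A → A := fun z => ⟨⟨fun θ => p + ∫ σ in (0 : ℝ)..θ, F σ (IccExtend h01 z.1 σ), by
      have := continuousOn_of_norm_sub_le (by positivity) (hlip z.1 z.2)
      exact continuousOn_iff_continuous_domRestrict.1 this⟩, by
    refine ⟨?_, fun θ hθ θ' hθ' => ?_⟩
    · rw [IccExtend_of_mem h01 _ ⟨le_rfl, h01⟩]
      change p + ∫ σ in (0 : ℝ)..0, F σ (IccExtend h01 z.1 σ) = p
      rw [intervalIntegral.integral_same, add_zero]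
    · rw [IccExtend_of_mem h01 _ hθ, IccExtend_of_mem h01 _ hθ']
      exact hlip z.1 z.2 θ hθ θ' hθ'⟩
  have hΦ : ContractingWith (1 / 2) Φ := by
    refine ⟨by rw [← NNReal.coe_lt_coe]; norm_num, LipschitzWith.of_dist_le_mul fun z z' => ?_⟩
    rw [Subtype.dist_eq, ContinuousMap.dist_le (by positivity)]
    intro θ
    have := P.norm_integral_sub_le z.2 z'.2 le_rfl (hint _ z.2) (hint _ z'.2) (d := dist z z')
      (fun σ hσ => by
        rw [IccExtend_of_mem h01 _ hσ, IccExtend_of_mem h01 _ hσ, ← dist_eq_norm]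
        exact ContinuousMap.dist_apply_le_dist _) θ.2
    rw [dist_eq_norm]
    change ‖(p + _) - (p + _)‖ ≤ _
    rw [add_sub_add_left_eq_sub, show ((1 / 2 : NNReal) : ℝ) = 1 / 2 by norm_num]
    exact this
  have : Nonempty A := ⟨⟨ContinuousMap.const _ p, ⟨by simp [IccExtend], fun θ _ θ' _ => by
    simp only [IccExtend, ContinuousMap.coe_const, Function.comp_apply, Function.const_apply,
      sub_self, norm_zero]
    positivity⟩⟩⟩
  have : CompleteSpace A := hclosed.completeSpace_coe
  obtain ⟨z, hz⟩ : ∃ z : A, Φ z = z := ⟨_, hΦ.fixedPoint_isFixedPt⟩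
  refine ⟨IccExtend h01 z.1, z.2.init, hint _ z.2, fun θ hθ => ?_⟩
  rw [z.2.init, IccExtend_of_mem h01 _ hθ]
  exact (congrArg (fun w : A => w.1 ⟨θ, hθ⟩) hz).symm

end

end PicardData

end WellPosed

/-! ### Global existence and uniqueness. -/

section Global

variable {E Q : Type*} [NormedAddCommGroup E] [NormedSpace ℝ E]
  [NormedAddCommGroup Q] [NormedSpace ℝ Q]
  {um : ℝ} {f g : E → E} {h : E → ℝ} {α : Q → ℝ × ℝ → ℝ → ℝ}
  {a : Q → ℝ × ℝ → ℝ → Q} {Hb : ℝ → E → Q → ℝ → ℝ → ℝ × ℝ}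
  {R B ε₁ r k lam R₀ δ T₀ : ℝ} {m : ℕ} {K ρ ε L : ℝ} {Z bar : ℝ → E × Q}

namespace TrackingData

section
variable [CompleteSpace E] [CompleteSpace Q]
  (D : TrackingData um f g h α a Hb R B ε₁ r k lam R₀ δ T₀ m K ρ ε Z bar)
include D

theorem picardData (hL : 0 ≤ L) (hα : MeasuredLipschitz um g h α Hb α R L ε)
    (ha : MeasuredLipschitz um g h α Hb a R L ε) (h1 : L * (2 * B ^ 2 + 1) * ε ≤ 2 * um)
    (h2 : (2 * B ^ 2 + L + 8 * B ^ 3 * L) * ε ≤ 1 / 2) {j : ℕ} {p : E × Q}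
    (hp : ‖p - bar (j * ε)‖ ≤ K * ε ^ 2) :
    PicardData um f g h α a Hb R B ε₁ ρ L ε j p where
  loop := D.loop
  hε := D.hε
  L_nonneg := hL
  duty := hα
  ctrl := ha
  slope := h1
  contraction := h2
  small := D.Bε_lt
  hρ := D.ρ_le
  norm_init := D.norm_le_of_near hp
  range := D.abs_duty_le_of_near hp

/-- Induction on the period: tracking places the common state at each grid time close enough to
`bar` for the one-period uniqueness to apply. -/
theorem eqOn_of_isSolution
    (hP : ∀ (j : ℕ) (p : E × Q), ‖p - bar (j * ε)‖ ≤ K * ε ^ 2 →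
      PicardData um f g h α a Hb R B ε₁ ρ L ε j p)
    {X Y : ℝ → E × Q} {T T' : ℝ} (hX : IsSolution (pwmField um f g α a Hb ε) 0 T X)
    (hY : IsSolution (pwmField um f g α a Hb ε) 0 T' Y) (hX0 : X 0 = bar 0) (hY0 : Y 0 = bar 0)
    {t : ℝ} (h0t : 0 ≤ t) (htT : t ≤ T) (htT' : t ≤ T') : X t = Y t := by
  have hε := D.hε.1
  have key : ∀ j : ℕ, ∀ t, 0 ≤ t → t ≤ T → t ≤ T' → t ≤ j * ε → X t = Y t := by
    intro j
    induction j with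
    | zero =>
      intro t h0 _ _ h1
      have : t = 0 := le_antisymm (by simpa using h1) h0
      rw [this, hX0, hY0]
    | succ j ih =>
      intro t h0 h1 h2 h3
      rcases le_or_gt t (j * ε) with h4 | h4
      · exact ih t h0 h1 h2 h4
      have hj0 : (0 : ℝ) ≤ j * ε := by positivity
      have hj := ih (j * ε) hj0 (h4.le.trans h1) (h4.le.trans h2) le_rfl
      set c := (t - j * ε) / ε with hc
      have hc0 : 0 ≤ c := div_nonneg (by linarith) hε.le
      have hc1 : c ≤ 1 := by
        rw [hc, div_le_one hε]; push_cast at h3; linarith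
      have et : j * ε + ε * c = t := by rw [hc]; field_simp; ring
      have hp := D.norm_sub_bar_le hX hX0 (h4.le.trans h1)
      have := (hP j _ hp).eqOn_of_isSolution hc0 hc1 (D.rescale_pwm hX hc0 (et.trans_le h1))
        (D.rescale_pwm hY hc0 (et.trans_le h2)) (by simp) (by simp [hj])
        ⟨hc0, le_rfl⟩
      simpa only [et] using this
  refine key ⌈t / ε⌉₊ t h0t htT htT' ?_
  rw [← div_le_iff₀ hε]
  exact Nat.le_ceil _

/-- The solution built so far is tracked up to its last instant, so a further period can be solved
from there and glued on, with no loss of smallness as `j` grows. -/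
theorem exists_isSolution_nat_mul (hf : Continuous f) (hg : Continuous g)
    (hP : ∀ (j : ℕ) (p : E × Q), ‖p - bar (j * ε)‖ ≤ K * ε ^ 2 →
      PicardData um f g h α a Hb R B ε₁ ρ L ε j p) (j : ℕ) :
    ∃ X : ℝ → E × Q, X 0 = bar 0 ∧ IsSolution (pwmField um f g α a Hb ε) 0 (j * ε) X := by
  have hε := D.hε.1
  induction j with
  | zero =>
    refine ⟨fun _ => bar 0, rfl, by simp, fun t ht => ?_⟩
    have : t = 0 := le_antisymm (by simpa using ht.2) ht.1
    rw [this, intervalIntegral.integral_same, add_zero]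
  | succ j ih =>
    obtain ⟨X, hX0, hX⟩ := ih
    obtain ⟨Y, hY0, hY⟩ := (hP j _ (D.norm_sub_bar_le hX hX0 le_rfl)).exists_isSolution hf hg
    have hY' := hY.unscale hε
    rw [mul_zero, add_zero, mul_one] at hY'
    have hj0 : (0 : ℝ) ≤ j * ε := by positivity
    have hj1 : ((j + 1 : ℕ) : ℝ) * ε = j * ε + ε := by push_cast; ring
    rw [hj1]
    refine ⟨_, ?_, hX.glue hY' hj0 (by linarith) (by simp [hY0])⟩
    simp only [if_pos hj0, hX0]

/-- Global existence for the PWM-fed loop. -/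
theorem exists_isSolution (hf : Continuous f) (hg : Continuous g)
    (hP : ∀ (j : ℕ) (p : E × Q), ‖p - bar (j * ε)‖ ≤ K * ε ^ 2 →
      PicardData um f g h α a Hb R B ε₁ ρ L ε j p) :
    ∃ X : ℝ → E × Q, X 0 = bar 0 ∧
      ∀ T, 0 ≤ T → IsSolution (pwmField um f g α a Hb ε) 0 T X := by
  have hε := D.hε.1
  choose X hX0 hX using D.exists_isSolution_nat_mul hf hg hP
  have hlt : ∀ t : ℝ, t ≤ ((⌊t / ε⌋₊ + 1 : ℕ) : ℝ) * ε := fun t => by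
    rw [← div_le_iff₀ hε]
    push_cast
    exact (Nat.lt_floor_add_one _).le
  -- At time `t` the value is read on a solution that lasts beyond `t`; uniqueness makes this choice
  -- consistent over any `[0, T]`.
  refine ⟨fun t => X (⌊t / ε⌋₊ + 1) t, hX0 _, fun T hT => ?_⟩
  refine ((hX (⌊T / ε⌋₊ + 1)).mono le_rfl hT (hlt T)).congr hT fun t ht => ?_
  exact D.eqOn_of_isSolution hP (hX _) (hX _) (hX0 _) (hX0 _) ht.1 (ht.2.trans (hlt T)) (hlt t)

end

end TrackingData

theorem MeasuredLipschitz.mono {G : Type*} [NormedAddCommGroup G] {φ : Q → ℝ × ℝ → ℝ → G} {L' : ℝ}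
    (hφ : MeasuredLipschitz um g h α Hb φ R L ε) (hL : L ≤ L') (hε : 0 ≤ ε) :
    MeasuredLipschitz um g h α Hb φ R L' ε :=
  fun j θ hθ θ' hθ' X X' hX hX' hu => (hφ j θ hθ θ' hθ' X X' hX hX' hu).trans (by gcongr)

open Filter Topology in
/-- When the remainder in the measured output is Lipschitz, the PWM-fed loop is well-posed along
any tracked ideal solution, for all small `ε`. -/
theorem eventually_existsUnique [FiniteDimensional ℝ E] [FiniteDimensional ℝ Q]
    (hf : Continuous f) (hg : ContDiff ℝ 2 g) (hh : ContDiff ℝ 3 h)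
    (hα : UniformC2 α) (ha : UniformC2 a) (hHb : IsCorrectedOutput um g h α Hb)
    (hLip : LipschitzRemainder um g h α Hb) {Z bar : ℝ → ℝ → E × Q}
    (hD : ∀ᶠ ε in 𝓝[>] 0,
      TrackingData um f g h α a Hb R B ε₁ r k lam R₀ δ T₀ m K ρ ε (Z ε) (bar ε)) :
    ∀ᶠ ε in 𝓝[>] 0, ∃ X : ℝ → E × Q, X 0 = bar ε 0 ∧
      (∀ T, 0 ≤ T → IsSolution (pwmField um f g α a Hb ε) 0 T X) ∧
      ∀ (T : ℝ) (Y : ℝ → E × Q), IsSolution (pwmField um f g α a Hb ε) 0 T Y → Y 0 = bar ε 0 →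
        ∀ t ∈ Icc 0 T, Y t = X t := by
  have := FiniteDimensional.complete ℝ E
  have := FiniteDimensional.complete ℝ Q
  obtain ⟨ε', D'⟩ := hD.exists
  have hε₁ : 0 < ε₁ := D'.hε.1.trans D'.hε.2
  have hum := D'.loop.um_pos
  obtain ⟨L, hL, hLα⟩ := exists_measuredLipschitz D'.loop hε₁ hg hh hα hHb hLip
  obtain ⟨L', hL', hLa⟩ := exists_measuredLipschitz D'.loop hε₁ hg hh ha hHb hLip
  filter_upwards [hD, hLα, hLa, self_mem_nhdsWithin,
    eventually_mul_lt (max L L' * (2 * B ^ 2 + 1)) (by linarith : 0 < 2 * um),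
    eventually_mul_lt (2 * B ^ 2 + max L L' + 8 * B ^ 3 * max L L') (by norm_num : (0 : ℝ) < 1 / 2)]
    with ε D h1 h2 hε h3 h4
  have hε0 : 0 ≤ ε := le_of_lt hε
  have hP : ∀ (j : ℕ) (p : E × Q), ‖p - bar ε (j * ε)‖ ≤ K * ε ^ 2 →
      PicardData um f g h α a Hb R B ε₁ ρ (max L L') ε j p := fun j p hp =>
    D.picardData (hL.trans (le_max_left _ _)) (h1.mono (le_max_left _ _) hε0)
      (h2.mono (le_max_right _ _) hε0) h3.le h4.le hp
  obtain ⟨X, hX0, hX⟩ := D.exists_isSolution hf hg.continuous hP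
  exact ⟨X, hX0, hX, fun T Y hY hY0 t ht =>
    D.eqOn_of_isSolution hP hY (hX T (ht.1.trans ht.2)) hY0 hX0 ht.1 ht.2 ht.2⟩

end Global

/-! ### Conclusion. -/

theorem theorem1 (n q : ℕ)
    (um : ℝ) (hum : 0 < um)
    (f g : EuclideanSpace ℝ (Fin n) → EuclideanSpace ℝ (Fin n))
    (h : EuclideanSpace ℝ (Fin n) → ℝ)
    (hf : ContDiff ℝ 2 f) (hg : ContDiff ℝ 2 g) (hh : ContDiff ℝ 3 h)
    (α : EuclideanSpace ℝ (Fin q) → ℝ × ℝ → ℝ → ℝ)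
    (a : EuclideanSpace ℝ (Fin q) → ℝ × ℝ → ℝ → EuclideanSpace ℝ (Fin q))
    (hα : UniformC2 α) (ha : UniformC2 a)
    (Hb : ℝ → EuclideanSpace ℝ (Fin n) → EuclideanSpace ℝ (Fin q) → ℝ → ℝ → ℝ × ℝ)
    (hHb : IsCorrectedOutput um g h α Hb)
    (x₀ : EuclideanSpace ℝ (Fin n)) (η₀ : EuclideanSpace ℝ (Fin q))
    (ε₁ : ℝ) (hε₁ : 0 < ε₁)
    -- the ideal closed loop has a bounded exponentially stable behavior, uniformly in `ε`,
    -- and the initial state lies in its region of exponential attraction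
    (Xref : ℝ → ℝ → EuclideanSpace ℝ (Fin n) × EuclideanSpace ℝ (Fin q))
    (r k lam : ℝ) (hr : 0 < r) (hlam : 0 < lam)
    (hstable : ∀ ε ∈ Set.Ioo 0 ε₁, ExpStable (idealField f g h α a ε) r k lam (Xref ε))
    (hbounded : ∃ B : ℝ, ∀ ε ∈ Set.Ioo 0 ε₁, ∀ t, 0 ≤ t → ‖Xref ε t‖ ≤ B)
    (hinit : ∀ ε ∈ Set.Ioo 0 ε₁, ‖(x₀, η₀) - Xref ε 0‖ ≤ r)
    -- the solution of the ideal closed loop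
    (xbar : ℝ → ℝ → EuclideanSpace ℝ (Fin n)) (ηbar : ℝ → ℝ → EuclideanSpace ℝ (Fin q))
    (hbar : ∀ ε ∈ Set.Ioo 0 ε₁, ∀ T, 0 ≤ T →
      IsSolution (idealField f g h α a ε) 0 T (fun t => (xbar ε t, ηbar ε t)))
    (hbar0 : ∀ ε ∈ Set.Ioo 0 ε₁,
      xbar ε 0 = x₀ - (ε * s1 um (α η₀ (extOutput g h ε x₀) 0) 0) • g x₀ ∧ ηbar ε 0 = η₀)
    -- near the ideal trajectory, the control does not exceed the range of the PWM encoder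
    (hrange : ∃ ρ : ℝ, 0 < ρ ∧ ∀ ε ∈ Set.Ioo 0 ε₁, ∀ t, 0 ≤ t → ∀ x η,
      ‖(x, η) - (xbar ε t, ηbar ε t)‖ ≤ ρ → |α η (extOutput g h ε x) t| ≤ um) :
    ∃ ε₀ K : ℝ, 0 < ε₀ ∧ ε₀ ≤ ε₁ ∧ 0 < K ∧ ∀ ε ∈ Set.Ioo 0 ε₀,
      -- the estimates, for every solution, as long as it is defined
      (∀ (T : ℝ) (x : ℝ → EuclideanSpace ℝ (Fin n)) (η : ℝ → EuclideanSpace ℝ (Fin q)),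
        IsSolution (pwmField um f g α a Hb ε) 0 T (fun t => (x t, η t)) →
        x 0 = x₀ → η 0 = η₀ →
        ∀ t ∈ Set.Icc 0 T,
          ‖x t - (xbar ε t +
            (ε * s1 um (α (ηbar ε t) (extOutput g h ε (xbar ε t)) t) (t / ε)) • g (xbar ε t))‖
              ≤ K * ε ^ 2 ∧
          ‖η t - ηbar ε t‖ ≤ K * ε ^ 2 ∧
          |h (x t) - (h (xbar ε t) + virtualOutput g h ε (xbar ε t) *
            s1 um (α (ηbar ε t) (extOutput g h ε (xbar ε t)) t) (t / ε))| ≤ K * ε ^ 2) ∧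
      -- the solution exists for all `t ≥ 0` and is unique
      (LipschitzRemainder um g h α Hb →
        ∃ (x : ℝ → EuclideanSpace ℝ (Fin n)) (η : ℝ → EuclideanSpace ℝ (Fin q)),
          x 0 = x₀ ∧ η 0 = η₀ ∧
          (∀ T, 0 ≤ T → IsSolution (pwmField um f g α a Hb ε) 0 T (fun t => (x t, η t))) ∧
          ∀ (T : ℝ) (x' : ℝ → EuclideanSpace ℝ (Fin n)) (η' : ℝ → EuclideanSpace ℝ (Fin q)),
            IsSolution (pwmField um f g α a Hb ε) 0 T (fun t => (x' t, η' t)) →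
            x' 0 = x₀ → η' 0 = η₀ → ∀ t ∈ Set.Icc 0 T, x' t = x t ∧ η' t = η t) := by
  obtain ⟨R₀, hR₀⟩ := hbounded
  obtain ⟨ρ, hρ, hρr⟩ := hrange
  -- The ripple vanishes at phase `0`, so the corrected initial state is the initial state itself.
  have hbar0' : ∀ ε ∈ Ioo 0 ε₁, ((xbar ε 0, ηbar ε 0) :
      EuclideanSpace ℝ (Fin n) × EuclideanSpace ℝ (Fin q)) = (x₀, η₀) := fun ε hε => by
    rw [(hbar0 ε hε).1, (hbar0 ε hε).2, s1_zero, mul_zero, zero_smul, sub_zero]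
  obtain ⟨R, B, ε₂, δ, T₀, m, K, ρ', hK, hB, hD⟩ := exists_trackingData hum hf hg hh hα ha hHb hε₁
    hr hlam hρ (bar := fun ε t => (xbar ε t, ηbar ε t)) hstable hR₀ hbar
    (fun ε hε => by simpa only [hbar0' ε hε] using hinit ε hε)
    (fun ε hε t ht X hX => hρr ε hε t ht X.1 X.2 hX)
  -- The threshold `ε₀` is chosen before `LipschitzRemainder` is assumed. Since this hypothesis does
  -- not involve `ε`, a case distinction yields one threshold valid for both conclusions.
  have hE : ∀ᶠ ε in nhdsWithin (0 : ℝ) (Ioi 0), LipschitzRemainder um g h α Hb →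
      ∃ X : ℝ → EuclideanSpace ℝ (Fin n) × EuclideanSpace ℝ (Fin q),
      X 0 = (xbar ε 0, ηbar ε 0) ∧
      (∀ T, 0 ≤ T → IsSolution (pwmField um f g α a Hb ε) 0 T X) ∧
      ∀ (T : ℝ) (Y : ℝ → EuclideanSpace ℝ (Fin n) × EuclideanSpace ℝ (Fin q)),
        IsSolution (pwmField um f g α a Hb ε) 0 T Y → Y 0 = (xbar ε 0, ηbar ε 0) →
        ∀ t ∈ Icc 0 T, Y t = X t := by
    by_cases hLip : LipschitzRemainder um g h α Hb
    · filter_upwards [eventually_existsUnique hf.continuous hg hh hα ha hHb hLip hD] with ε hε _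
      exact hε
    · exact Filter.Eventually.of_forall fun ε h => absurd h hLip
  obtain ⟨ε₀, hε₀, hsub⟩ := mem_nhdsGT_iff_exists_Ioo_subset.1
    ((hD.and hE).and (Ioo_mem_nhdsGT hε₁))
  refine ⟨min ε₀ ε₁, 66 * B ^ 5 + 7 * B ^ 3 * K, lt_min hε₀ hε₁, min_le_right _ _, by positivity,
    fun ε hε => ?_⟩
  obtain ⟨⟨D, hex⟩, hεε⟩ := hsub ⟨hε.1, hε.2.trans_le (min_le_left _ _)⟩
  have h0 := hbar0' ε hεε
  refine ⟨fun T x η hX hx0 hη0 t ht => ?_, fun hLip => ?_⟩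
  · exact D.estimates hX (by simp only [hx0, hη0, h0]) ht
  · obtain ⟨X, hX0, hX, hu⟩ := hex hLip
    rw [h0] at hX0
    refine ⟨fun t => (X t).1, fun t => (X t).2, congrArg Prod.fst hX0, congrArg Prod.snd hX0, hX,
      fun T x' η' hX' hx0 hη0 t ht => ?_⟩
    have := hu T _ hX' (by simp only [hx0, hη0, h0]) t ht
    exact ⟨congrArg Prod.fst this, congrArg Prod.snd this⟩
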